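/- **Theorem.** The distributed ticket-lock implementation $I_{WL}$ is a well-defined and sound implementation of the weak-lock library WLOCK using the libraries RDMA (remote direct memory access with remote read-modify-writes) and SV (shared variables): for every concurrent program $\vec p$ over the calls of RDMA, SV and WLOCK with $\mathrm{loc}(I_{WL})\cap \mathrm{loc}(\vec p)=\emptyset$, $$\mathrm{outcome}_{\{\mathrm{RDMA},\mathrm{SV}\}}\big(\vec p\,[I_{WL}]\big)\ \subseteq\ \mathrm{outcome}_{\{\mathrm{RDMA},\mathrm{SV},\mathrm{WLOCK}\}}(\vec p),$$ where $\vec p\,[I_{WL}]$ is $\vec p$ with every WLOCK call replaced by its implementation. The terms are as follows. *Setting.* There are finitely many threads $1,\dots,T$, each on a node $n(t)$; every location $x$ has a node $n(x)$; $d$ ranges over work identifiers. Values have a unit value $()$, $0$, $1$ and an addition (an additive monoid) in which $0,1,1+1,\dots$ are pairwise distinct, so tickets do not wrap around. *Programs.* $p ::= v \mid m(\vec v)\mid \mathtt{let}\ p\ \mathtt{in}\ f\mid \mathtt{loop}\ p\mid \mathtt{break}_k\,v$ ($f$ a function from values to programs, $k\ge 1$). A run of a thread generates a set of events $\langle t,\iota,\langle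 m,\vec v,v'\rangle\rangle$ (thread, identifier, call, output), totally ordered by program order $po$, each call a priori with an arbitrary output; a concurrent program has one program per thread, all terminating with break number $0$. $\mathrm{loc}(\vec p)$ is the set of locations accessed by events of runs of $\vec p$; $\mathrm{loc}(I)$ is that for all implementations $I(t,m,\vec v)$ of calls. $I$ is *well-defined* if the implemented library is not among those used, each $I(t,m,\vec v)$ calls only methods of those, never ends with a nonzero break number, and has at least one event in each terminating run. *Executions.* Stamps are $aCR,aCW,aCAS,aMF,aWT$ and, for each node $n$, $nlR_n,nrW_n,narR_n,nrR_n,nlW_n,nF_n,GF_n$. The stamp order $sto$ relates (earlier, later): each of $aCR,aCAS,aMF,aWT,GF_n$ to all stamps; $aCW$ to all stamps except $aCR,aWT$; and, for the same $n$ only, $nlR_n$ and $nF_n$ to all of the seven families; $nrW_n$ to $nrW_n,narR_n,nrR_n,nlW_n,GF_n$; $narR_n$ to $nrW_n,narR_n,nrR_n,nlW_n,nF_n,GF_n$; $nrR_n$ to $nlW_n,nF_n,GF_n$; $nlW_n$ to $nlW_n,GF_n$. An execution is $\langle E,po,stmp,so,hb\rangle$, where $stmp$ gives each event a non-empty set of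 stamps, a subevent is a pair of an event and one of its stamps, $ppo$ relates $\langle e_1,a_1\rangle$ to $\langle e_2,a_2\rangle$ if $(e_1,e_2)\in po$ and $(a_1,a_2)\in sto$, and $hb$ is a strict partial order on subevents containing $so\cup ppo$. Read subevents have stamps $aCR,aCAS,nlR,narR,nrR$; write subevents $aCW,aCAS,nlW,nrW$. An execution is $\Lambda$-consistent if its restriction to each library of $\Lambda$ is consistent for it, all events are calls of these libraries, and each $so$ edge is within one library. $\mathrm{outcome}_\Lambda(\vec p)$ is the set of output tuples of runs of $\vec p$ that extend to a $\Lambda$-consistent execution. Below, $[A]$ is the identity on $A$, $r_1;r_2$ composition, $\mathrm{imm}(r)=r\setminus(r;r)$, and two events have "the same $d$" if their calls carry the same work identifier. Methods other than $\mathtt{Read}$, $\mathtt{CAS}$, $\mathtt{Read}_{SV}$ return $()$. *RDMA.* Calls and stamps: $\mathtt{Write}(x,v)$: $\{aCW\}$; $\mathtt{Read}(x)$: $\{aCR\}$; $\mathtt{CAS}(x,v_1,v_2)$: $\{aCAS\}$ if it returns $v_1$, else $\{aMF,aCR\}$; $\mathtt{Mfence}()$: $\{aMF\}$; $\mathtt{Get}(x,y,d)$: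 $\{nrR_n,nlW_n\}$ with $n=n(y)$; $\mathtt{Put}(x,y,d)$: $\{nlR_n,nrW_n\}$ with $n=n(x)$; $\mathtt{Wait}(d)$: $\{aWT\}$; $\mathtt{Rfence}(n)$: $\{nF_n\}$; $\mathtt{RFAA}(x,y,v,d)$: $\{narR_n,nrW_n,nlW_n\}$, and $\mathtt{RCAS}(x,y,v_1,v_2,d)$: this set (success) or $\{narR_n,nlW_n\}$ (failure), with $n=n(y)$. In $\mathtt{Put}$ the location $y$, in the others $x$, must be on the node of the thread. A subevent accesses: the location of the call for CPU operations; for the remote ones, $nlR,nlW$ access the local location and $nrR,narR,nrW$ the remote one. An execution is consistent if it is so addressed and stamped and there are values $v_R,v_W$ of the read and write subevents and relations $rf,mo,nfo,rao$ such that: $v_R$ of a $\mathtt{Read}$ or $\mathtt{CAS}$ is its output, $v_W$ of a $\mathtt{Write}$ or successful $\mathtt{CAS}$ is the value given; for subevents of one event and the same $n$, $v_R(nlR_n)=v_W(nrW_n)$, $v_R(nrR_n)=v_W(nlW_n)$, $v_R(narR_n)=v_W(nlW_n)$; a successful $\mathtt{RCAS}$ has $v_R(narR)=v_1$, $v_W(nrW)=v_2$,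 a failing one $v_R(narR)\ne v_1$; an $\mathtt{RFAA}$ has $v_W(nrW)=v_R(narR)+v$; $rf$ relates writes to reads of the same location and value, each read to at most one write, and unrelated reads have value $0$; $mo$ is a union of strict total orders on the writes of each location; $nfo$ is a relation on subevents that relates, in one direction or the other, any two subevents of one thread with stamps in $nlR_n\times nlW_n$ or $\{nrR_n,narR_n\}\times nrW_n$; $rao$ is a union over nodes $n$ of strict total orders on the $narR_n$ subevents of $\mathtt{RFAA}$s and $\mathtt{RCAS}$s; $ib$ is irreflexive; and $$so = iso\cup rf_e\cup pfg\cup nfo\cup rb\cup mo\cup rao\cup([nrW];iso^{-1};rao)\cup([\mathrm{Inst}];ib).$$ Here $\mathrm{Inst}$ is the set of subevents without stamp $aCW,nlW,nrW$; $rb$ relates a read $r$ to every write $w\neq r$ of the same location if $(r,w)\in rf^{-1};mo$ or $r$ is $rf$-unrelated; $rf_i=[aCW];(po\cap rf);[aCR]$; $rf_e=rf\setminus rf_i$; $rb_i=[aCR];((po\cup po^{-1})\cap rb);[aCW]$; $pfg$ (resp. $pfp$) relates $nlW$ (resp. $nrW$) subevents to $po$-later $aWT$ subevents with the same $d$; $iso$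 relates, within one event, $aMF$ to $aCR$ ($\mathtt{CAS}$), $nrR_n$ to $nlW_n$ ($\mathtt{Get}$), $nlR_n$ to $nrW_n$ ($\mathtt{Put}$), $narR_n$ to $nlW_n$ and to $nrW_n$ ($\mathtt{RCAS},\mathtt{RFAA}$); and $ib=(ppo\cup([aCW];po;[aCR\cup aWT])\cup\bigcup_n([nrW_n\cup nlW_n];po;[nF_n])\cup iso\cup rf\cup pfg\cup pfp\cup nfo\cup rb_i)^+$. *SV.* Calls and stamps: $\mathtt{Write}_{SV}(x,v)$: $\{aCW\}$; $\mathtt{Read}_{SV}(x)$: $\{aCR\}$; $\mathtt{Bcast}_{SV}(x,d,N)$: $\{nlR_n,nrW_n: n\in N\}$; $\mathtt{Wait}_{SV}(d)$: $\{aWT\}$; $\mathtt{GFence}(N)$: $\{GF_n:n\in N\}$. Writes on node $n$ are the $aCW$ subevents of threads on $n$ and all $nrW_n$; reads on $n$ are the reads of threads on $n$. An execution is consistent if it is so stamped and there are $v_R,v_W$ (output of $\mathtt{Read}_{SV}$, argument of $\mathtt{Write}_{SV}$, $v_R(nlR_n)=v_W(nrW_n)$ within a broadcast), for each $n$ a relation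 $rf^n$ from writes on $n$ to reads on $n$ of the same location and value, each read related to at most one write and with value $0$ if related to none, and strict total orders $mo^n_x$ on the writes of $x$ on $n$, such that $[aCR];(po^{-1}\cap rb);[aCW]=\emptyset$ and $so=iso\cup rf_e\cup pf\cup rb\cup mo$. Here $rf,mo$ are the unions, $rf_e$ is as above, $rb$ is the union of the relations $rb^n$ (from reads $r$ to writes $w$ on $n$ of the same location with $(r,w)\in(rf^n)^{-1};mo^n$ or $r$ being $rf^n$-unrelated), $pf$ relates $nlR$ subevents to $po$-later $aWT$ subevents with the same $d$, and $iso$ relates $nlR_n$ to $nrW_n$ within a broadcast. *WLOCK.* Calls $\mathtt{Acq}(x)$, $\mathtt{Rel}(x)$. Let $po_x$ be $po$ restricted to lock events on $x$. An execution is lock-well-formed if, for all $x$, each acquire $a$ of $x$ has a release $r$ of $x$ with $(a,r)\in\mathrm{imm}(po_x)$, and each release $r$ of $x$ has an acquire $a$ of $x$ with $(a,r)\in\mathrm{imm}(po_x)$. All executions that are not lock-well-formed are consistent. A lock-well-formed one is consistent iff acquires have stamps $\{aMF\}$, releases $\{aCW\}$, all outputs are $()$, and for some strict total orders $lo_x$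 on the acquires of $x$, $$so=\bigcup_x\{\langle\langle e_1,aCW\rangle,\langle e_2,aMF\rangle\rangle : (e_1,e_2)\in \mathrm{imm}(po_x)^{-1};lo_x\}.$$ *The implementation.* For each $x$ fix locations $x_a$ (on any node), $p^t_x$ (on node $n(t)$) and $x_t$ ($1\le t\le T$), all pairwise distinct for all $x,t$; work identifiers $d,d'$ are arbitrary. $I_{WL}(t,\mathtt{Acq},x)$ is $\mathtt{RFAA}(p^t_x,x_a,1,d);\ \mathtt{Wait}(d);\ \mathtt{let}\ v=\mathtt{Read}(p^t_x)\ \mathtt{in}\ \mathtt{loop}\{\mathtt{if}\ \mathtt{Read}_{SV}(x_1)=v\ \mathtt{then}\ \mathtt{break}\ \mathtt{else}\ \dots\ \mathtt{if}\ \mathtt{Read}_{SV}(x_T)=v\ \mathtt{then}\ \mathtt{break}\}$, and $I_{WL}(t,\mathtt{Rel},x)$ is $\mathtt{let}\ v=\mathtt{Read}(p^t_x)\ \mathtt{in}\ \mathtt{Write}_{SV}(x_t,v+1);\ \mathtt{Bcast}_{SV}(x_t,d',\mathrm{Node}\setminus\{n(t)\})$. -/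

import Mathlib

namespace Mowgli

/-! ## Generic framework: programs, executions, libraries, soundness -/

/-- Stamps. The constructors with an argument are the stamp families indexed by a node. -/
inductive Stamp (Node : Type*) where
  | aCR | aCW | aCAS | aMF | aWT
  | nlr (n : Node) | nrw (n : Node) | narr (n : Node) | nrr (n : Node)
  | nlw (n : Node) | nf (n : Node) | gf (n : Node)

/-- The stamp order: which pairs (earlier, later) of stamps keep their program order. -/
def Stamp.sto {Node : Type*} : Stamp Node → Stamp Node → Prop
  | .aCR, _ => True
  | .aCAS, _ => True
  | .aMF, _ => True
  | .aWT, _ => True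
  | .gf _, _ => True
  | .aCW, .aCR => False
  | .aCW, .aWT => False
  | .aCW, _ => True
  | .nlr n, .nlr m => n = m
  | .nlr n, .nrw m => n = m
  | .nlr n, .narr m => n = m
  | .nlr n, .nrr m => n = m
  | .nlr n, .nlw m => n = m
  | .nlr n, .nf m => n = m
  | .nlr n, .gf m => n = m
  | .nlr _, _ => False
  | .nrw n, .nrw m => n = m
  | .nrw n, .narr m => n = m
  | .nrw n, .nrr m => n = m
  | .nrw n, .nlw m => n = m
  | .nrw n, .gf m => n = m
  | .nrw _, _ => False
  | .narr n, .nrw m => n = m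
  | .narr n, .narr m => n = m
  | .narr n, .nrr m => n = m
  | .narr n, .nlw m => n = m
  | .narr n, .nf m => n = m
  | .narr n, .gf m => n = m
  | .narr _, _ => False
  | .nrr n, .nlw m => n = m
  | .nrr n, .nf m => n = m
  | .nrr n, .gf m => n = m
  | .nrr _, _ => False
  | .nlw n, .nlw m => n = m
  | .nlw n, .gf m => n = m
  | .nlw _, _ => False
  | .nf n, .nlr m => n = m
  | .nf n, .nrw m => n = m
  | .nf n, .narr m => n = m
  | .nf n, .nrr m => n = m
  | .nf n, .nlw m => n = m
  | .nf n, .nf m => n = m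
  | .nf n, .gf m => n = m
  | .nf _, _ => False

/-- Stamps of read subevents. -/
def Stamp.IsRead {Node : Type*} : Stamp Node → Prop
  | .aCR | .aCAS | .nlr _ | .narr _ | .nrr _ => True
  | _ => False

/-- Stamps of write subevents. -/
def Stamp.IsWrite {Node : Type*} : Stamp Node → Prop
  | .aCW | .aCAS | .nlw _ | .nrw _ => True
  | _ => False

/-- Stamps of instantaneous subevents. -/
def Stamp.IsInst {Node : Type*} : Stamp Node → Prop
  | .aCW | .nlw _ | .nrw _ => False
  | _ => True

/-- `r` is a strict total order on the set `A` (and relates only elements of `A`). -/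
structure StrictTotalOn {α : Type*} (r : α → α → Prop) (A : Set α) : Prop where
  sub : ∀ a b, r a b → a ∈ A ∧ b ∈ A
  irrefl : ∀ a, ¬ r a a
  trans : ∀ a b c, r a b → r b c → r a c
  total : ∀ a ∈ A, ∀ b ∈ A, a ≠ b → r a b ∨ r b a

/-- Immediate edges of a relation: `r \ (r ; r)`. -/
def imm {α : Type*} (r : α → α → Prop) (a b : α) : Prop :=
  r a b ∧ ¬ ∃ c, r a c ∧ r c b

/-- Sequential programs over method calls `M` (a method name with its arguments). -/
inductive SeqProg (Val M : Type*) where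
  | val (v : Val)
  | call (c : M)
  | letIn (p : SeqProg Val M) (f : Val → SeqProg Val M)
  | loop (p : SeqProg Val M)
  | brk (k : ℕ+) (v : Val)

/-- Events: executing thread, identifier, method call, output value. -/
@[ext] structure Event (Val M : Type*) (T : ℕ) where
  thread : Fin T
  ident : ℕ
  call : M
  out : Val

/-- Subevents: an event together with one stamp. -/
abbrev SubEvent (Val M Node : Type*) (T : ℕ) := Event Val M T × Stamp Node

/-- The first two components (events and program order) of an execution. -/
structure Plain (Val M : Type*) (T : ℕ) where
  E : Set (Event Val M T)
  po : Event Val M T → Event Val M T → Prop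

namespace Plain
variable {Val M : Type*} {T : ℕ}

def empty : Plain Val M T := ⟨∅, fun _ _ => False⟩

def single (e : Event Val M T) : Plain Val M T := ⟨{e}, fun _ _ => False⟩

/-- Sequential composition (used for disjoint event sets only). -/
def seq (G₁ G₂ : Plain Val M T) : Plain Val M T :=
  ⟨G₁.E ∪ G₂.E, fun a b => G₁.po a b ∨ G₂.po a b ∨ (a ∈ G₁.E ∧ b ∈ G₂.E)⟩

/-- Parallel composition of one plain execution per thread. -/
def par (G : Fin T → Plain Val M T) : Plain Val M T :=
  ⟨⋃ t, (G t).E, fun a b => ∃ t, (G t).po a b⟩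

end Plain

/-- `Sem t p v k G`: executed by thread `t`, the program `p` can unfold into the plain
execution `G` with output value `v` and break number `k`. -/
inductive Sem {Val M : Type*} {T : ℕ} (t : Fin T) :
    SeqProg Val M → Val → ℕ → Plain Val M T → Prop where
  | val (v : Val) : Sem t (.val v) v 0 Plain.empty
  | brk (k : ℕ+) (v : Val) : Sem t (.brk k v) v k Plain.empty
  | call (c : M) (i : ℕ) (v : Val) : Sem t (.call c) v 0 (Plain.single ⟨t, i, c, v⟩)
  | letIn {p : SeqProg Val M} {f : Val → SeqProg Val M} {v r : Val} {k : ℕ}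
      {G₁ G₂ : Plain Val M T} : Sem t p v 0 G₁ → Sem t (f v) r k G₂ → Disjoint G₁.E G₂.E →
      Sem t (.letIn p f) r k (G₁.seq G₂)
  | letBrk {p : SeqProg Val M} {f : Val → SeqProg Val M} {v : Val} {k : ℕ}
      {G : Plain Val M T} : Sem t p v k G → k ≠ 0 → Sem t (.letIn p f) v k G
  | loopBrk {p : SeqProg Val M} {v : Val} {k : ℕ} {G : Plain Val M T} :
      Sem t p v (k + 1) G → Sem t (.loop p) v k G
  | loopNext {p : SeqProg Val M} {v r : Val} {k : ℕ} {G₁ G₂ : Plain Val M T} :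
      Sem t p v 0 G₁ → Sem t (.loop p) r k G₂ → Disjoint G₁.E G₂.E →
      Sem t (.loop p) r k (G₁.seq G₂)

/-- Concurrent programs: one sequential program per thread. -/
abbrev Prog (Val M : Type*) (T : ℕ) := Fin T → SeqProg Val M

/-- Plain semantics of concurrent programs: every thread terminates with break number `0`. -/
def ProgSem {Val M : Type*} {T : ℕ} (p : Prog Val M T) (v : Fin T → Val)
    (G : Plain Val M T) : Prop :=
  ∃ Gs : Fin T → Plain Val M T, (∀ t, Sem t (p t) (v t) 0 (Gs t)) ∧ G = Plain.par Gs

/-- The components of an execution; `Exec.Valid` states the requirements on them. Only the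
values of `stmp` on `E` are relevant. -/
structure Exec (Val M Node : Type*) (T : ℕ) extends Plain Val M T where
  stmp : Event Val M T → Set (Stamp Node)
  so : SubEvent Val M Node T → SubEvent Val M Node T → Prop
  hb : SubEvent Val M Node T → SubEvent Val M Node T → Prop

namespace Exec
variable {Val M Node : Type*} {T : ℕ}

/-- The set of subevents. -/
def SE (G : Exec Val M Node T) : Set (SubEvent Val M Node T) :=
  {s | s.1 ∈ G.E ∧ s.2 ∈ G.stmp s.1}

/-- Read subevents. -/
def Reads (G : Exec Val M Node T) : Set (SubEvent Val M Node T) := {s ∈ G.SE | s.2.IsRead}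

/-- Write subevents. -/
def Writes (G : Exec Val M Node T) : Set (SubEvent Val M Node T) := {s ∈ G.SE | s.2.IsWrite}

/-- Preserved program order. -/
def ppo (G : Exec Val M Node T) (s₁ s₂ : SubEvent Val M Node T) : Prop :=
  s₁ ∈ G.SE ∧ s₂ ∈ G.SE ∧ G.po s₁.1 s₂.1 ∧ Stamp.sto s₁.2 s₂.2

/-- The tuple is an execution. -/
structure Valid (G : Exec Val M Node T) : Prop where
  po_sub : ∀ a b, G.po a b → a ∈ G.E ∧ b ∈ G.E ∧ a.thread = b.thread
  po_irrefl : ∀ a, ¬ G.po a a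
  po_trans : ∀ a b c, G.po a b → G.po b c → G.po a c
  po_total : ∀ a ∈ G.E, ∀ b ∈ G.E, a.thread = b.thread → a ≠ b → G.po a b ∨ G.po b a
  stmp_nonempty : ∀ e ∈ G.E, (G.stmp e).Nonempty
  so_sub : ∀ s₁ s₂, G.so s₁ s₂ → s₁ ∈ G.SE ∧ s₂ ∈ G.SE
  hb_sub : ∀ s₁ s₂, G.hb s₁ s₂ → s₁ ∈ G.SE ∧ s₂ ∈ G.SE
  hb_trans : ∀ s₁ s₂ s₃, G.hb s₁ s₂ → G.hb s₂ s₃ → G.hb s₁ s₃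
  hb_irrefl : ∀ s, ¬ G.hb s s
  so_hb : ∀ s₁ s₂, G.so s₁ s₂ → G.hb s₁ s₂
  ppo_hb : ∀ s₁ s₂, G.ppo s₁ s₂ → G.hb s₁ s₂

/-- Restriction of an execution to the events whose method call lies in `C`. -/
def restrict (G : Exec Val M Node T) (C : Set M) : Exec Val M Node T where
  E := {e ∈ G.E | e.call ∈ C}
  po a b := G.po a b ∧ a.call ∈ C ∧ b.call ∈ C
  stmp := G.stmp
  so s₁ s₂ := G.so s₁ s₂ ∧ s₁.1.call ∈ C ∧ s₂.1.call ∈ C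
  hb s₁ s₂ := G.hb s₁ s₂ ∧ s₁.1.call ∈ C ∧ s₂.1.call ∈ C

end Exec

/-- A library: its method calls, the locations accessed by a call, its consistent executions. -/
structure Library (Val M Loc Node : Type*) (T : ℕ) where
  calls : Set M
  loc : M → Set Loc
  consistent : Set (Exec Val M Node T)

section Soundness
variable {Val M Loc Node : Type*} {T : ℕ}

/-- Consistency of an execution against a set of libraries. -/
structure Consistent (Λ : Set (Library Val M Loc Node T)) (G : Exec Val M Node T) : Prop where
  valid : G.Valid
  lib : ∀ L ∈ Λ, G.restrict L.calls ∈ L.consistent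
  events : ∀ e ∈ G.E, ∃ L ∈ Λ, e.call ∈ L.calls
  sync : ∀ s₁ s₂, G.so s₁ s₂ → ∃ L ∈ Λ, s₁.1.call ∈ L.calls ∧ s₂.1.call ∈ L.calls

/-- The output values of the `Λ`-consistent executions of `p`. -/
def outcome (Λ : Set (Library Val M Loc Node T)) (p : Prog Val M T) : Set (Fin T → Val) :=
  {v | ∃ G : Exec Val M Node T, Consistent Λ G ∧ ProgSem p v G.toPlain}

/-- An implementation maps each thread and method call to a sequential program. Only its values
on the calls of the implemented library are relevant. -/
abbrev Impl (Val M : Type*) (T : ℕ) := Fin T → M → SeqProg Val M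

open Classical in
/-- Replace all calls in `C` by their implementation, in a program of thread `t`. -/
noncomputable def inlineSeq (C : Set M) (I : Impl Val M T) (t : Fin T) :
    SeqProg Val M → SeqProg Val M
  | .val v => .val v
  | .call c => if c ∈ C then I t c else .call c
  | .letIn p f => .letIn (inlineSeq C I t p) (fun v => inlineSeq C I t (f v))
  | .loop p => .loop (inlineSeq C I t p)
  | .brk k v => .brk k v

/-- Replace all calls of the library `L` by their implementation, in a concurrent program. -/
noncomputable def inline (L : Library Val M Loc Node T) (I : Impl Val M T) (p : Prog Val M T) :
    Prog Val M T :=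
  fun t => inlineSeq L.calls I t (p t)

/-- Locations accessed by a call of one of the libraries. -/
def callLoc (Λ : Set (Library Val M Loc Node T)) (c : M) : Set Loc :=
  {x | ∃ L ∈ Λ, c ∈ L.calls ∧ x ∈ L.loc c}

/-- Locations that the implementation `I` of `L` can access. -/
def implLoc (Λ : Set (Library Val M Loc Node T)) (L : Library Val M Loc Node T)
    (I : Impl Val M T) : Set Loc :=
  {x | ∃ (t : Fin T) (c : M) (v : Val) (k : ℕ) (G : Plain Val M T),
    c ∈ L.calls ∧ Sem t (I t c) v k G ∧ ∃ e ∈ G.E, x ∈ callLoc Λ e.call}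

/-- Locations that the concurrent program `p` can access. -/
def progLoc (Λ : Set (Library Val M Loc Node T)) (p : Prog Val M T) : Set Loc :=
  {x | ∃ (v : Fin T → Val) (G : Plain Val M T),
    ProgSem p v G ∧ ∃ e ∈ G.E, x ∈ callLoc Λ e.call}

/-- The program only contains calls from `C`. -/
inductive CallsIn (C : Set M) : SeqProg Val M → Prop where
  | val (v : Val) : CallsIn C (.val v)
  | brk (k : ℕ+) (v : Val) : CallsIn C (.brk k v)
  | call {c : M} : c ∈ C → CallsIn C (.call c)
  | letIn {p : SeqProg Val M} {f : Val → SeqProg Val M} :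
      CallsIn C p → (∀ v, CallsIn C (f v)) → CallsIn C (.letIn p f)
  | loop {p : SeqProg Val M} : CallsIn C p → CallsIn C (.loop p)

/-- `I` is a well-defined implementation of `L` using `Λ`. -/
structure WellDefined (Λ : Set (Library Val M Loc Node T)) (L : Library Val M Loc Node T)
    (I : Impl Val M T) : Prop where
  not_mem : L ∉ Λ
  calls : ∀ t, ∀ c ∈ L.calls, CallsIn (⋃ L' ∈ Λ, L'.calls) (I t c)
  no_break : ∀ t, ∀ c ∈ L.calls, ∀ v k G, ¬ Sem t (I t c) v (k + 1) G
  nonempty : ∀ t, ∀ c ∈ L.calls, ∀ v G, Sem t (I t c) v 0 G → G.E.Nonempty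

/-- `I` is a sound implementation of `L` using `Λ`. -/
def Sound (Λ : Set (Library Val M Loc Node T)) (L : Library Val M Loc Node T)
    (I : Impl Val M T) : Prop :=
  ∀ p : Prog Val M T, Disjoint (implLoc Λ L I) (progLoc (insert L Λ) p) →
    outcome Λ (inline L I p) ⊆ outcome (insert L Λ) p

end Soundness

/-! ## Method calls of the three libraries -/

/-- Calls of the base RDMA library: CPU operations, remote operations, and remote RMWs. -/
inductive RdmaCall (Val Loc Node Wid : Type*) where
  | write (x : Loc) (v : Val)
  | read (x : Loc)
  | cas (x : Loc) (v₁ v₂ : Val)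
  | mfence
  | get (x y : Loc) (d : Wid)
  | put (x y : Loc) (d : Wid)
  | wait (d : Wid)
  | rfence (n : Node)
  | rcas (x y : Loc) (v₁ v₂ : Val) (d : Wid)
  | rfaa (x y : Loc) (v : Val) (d : Wid)

/-- Calls of the shared-variable library. -/
inductive SvCall (Val Loc Node Wid : Type*) where
  | write (x : Loc) (v : Val)
  | read (x : Loc)
  | bcast (x : Loc) (d : Wid) (N : Set Node)
  | wait (d : Wid)
  | gfence (N : Set Node)

/-- Calls of the weak lock library. -/
inductive LockCall (Loc : Type*) where
  | acq (x : Loc)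
  | rel (x : Loc)

inductive Call (Val Loc Node Wid : Type*) where
  | rdma (c : RdmaCall Val Loc Node Wid)
  | sv (c : SvCall Val Loc Node Wid)
  | lock (c : LockCall Loc)

/-- The work identifier of a call, if it has one. -/
def Call.wid {Val Loc Node Wid : Type*} : Call Val Loc Node Wid → Option Wid
  | .rdma (.get _ _ d) => some d
  | .rdma (.put _ _ d) => some d
  | .rdma (.wait d) => some d
  | .rdma (.rcas _ _ _ _ d) => some d
  | .rdma (.rfaa _ _ _ d) => some d
  | .sv (.bcast _ d _) => some d
  | .sv (.wait d) => some d
  | _ => none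

/-- The unit value `()`, the node of each thread, and the node of each location. -/
structure Sys (Val Loc Node : Type*) (T : ℕ) where
  unit : Val
  threadNode : Fin T → Node
  locNode : Loc → Node

/-- `po` restricted to the events with some common work identifier. -/
def poWid {Val Loc Node Wid : Type*} {T : ℕ} (G : Exec Val (Call Val Loc Node Wid) Node T)
    (a b : Event Val (Call Val Loc Node Wid) T) : Prop :=
  G.po a b ∧ ∃ d, a.call.wid = some d ∧ b.call.wid = some d

/-! ## The base RDMA library with remote RMWs -/

section Rdma
variable {Val Loc Node Wid : Type*} {T : ℕ}

local notation "Ev" => Event Val (Call Val Loc Node Wid) T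
local notation "SEv" => SubEvent Val (Call Val Loc Node Wid) Node T
local notation "Ex" => Exec Val (Call Val Loc Node Wid) Node T

def RdmaCall.loc : RdmaCall Val Loc Node Wid → Set Loc
  | .write x _ => {x}
  | .read x => {x}
  | .cas x _ _ => {x}
  | .get x y _ => {x, y}
  | .put x y _ => {x, y}
  | .rcas x y _ _ _ => {x, y}
  | .rfaa x y _ _ => {x, y}
  | _ => ∅

/-- Locations of a subevent of an RDMA call. -/
def RdmaCall.subLoc : RdmaCall Val Loc Node Wid → Stamp Node → Set Loc
  | .get _ y _, .nrr _ => {y}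
  | .get x _ _, .nlw _ => {x}
  | .get _ _ _, _ => ∅
  | .put _ y _, .nlr _ => {y}
  | .put x _ _, .nrw _ => {x}
  | .put _ _ _, _ => ∅
  | .rcas _ y _ _ _, .narr _ => {y}
  | .rcas _ y _ _ _, .nrw _ => {y}
  | .rcas x _ _ _ _, .nlw _ => {x}
  | .rcas _ _ _ _ _, _ => ∅
  | .rfaa _ y _ _, .narr _ => {y}
  | .rfaa _ y _ _, .nrw _ => {y}
  | .rfaa x _ _ _, .nlw _ => {x}
  | .rfaa _ _ _ _, _ => ∅
  | c, _ => c.loc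

/-- The locations that must be local to thread `t` are. -/
def RdmaCall.Addressed (σ : Sys Val Loc Node T) (t : Fin T) :
    RdmaCall Val Loc Node Wid → Prop
  | .write x _ => σ.locNode x = σ.threadNode t
  | .read x => σ.locNode x = σ.threadNode t
  | .cas x _ _ => σ.locNode x = σ.threadNode t
  | .get x _ _ => σ.locNode x = σ.threadNode t
  | .put _ y _ => σ.locNode y = σ.threadNode t
  | .rcas x _ _ _ _ => σ.locNode x = σ.threadNode t
  | .rfaa x _ _ _ => σ.locNode x = σ.threadNode t
  | .mfence => True
  | .wait _ => True
  | .rfence _ => True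

/-- The allowed stamp sets of a call with a given output. -/
def RdmaCall.stamps (σ : Sys Val Loc Node T) :
    RdmaCall Val Loc Node Wid → Val → Set (Set (Stamp Node))
  | .write _ _, _ => {{.aCW}}
  | .read _, _ => {{.aCR}}
  | .cas _ v₁ _, v => {A | (v₁ ≠ v ∧ A = {.aMF, .aCR}) ∨ (v₁ = v ∧ A = {.aCAS})}
  | .mfence, _ => {{.aMF}}
  | .get _ y _, _ => {{.nrr (σ.locNode y), .nlw (σ.locNode y)}}
  | .put x _ _, _ => {{.nlr (σ.locNode x), .nrw (σ.locNode x)}}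
  | .wait _, _ => {{.aWT}}
  | .rfence n, _ => {{.nf n}}
  | .rcas _ y _ _ _, _ =>
      {{.narr (σ.locNode y), .nlw (σ.locNode y)},
       {.narr (σ.locNode y), .nrw (σ.locNode y), .nlw (σ.locNode y)}}
  | .rfaa _ y _ _, _ => {{.narr (σ.locNode y), .nrw (σ.locNode y), .nlw (σ.locNode y)}}

/-- The methods that return a value; all others return `()`. -/
def RdmaCall.ReturnsVal : RdmaCall Val Loc Node Wid → Prop
  | .read _ => True
  | .cas _ _ _ => True
  | _ => False

/-- Locations of a subevent, for events of the RDMA library. -/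
def rdmaLoc (s : SEv) : Set Loc :=
  match s.1.call with
  | .rdma c => c.subLoc s.2
  | _ => ∅

/-- The call is a `CAS`, a `Get`, a `Put`, a remote RMW, respectively. -/
def Call.IsCas : Call Val Loc Node Wid → Prop
  | .rdma (.cas _ _ _) => True
  | _ => False
def Call.IsGet : Call Val Loc Node Wid → Prop
  | .rdma (.get _ _ _) => True
  | _ => False
def Call.IsPut : Call Val Loc Node Wid → Prop
  | .rdma (.put _ _ _) => True
  | _ => False
def Call.IsRmw : Call Val Loc Node Wid → Prop
  | .rdma (.rcas _ _ _ _ _) => True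
  | .rdma (.rfaa _ _ _ _) => True
  | _ => False

/-- Candidate values read and written, reads-from, modification order per location, NIC flush
order, and remote-atomic order per node. -/
structure RdmaWit (Val Loc Node Wid : Type*) (T : ℕ) where
  vR : SubEvent Val (Call Val Loc Node Wid) Node T → Val
  vW : SubEvent Val (Call Val Loc Node Wid) Node T → Val
  rf : SubEvent Val (Call Val Loc Node Wid) Node T →
    SubEvent Val (Call Val Loc Node Wid) Node T → Prop
  moAt : Loc → SubEvent Val (Call Val Loc Node Wid) Node T →
    SubEvent Val (Call Val Loc Node Wid) Node T → Prop
  nfo : SubEvent Val (Call Val Loc Node Wid) Node T →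
    SubEvent Val (Call Val Loc Node Wid) Node T → Prop
  raoAt : Node → SubEvent Val (Call Val Loc Node Wid) Node T →
    SubEvent Val (Call Val Loc Node Wid) Node T → Prop

namespace RdmaWit

def mo (w : RdmaWit Val Loc Node Wid T) (s₁ s₂ : SEv) : Prop := ∃ x, w.moAt x s₁ s₂

def rao (w : RdmaWit Val Loc Node Wid T) (s₁ s₂ : SEv) : Prop := ∃ n, w.raoAt n s₁ s₂

/-- NIC read `s₁` and NIC write `s₂` of the same thread towards the same node, both on the local
side or both on the remote side. -/
def FlushPair (s₁ s₂ : SEv) : Prop :=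
  s₁.1.thread = s₂.1.thread ∧ ∃ n, (s₁.2 = .nlr n ∧ s₂.2 = .nlw n) ∨
    ((s₁.2 = .nrr n ∨ s₁.2 = .narr n) ∧ s₂.2 = .nrw n)

/-- Well-formedness of the tuple with respect to an execution. -/
structure WellFormed [Zero Val] [Add Val] (σ : Sys Val Loc Node T) (G : Ex)
    (w : RdmaWit Val Loc Node Wid T) : Prop where
  read_val : ∀ e a x, (e, a) ∈ G.Reads → e.call = .rdma (.read x) → w.vR (e, a) = e.out
  cas_read_val : ∀ e a x v₁ v₂, (e, a) ∈ G.Reads → e.call = .rdma (.cas x v₁ v₂) →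
    w.vR (e, a) = e.out
  write_val : ∀ e a x v, (e, a) ∈ G.Writes → e.call = .rdma (.write x v) → w.vW (e, a) = v
  cas_write_val : ∀ e a x v₁ v₂, (e, a) ∈ G.Writes → e.call = .rdma (.cas x v₁ v₂) →
    e.out = v₁ → w.vW (e, a) = v₂
  put_val : ∀ e n, (e, .nlr n) ∈ G.SE → (e, .nrw n) ∈ G.SE →
    w.vR (e, .nlr n) = w.vW (e, .nrw n)
  get_val : ∀ e n, (e, .nrr n) ∈ G.SE → (e, .nlw n) ∈ G.SE →
    w.vR (e, .nrr n) = w.vW (e, .nlw n)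
  rmw_val : ∀ e n, (e, .narr n) ∈ G.SE → (e, .nlw n) ∈ G.SE →
    w.vR (e, .narr n) = w.vW (e, .nlw n)
  rf_sub : ∀ s₁ s₂, w.rf s₁ s₂ → s₁ ∈ G.Writes ∧ s₂ ∈ G.Reads
  rf_match : ∀ s₁ s₂, w.rf s₁ s₂ → rdmaLoc s₁ = rdmaLoc s₂ ∧ w.vW s₁ = w.vR s₂
  rf_fun : ∀ s₁ s₁' s₂, w.rf s₁ s₂ → w.rf s₁' s₂ → s₁ = s₁'
  rf_zero : ∀ s₂ ∈ G.Reads, (¬ ∃ s₁, w.rf s₁ s₂) → w.vR s₂ = 0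
  mo_total : ∀ x, StrictTotalOn (w.moAt x) {s ∈ G.Writes | rdmaLoc s = {x}}
  nfo_sub : ∀ s₁ s₂, w.nfo s₁ s₂ → s₁ ∈ G.SE ∧ s₂ ∈ G.SE
  nfo_total : ∀ s₁ ∈ G.SE, ∀ s₂ ∈ G.SE, FlushPair s₁ s₂ → w.nfo s₁ s₂ ∨ w.nfo s₂ s₁
  rcas_fail : ∀ e ∈ G.E, ∀ x y v₁ v₂ d, e.call = .rdma (.rcas x y v₁ v₂ d) →
    G.stmp e = {.narr (σ.locNode y), .nlw (σ.locNode y)} →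
    w.vR (e, .narr (σ.locNode y)) ≠ v₁
  rcas_succ : ∀ e ∈ G.E, ∀ x y v₁ v₂ d, e.call = .rdma (.rcas x y v₁ v₂ d) →
    G.stmp e = {.narr (σ.locNode y), .nrw (σ.locNode y), .nlw (σ.locNode y)} →
    w.vR (e, .narr (σ.locNode y)) = v₁ ∧ w.vW (e, .nrw (σ.locNode y)) = v₂
  rfaa_val : ∀ e ∈ G.E, ∀ x y v d, e.call = .rdma (.rfaa x y v d) →
    w.vW (e, .nrw (σ.locNode y)) = w.vR (e, .narr (σ.locNode y)) + v
  rao_total : ∀ n, StrictTotalOn (w.raoAt n)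
    {s ∈ G.SE | s.2 = .narr n ∧
      ((∃ x y v₁ v₂ d, s.1.call = .rdma (.rcas x y v₁ v₂ d) ∧ σ.locNode y = n) ∨
       (∃ x y v d, s.1.call = .rdma (.rfaa x y v d) ∧ σ.locNode y = n))}

/-- Reads-before. -/
def rb (G : Ex) (w : RdmaWit Val Loc Node Wid T) (r s : SEv) : Prop :=
  r ∈ G.Reads ∧ s ∈ G.Writes ∧ ((∃ u, w.rf u r ∧ w.mo u s) ∨ ¬ ∃ u, w.rf u r) ∧
    rdmaLoc r = rdmaLoc s ∧ r ≠ s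

/-- Internal reads-before. -/
def rbi (G : Ex) (w : RdmaWit Val Loc Node Wid T) (r s : SEv) : Prop :=
  r.2 = .aCR ∧ s.2 = .aCW ∧ (G.po r.1 s.1 ∨ G.po s.1 r.1) ∧ w.rb G r s

/-- Internal reads-from. -/
def rfi (G : Ex) (w : RdmaWit Val Loc Node Wid T) (s r : SEv) : Prop :=
  s.2 = .aCW ∧ r.2 = .aCR ∧ G.po s.1 r.1 ∧ w.rf s r

/-- External reads-from. -/
def rfe (G : Ex) (w : RdmaWit Val Loc Node Wid T) (s r : SEv) : Prop :=
  w.rf s r ∧ ¬ w.rfi G s r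

end RdmaWit

/-- A wait synchronises with earlier NIC local writes with the same work identifier. -/
def pfg (G : Ex) (s₁ s₂ : SEv) : Prop :=
  s₁ ∈ G.SE ∧ s₂ ∈ G.SE ∧ (∃ n, s₁.2 = .nlw n) ∧ s₂.2 = .aWT ∧ poWid G s₁.1 s₂.1

/-- Likewise for NIC remote writes. -/
def pfp (G : Ex) (s₁ s₂ : SEv) : Prop :=
  s₁ ∈ G.SE ∧ s₂ ∈ G.SE ∧ (∃ n, s₁.2 = .nrw n) ∧ s₂.2 = .aWT ∧ poWid G s₁.1 s₂.1

/-- Internal synchronisation order between subevents of one event. -/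
def rdmaIso (G : Ex) (s₁ s₂ : SEv) : Prop :=
  s₁ ∈ G.SE ∧ s₂ ∈ G.SE ∧ s₁.1 = s₂.1 ∧
    ((s₁.1.call.IsCas ∧ s₁.2 = .aMF ∧ s₂.2 = .aCR) ∨
     (s₁.1.call.IsGet ∧ ∃ n, s₁.2 = .nrr n ∧ s₂.2 = .nlw n) ∨
     (s₁.1.call.IsPut ∧ ∃ n, s₁.2 = .nlr n ∧ s₂.2 = .nrw n) ∨
     (s₁.1.call.IsRmw ∧ ∃ n, s₁.2 = .narr n ∧ s₂.2 = .nlw n) ∨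
     (s₁.1.call.IsRmw ∧ ∃ n, s₁.2 = .narr n ∧ s₂.2 = .nrw n))

/-- Issue-preserved program order. -/
def ippo (G : Ex) (s₁ s₂ : SEv) : Prop :=
  G.ppo s₁ s₂ ∨
    (s₁ ∈ G.SE ∧ s₂ ∈ G.SE ∧ G.po s₁.1 s₂.1 ∧
      ((s₁.2 = .aCW ∧ (s₂.2 = .aCR ∨ s₂.2 = .aWT)) ∨
       ∃ n, (s₁.2 = .nrw n ∨ s₁.2 = .nlw n) ∧ s₂.2 = .nf n))

/-- Issued-before. -/
def ib (G : Ex) (w : RdmaWit Val Loc Node Wid T) : SEv → SEv → Prop :=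
  Relation.TransGen fun s₁ s₂ =>
    ippo G s₁ s₂ ∨ rdmaIso G s₁ s₂ ∨ w.rf s₁ s₂ ∨ pfg G s₁ s₂ ∨ pfp G s₁ s₂ ∨ w.nfo s₁ s₂ ∨
      w.rbi G s₁ s₂

/-- The synchronisation order exported by the RDMA library. -/
def rdmaSo (G : Ex) (w : RdmaWit Val Loc Node Wid T) (s₁ s₂ : SEv) : Prop :=
  rdmaIso G s₁ s₂ ∨ w.rfe G s₁ s₂ ∨ pfg G s₁ s₂ ∨ w.nfo s₁ s₂ ∨ w.rb G s₁ s₂ ∨ w.mo s₁ s₂ ∨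
    w.rao s₁ s₂ ∨ ((∃ n, s₁.2 = .nrw n) ∧ ∃ s, rdmaIso G s s₁ ∧ w.rao s s₂) ∨
    (s₁ ∈ G.SE ∧ s₁.2.IsInst ∧ ib G w s₁ s₂)

/-- Consistency for the RDMA library: well-addressed, well-stamped, methods without a return value
return `()`, and a well-formed tuple explains `so`. -/
def RdmaConsistent [Zero Val] [Add Val] (σ : Sys Val Loc Node T) (G : Ex) : Prop :=
  (∀ e ∈ G.E, ∀ c, e.call = .rdma c →
    c.Addressed σ e.thread ∧ G.stmp e ∈ c.stamps σ e.out ∧ (¬ c.ReturnsVal → e.out = σ.unit)) ∧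
  ∃ w : RdmaWit Val Loc Node Wid T, w.WellFormed σ G ∧ (∀ s, ¬ ib G w s s) ∧
    ∀ s₁ s₂, G.so s₁ s₂ ↔ rdmaSo G w s₁ s₂

/-- The RDMA library. -/
def rdmaLib [Zero Val] [Add Val] (σ : Sys Val Loc Node T) :
    Library Val (Call Val Loc Node Wid) Loc Node T where
  calls := Set.range Call.rdma
  loc := fun c => match c with
    | .rdma c => c.loc
    | _ => ∅
  consistent := {G | RdmaConsistent σ G}

end Rdma

/-! ## The shared-variable library -/

section Sv
variable {Val Loc Node Wid : Type*} {T : ℕ}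

local notation "Ev" => Event Val (Call Val Loc Node Wid) T
local notation "SEv" => SubEvent Val (Call Val Loc Node Wid) Node T
local notation "Ex" => Exec Val (Call Val Loc Node Wid) Node T

def SvCall.loc : SvCall Val Loc Node Wid → Set Loc
  | .write x _ => {x}
  | .read x => {x}
  | .bcast x _ _ => {x}
  | .wait _ => ∅
  | .gfence _ => ∅

def SvCall.stamps : SvCall Val Loc Node Wid → Set (Stamp Node)
  | .write _ _ => {.aCW}
  | .read _ => {.aCR}
  | .wait _ => {.aWT}
  | .gfence N => {a | ∃ n ∈ N, a = .gf n}
  | .bcast _ _ N => {a | ∃ n ∈ N, a = .nlr n ∨ a = .nrw n}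

/-- The only method that returns a value; all others return `()`. -/
def SvCall.ReturnsVal : SvCall Val Loc Node Wid → Prop
  | .read _ => True
  | _ => False

/-- Locations of an event (equivalently, of its subevents) of the shared-variable library. -/
def svLoc (s : SEv) : Set Loc :=
  match s.1.call with
  | .sv c => c.loc
  | _ => ∅

/-- Write subevents occurring on node `n`. -/
def svWritesOn (σ : Sys Val Loc Node T) (G : Ex) (n : Node) : Set SEv :=
  {s ∈ G.SE | (s.2 = .aCW ∧ σ.threadNode s.1.thread = n) ∨ s.2 = .nrw n}

/-- Read subevents occurring on node `n`. -/
def svReadsOn (σ : Sys Val Loc Node T) (G : Ex) (n : Node) : Set SEv :=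
  {s ∈ G.Reads | σ.threadNode s.1.thread = n}

/-- Candidate values read and written, reads-from per node, modification order per location and
node. -/
structure SvWit (Val Loc Node Wid : Type*) (T : ℕ) where
  vR : SubEvent Val (Call Val Loc Node Wid) Node T → Val
  vW : SubEvent Val (Call Val Loc Node Wid) Node T → Val
  rfOn : Node → SubEvent Val (Call Val Loc Node Wid) Node T →
    SubEvent Val (Call Val Loc Node Wid) Node T → Prop
  moOn : Loc → Node → SubEvent Val (Call Val Loc Node Wid) Node T →
    SubEvent Val (Call Val Loc Node Wid) Node T → Prop

namespace SvWit

def rf (w : SvWit Val Loc Node Wid T) (s₁ s₂ : SEv) : Prop := ∃ n, w.rfOn n s₁ s₂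

def mo (w : SvWit Val Loc Node Wid T) (s₁ s₂ : SEv) : Prop := ∃ x n, w.moOn x n s₁ s₂

/-- Well-formedness of the tuple with respect to an execution. -/
structure WellFormed [Zero Val] (σ : Sys Val Loc Node T) (G : Ex)
    (w : SvWit Val Loc Node Wid T) : Prop where
  read_val : ∀ e a x, (e, a) ∈ G.Reads → e.call = .sv (.read x) → w.vR (e, a) = e.out
  write_val : ∀ e a x v, (e, a) ∈ G.Writes → e.call = .sv (.write x v) → w.vW (e, a) = v
  bcast_val : ∀ e n, (e, .nlr n) ∈ G.SE → (e, .nrw n) ∈ G.SE →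
    w.vR (e, .nlr n) = w.vW (e, .nrw n)
  rf_sub : ∀ n s₁ s₂, w.rfOn n s₁ s₂ → s₁ ∈ svWritesOn σ G n ∧ s₂ ∈ svReadsOn σ G n
  rf_match : ∀ n s₁ s₂, w.rfOn n s₁ s₂ → svLoc s₁ = svLoc s₂ ∧ w.vW s₁ = w.vR s₂
  rf_fun : ∀ n s₁ s₁' s₂, w.rfOn n s₁ s₂ → w.rfOn n s₁' s₂ → s₁ = s₁'
  rf_zero : ∀ n, ∀ s₂ ∈ svReadsOn σ G n, (¬ ∃ s₁, w.rfOn n s₁ s₂) → w.vR s₂ = 0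
  mo_total : ∀ x n, StrictTotalOn (w.moOn x n) {s ∈ svWritesOn σ G n | svLoc s = {x}}

/-- Reads-before. -/
def rb (σ : Sys Val Loc Node T) (G : Ex) (w : SvWit Val Loc Node Wid T) (r s : SEv) : Prop :=
  ∃ n, r ∈ svReadsOn σ G n ∧ s ∈ svWritesOn σ G n ∧ svLoc r = svLoc s ∧
    ((∃ u, w.rfOn n u r ∧ ∃ x, w.moOn x n u s) ∨ ¬ ∃ u, w.rfOn n u r)

/-- Internal reads-from. -/
def rfi (G : Ex) (w : SvWit Val Loc Node Wid T) (s r : SEv) : Prop :=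
  s.2 = .aCW ∧ r.2 = .aCR ∧ G.po s.1 r.1 ∧ w.rf s r

/-- External reads-from. -/
def rfe (G : Ex) (w : SvWit Val Loc Node Wid T) (s r : SEv) : Prop :=
  w.rf s r ∧ ¬ w.rfi G s r

end SvWit

/-- A wait synchronises with the reads of earlier broadcasts with the same work identifier. -/
def svPf (G : Ex) (s₁ s₂ : SEv) : Prop :=
  s₁ ∈ G.SE ∧ s₂ ∈ G.SE ∧ (∃ n, s₁.2 = .nlr n) ∧ s₂.2 = .aWT ∧ poWid G s₁.1 s₂.1

/-- Within a broadcast, the read precedes the write, for each target node. -/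
def svIso (G : Ex) (s₁ s₂ : SEv) : Prop :=
  s₁ ∈ G.SE ∧ s₂ ∈ G.SE ∧ s₁.1 = s₂.1 ∧
    ∃ x d N, s₁.1.call = .sv (.bcast x d N) ∧ ∃ n ∈ N, s₁.2 = .nlr n ∧ s₂.2 = .nrw n

/-- Consistency for the shared-variable library. -/
def SvConsistent [Zero Val] (σ : Sys Val Loc Node T) (G : Ex) : Prop :=
  (∀ e ∈ G.E, ∀ c, e.call = .sv c →
    G.stmp e = c.stamps ∧ (¬ c.ReturnsVal → e.out = σ.unit)) ∧
  ∃ w : SvWit Val Loc Node Wid T, w.WellFormed σ G ∧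
    (∀ r s, ¬ (r.2 = .aCR ∧ G.po s.1 r.1 ∧ w.rb σ G r s ∧ s.2 = .aCW)) ∧
    ∀ s₁ s₂, G.so s₁ s₂ ↔
      (svIso G s₁ s₂ ∨ w.rfe G s₁ s₂ ∨ svPf G s₁ s₂ ∨ w.rb σ G s₁ s₂ ∨ w.mo s₁ s₂)

/-- The shared-variable library. -/
def svLib [Zero Val] (σ : Sys Val Loc Node T) :
    Library Val (Call Val Loc Node Wid) Loc Node T where
  calls := Set.range Call.sv
  loc := fun c => match c with
    | .sv c => c.loc
    | _ => ∅
  consistent := {G | SvConsistent σ G}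

end Sv

/-! ## The weak lock library -/

section WLock
variable {Val Loc Node Wid : Type*} {T : ℕ}

local notation "Ev" => Event Val (Call Val Loc Node Wid) T
local notation "SEv" => SubEvent Val (Call Val Loc Node Wid) Node T
local notation "Ex" => Exec Val (Call Val Loc Node Wid) Node T

def LockCall.loc : LockCall Loc → Set Loc
  | .acq x => {x}
  | .rel x => {x}

def LockCall.stamps : LockCall Loc → Set (Stamp Node)
  | .acq _ => {.aMF}
  | .rel _ => {.aCW}

/-- Acquire events, respectively release events, on `x`. -/
def acquires (G : Ex) (x : Loc) : Set Ev := {e ∈ G.E | e.call = .lock (.acq x)}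
def releases (G : Ex) (x : Loc) : Set Ev := {e ∈ G.E | e.call = .lock (.rel x)}

/-- Program order between lock events on `x`. -/
def lockPo (G : Ex) (x : Loc) (a b : Ev) : Prop :=
  G.po a b ∧ a ∈ acquires G x ∪ releases G x ∧ b ∈ acquires G x ∪ releases G x

/-- Every acquire is immediately followed by a release of the same lock, and every release is
immediately preceded by an acquire. -/
def LockWellFormed (G : Ex) : Prop :=
  ∀ x, (∀ a ∈ acquires G x, ∃ r ∈ releases G x, imm (lockPo G x) a r) ∧
    (∀ r ∈ releases G x, ∃ a ∈ acquires G x, imm (lockPo G x) a r)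

/-- Consistency for the weak lock library. Executions that are not lock-well-formed are not
constrained. Releases synchronise with all acquires that come later, in the order `lo x` of
acquires of `x`, than the acquire matching the release. -/
def WLockConsistent (σ : Sys Val Loc Node T) (G : Ex) : Prop :=
  LockWellFormed G →
    (∀ e ∈ G.E, ∀ c, e.call = .lock c → G.stmp e = c.stamps ∧ e.out = σ.unit) ∧
    ∃ lo : Loc → Ev → Ev → Prop, (∀ x, StrictTotalOn (lo x) (acquires G x)) ∧
      ∀ s₁ s₂ : SEv, G.so s₁ s₂ ↔
        ∃ x, s₁.2 = .aCW ∧ s₂.2 = .aMF ∧ ∃ a, imm (lockPo G x) a s₁.1 ∧ lo x a s₂.1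

/-- The weak lock library. -/
def wlockLib (σ : Sys Val Loc Node T) : Library Val (Call Val Loc Node Wid) Loc Node T where
  calls := Set.range Call.lock
  loc := fun c => match c with
    | .lock c => c.loc
    | _ => ∅
  consistent := {G | WLockConsistent σ G}

/-! ## The distributed ticket-lock implementation -/

/-- For each lock: the ticket dispenser, the private ticket of each thread, and the shared release
variable of each thread. -/
inductive Slot (T : ℕ) where
  | dispenser
  | ticket (t : Fin T)
  | turn (t : Fin T)

/-- Pairwise distinct locations for the slots of all locks; private tickets are local to their
thread. -/
structure Layout (σ : Sys Val Loc Node T) where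
  cell : Loc → Slot T → Loc
  distinct : ∀ x s x' s', cell x s = cell x' s' → x = x' ∧ s = s'
  ticket_local : ∀ x t, σ.locNode (cell x (.ticket t)) = σ.threadNode t

open Classical in
/-- Read the release variables of the listed threads one after the other; break as soon as one
of them holds `v`. -/
noncomputable def pollTurns {σ : Sys Val Loc Node T} (lay : Layout σ) (x : Loc) (v : Val) :
    List (Fin T) → SeqProg Val (Call Val Loc Node Wid)
  | [] => .val σ.unit
  | t :: ts => .letIn (.call (.sv (.read (lay.cell x (.turn t))))) fun r =>
      if r = v then .brk 1 σ.unit else pollTurns lay x v ts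

/-- Acquire `x`: fetch a ticket, wait for it, and poll until its turn has come. -/
noncomputable def acqImpl [One Val] {σ : Sys Val Loc Node T} (lay : Layout σ) (d : Wid)
    (t : Fin T) (x : Loc) : SeqProg Val (Call Val Loc Node Wid) :=
  .letIn (.call (.rdma (.rfaa (lay.cell x (.ticket t)) (lay.cell x .dispenser) 1 d))) fun _ =>
  .letIn (.call (.rdma (.wait d))) fun _ =>
  .letIn (.call (.rdma (.read (lay.cell x (.ticket t))))) fun v =>
  .loop (pollTurns lay x v (List.finRange T))

/-- Release `x`: write the next turn to the own release variable, and broadcast it to all other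
nodes. -/
def relImpl [One Val] [Add Val] {σ : Sys Val Loc Node T} (lay : Layout σ) (d : Wid)
    (t : Fin T) (x : Loc) : SeqProg Val (Call Val Loc Node Wid) :=
  .letIn (.call (.rdma (.read (lay.cell x (.ticket t))))) fun v =>
  .letIn (.call (.sv (.write (lay.cell x (.turn t)) (v + 1)))) fun _ =>
  .call (.sv (.bcast (lay.cell x (.turn t)) d {σ.threadNode t}ᶜ))

/-- The implementation of the weak lock library. The work identifiers used by acquires and by
releases may depend on the thread and on the lock. -/
noncomputable def wlockImpl [One Val] [Add Val] {σ : Sys Val Loc Node T} (lay : Layout σ)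
    (dAcq dRel : Fin T → Loc → Wid) : Impl Val (Call Val Loc Node Wid) T
  | t, .lock (.acq x) => acqImpl lay (dAcq t x) t x
  | t, .lock (.rel x) => relImpl lay (dRel t x) t x
  | _, c => .call c

end WLock

end Mowgli

/-!
The implementation is a ticket lock. An execution of the inlined program is turned into one of
the original program by collapsing each run of the implementation to a single lock event
(`Sem.abstract`), keeping all other events.

*Happens-before.* A lock event is represented by one subevent of its run: an acquire by the last
poll of a turn variable, a release by the write of the turn variable (`lockPoint`). The abstract
happens-before relates two subevents if their representatives are related in the given execution;
it is therefore a strict partial order. It contains the preserved program order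
(`LockRun.hb_lockPoint_of_ppo`): the only pairs of stamps for which this is not immediate are
those of a CPU write before an acquire, and there the write is ordered with the remote
fetch-and-add, whose completion is awaited before the poll.

*The other libraries.* Events of the implementation share no location with the other events, so no
event outside the implementation reads from one inside. Hence the witnesses of RDMA and SV
consistency restrict to the remaining events, and the restricted synchronisation orders are
contained in the given ones (`RdmaWit.so_sub`, `SvWit.so_sub`).

*The lock library.* Acquires of a lock are ordered as their fetch-and-adds of the dispenser are in
the remote-atomic order. Each fetch-and-add reads from its predecessor, so it fetches the number of
earlier ones (`RdmaRun.vR_eq_ticketNo`), and the later reads of the private ticket return this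
number (`LockRun.read_ticket`). A poll that returns a nonzero ticket obtains it, directly or
through a broadcast, from the write of a release, which happens before the poll
(`LockRun.exists_release_hb_poll`); tickets being distinct, this release matches the acquire with
the preceding ticket. Induction on the ticket shows that all releases matching earlier acquires
happen before the poll (`LockRun.release_hb_poll`). If the program does not use its locks in a
well-formed way, the lock library demands nothing, and the abstract execution has no lock
synchronisation.
-/

namespace Mowgli

/-! ### Plain executions of programs -/

section Plain
variable {Val M : Type*} {T : ℕ}

/-- A finite plain execution, totally ordered by program order on each thread. -/
structure Plain.Ordered (G : Plain Val M T) : Prop where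
  finite : G.E.Finite
  po_sub : ∀ a b, G.po a b → a ∈ G.E ∧ b ∈ G.E ∧ a.thread = b.thread
  irrefl : ∀ a, ¬ G.po a a
  trans : ∀ a b c, G.po a b → G.po b c → G.po a c
  total : ∀ a ∈ G.E, ∀ b ∈ G.E, a.thread = b.thread → a ≠ b → G.po a b ∨ G.po b a

theorem Plain.ordered_empty : (Plain.empty : Plain Val M T).Ordered where
  finite := Set.finite_empty
  po_sub _ _ h := h.elim
  irrefl _ h := h
  trans _ _ _ h := h.elim
  total _ h := h.elim

theorem Plain.ordered_single (e : Event Val M T) : (Plain.single e).Ordered where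
  finite := Set.finite_singleton e
  po_sub _ _ h := h.elim
  irrefl _ h := h
  trans _ _ _ h := h.elim
  total a ha b hb _ hab := absurd ((show a = e from ha).trans (show b = e from hb).symm) hab

theorem Plain.Ordered.seq {t : Fin T} {G₁ G₂ : Plain Val M T} (h₁ : G₁.Ordered)
    (h₂ : G₂.Ordered) (t₁ : ∀ e ∈ G₁.E, e.thread = t) (t₂ : ∀ e ∈ G₂.E, e.thread = t)
    (hd : Disjoint G₁.E G₂.E) : (G₁.seq G₂).Ordered where
  finite := h₁.finite.union h₂.finite
  po_sub a b h := by
    rcases h with h | h | ⟨ha, hb⟩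
    · exact ⟨.inl (h₁.po_sub a b h).1, .inl (h₁.po_sub a b h).2.1, (h₁.po_sub a b h).2.2⟩
    · exact ⟨.inr (h₂.po_sub a b h).1, .inr (h₂.po_sub a b h).2.1, (h₂.po_sub a b h).2.2⟩
    · exact ⟨.inl ha, .inr hb, (t₁ a ha).trans (t₂ b hb).symm⟩
  irrefl a h := by
    rcases h with h | h | ⟨ha, hb⟩
    · exact h₁.irrefl a h
    · exact h₂.irrefl a h
    · exact Set.disjoint_left.1 hd ha hb
  trans a b c hab hbc := by
    have hn : ∀ e, e ∈ G₁.E → e ∈ G₂.E → False := fun _ h h' => Set.disjoint_left.1 hd h h'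
    rcases hab with h | h | ⟨ha, hb⟩ <;> rcases hbc with h' | h' | ⟨hb', hc⟩
    · exact .inl (h₁.trans a b c h h')
    · exact (hn b (h₁.po_sub a b h).2.1 (h₂.po_sub b c h').1).elim
    · exact .inr (.inr ⟨(h₁.po_sub a b h).1, hc⟩)
    · exact (hn b (h₁.po_sub b c h').1 (h₂.po_sub a b h).2.1).elim
    · exact .inr (.inl (h₂.trans a b c h h'))
    · exact (hn b hb' (h₂.po_sub a b h).2.1).elim
    · exact (hn b (h₁.po_sub b c h').1 hb).elim
    · exact .inr (.inr ⟨ha, (h₂.po_sub b c h').2.1⟩)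
    · exact .inr (.inr ⟨ha, hc⟩)
  total a ha b hb ht hab := by
    rcases ha with ha | ha <;> rcases hb with hb | hb
    · exact (h₁.total a ha b hb ht hab).imp .inl .inl
    · exact .inl (.inr (.inr ⟨ha, hb⟩))
    · exact .inr (.inr (.inr ⟨hb, ha⟩))
    · exact (h₂.total a ha b hb ht hab).imp (fun h => .inr (.inl h)) (fun h => .inr (.inl h))

theorem Sem.ordered {t : Fin T} {p : SeqProg Val M} {v : Val} {k : ℕ} {G : Plain Val M T}
    (h : Sem t p v k G) : G.Ordered ∧ ∀ e ∈ G.E, e.thread = t := by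
  induction h with
  | val | brk => exact ⟨Plain.ordered_empty, fun e he => he.elim⟩
  | call c i v =>
    refine ⟨Plain.ordered_single _, fun e he => ?_⟩
    rw [show e = _ from he]
  | letIn _ _ hd ih₁ ih₂ | loopNext _ _ hd ih₁ ih₂ =>
    exact ⟨ih₁.1.seq ih₂.1 ih₁.2 ih₂.2 hd, fun e he => he.elim (ih₁.2 e) (ih₂.2 e)⟩
  | letBrk _ _ ih | loopBrk _ ih => exact ih

theorem Plain.ordered_par {Gs : Fin T → Plain Val M T} (h : ∀ t, (Gs t).Ordered)
    (ht : ∀ t, ∀ e ∈ (Gs t).E, e.thread = t) : (Plain.par Gs).Ordered where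
  finite := Set.finite_iUnion fun t => (h t).finite
  po_sub := by
    rintro a b ⟨t, hab⟩
    obtain ⟨ha, hb, e⟩ := (h t).po_sub a b hab
    exact ⟨Set.mem_iUnion.2 ⟨t, ha⟩, Set.mem_iUnion.2 ⟨t, hb⟩, e⟩
  irrefl := by
    rintro a ⟨t, haa⟩
    exact (h t).irrefl a haa
  trans := by
    rintro a b c ⟨t, hab⟩ ⟨t', hbc⟩
    have e₁ := ht t b ((h t).po_sub a b hab).2.1
    have e₂ := ht t' b ((h t').po_sub b c hbc).1
    obtain rfl : t = t' := e₁.symm.trans e₂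
    exact ⟨t, (h t).trans a b c hab hbc⟩
  total := by
    intro a ha b hb hab hne
    obtain ⟨t, ha⟩ := Set.mem_iUnion.1 ha
    obtain ⟨t', hb⟩ := Set.mem_iUnion.1 hb
    obtain rfl : t = t' := (ht t a ha).symm.trans (hab.trans (ht t' b hb))
    exact ((h t).total a ha b hb hab hne).imp (fun h => ⟨t, h⟩) (fun h => ⟨t, h⟩)

/-! ### Undoing the inlining of an implementation -/

/-- `f` collapses the run `G` of an inlined program onto the run `G'` of the original program:
it fixes the events outside the implementation and maps all events of an implementation run
to the call that the run implements. The identifier of that call is taken from the event of the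
implementation run that calls `key` and returns `u`. -/
structure Abstracts (C : Set M) (I : Impl Val M T) (key : Fin T → M → M) (u : Val)
    (G G' : Plain Val M T) (f : Event Val M T → Event Val M T) : Prop where
  maps : ∀ e ∈ G.E, f e ∈ G'.E
  fixed : ∀ e' ∈ G'.E, e'.call ∉ C → e' ∈ G.E ∧ ∀ e ∈ G.E, f e = e' ↔ e = e'
  run : ∀ e' ∈ G'.E, e'.call ∈ C → ∃ G₀ : Plain Val M T,
    Sem e'.thread (I e'.thread e'.call) e'.out 0 G₀ ∧ G₀.E = {e ∈ G.E | f e = e'} ∧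
      ∀ a b, G₀.po a b → G.po a b
  key_mem : ∀ e' ∈ G'.E, e'.call ∈ C →
    (⟨e'.thread, e'.ident, key e'.thread e'.call, u⟩ : Event Val M T) ∈ G.E ∧
      f ⟨e'.thread, e'.ident, key e'.thread e'.call, u⟩ = e'
  po_iff : ∀ a ∈ G.E, ∀ b ∈ G.E, f a ≠ f b → (G.po a b ↔ G'.po (f a) (f b))

section Abstracts
variable {C : Set M} {I : Impl Val M T} {key : Fin T → M → M} {u : Val}

theorem abstracts_empty : Abstracts C I key u Plain.empty Plain.empty id where
  maps _ h := h.elim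
  fixed _ h := h.elim
  run _ h := h.elim
  key_mem _ h := h.elim
  po_iff _ h := h.elim

theorem abstracts_single {e : Event Val M T} (he : e.call ∉ C) :
    Abstracts C I key u (Plain.single e) (Plain.single e) id where
  maps _ h := h
  fixed _ h _ := ⟨h, fun _ _ => Iff.rfl⟩
  run e' h hc := absurd (show e' = e from h) (fun h => he (h ▸ hc))
  key_mem e' h hc := absurd (show e' = e from h) (fun h => he (h ▸ hc))
  po_iff _ _ _ _ _ := Iff.rfl

theorem abstracts_run {t : Fin T} {c : M} (hc : c ∈ C) {v : Val} {G : Plain Val M T}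
    (h : Sem t (I t c) v 0 G) {i : ℕ}
    (hk : (⟨t, i, key t c, u⟩ : Event Val M T) ∈ G.E) :
    Abstracts C I key u G (Plain.single ⟨t, i, c, v⟩) (fun _ => ⟨t, i, c, v⟩) where
  maps _ _ := rfl
  fixed e' he hn := by
    obtain rfl : e' = _ := he
    exact absurd hc hn
  run e' he _ := by
    obtain rfl : e' = _ := he
    exact ⟨G, h, by ext; simp, fun _ _ h => h⟩
  key_mem e' he _ := by
    obtain rfl : e' = _ := he
    exact ⟨hk, rfl⟩
  po_iff _ _ _ _ hne := absurd rfl hne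

theorem Abstracts.disjoint {G₁ G₂ G₁' G₂' : Plain Val M T}
    {f₁ f₂ : Event Val M T → Event Val M T} (h₁ : Abstracts C I key u G₁ G₁' f₁)
    (h₂ : Abstracts C I key u G₂ G₂' f₂) (hd : Disjoint G₁.E G₂.E) :
    Disjoint G₁'.E G₂'.E := by
  refine Set.disjoint_left.2 fun e' he₁ he₂ => ?_
  by_cases hc : e'.call ∈ C
  · exact Set.disjoint_left.1 hd (h₁.key_mem e' he₁ hc).1 (h₂.key_mem e' he₂ hc).1
  · exact Set.disjoint_left.1 hd (h₁.fixed e' he₁ hc).1 (h₂.fixed e' he₂ hc).1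

open Classical in
theorem Abstracts.seq {G₁ G₂ G₁' G₂' : Plain Val M T}
    {f₁ f₂ : Event Val M T → Event Val M T} (h₁ : Abstracts C I key u G₁ G₁' f₁)
    (h₂ : Abstracts C I key u G₂ G₂' f₂) (hd : Disjoint G₁.E G₂.E)
    (o₁ : G₁.Ordered) (o₂ : G₂.Ordered) (o₁' : G₁'.Ordered) (o₂' : G₂'.Ordered) :
    Abstracts C I key u (G₁.seq G₂) (G₁'.seq G₂')
      (fun e => if e ∈ G₁.E then f₁ e else f₂ e) := by
  have hd' := h₁.disjoint h₂ hd
  have hn : ∀ e, e ∈ G₁.E → e ∈ G₂.E → False := fun _ h h' => Set.disjoint_left.1 hd h h'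
  have hn' : ∀ e, e ∈ G₁'.E → e ∈ G₂'.E → False := fun _ h h' => Set.disjoint_left.1 hd' h h'
  have i₁ : ∀ e ∈ G₁.E, (if e ∈ G₁.E then f₁ e else f₂ e) = f₁ e := fun e he => if_pos he
  have i₂ : ∀ e ∈ G₂.E, (if e ∈ G₁.E then f₁ e else f₂ e) = f₂ e :=
    fun e he => if_neg fun h => hn e h he
  have fib₁ : ∀ e' ∈ G₁'.E, ∀ e ∈ G₁.E ∪ G₂.E,
      (if e ∈ G₁.E then f₁ e else f₂ e) = e' ↔ e ∈ G₁.E ∧ f₁ e = e' := by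
    rintro e' he' e (he | he)
    · simp [he]
    · rw [i₂ e he]
      exact ⟨fun h => (hn' e' he' (h ▸ h₂.maps e he)).elim, fun h => (hn e h.1 he).elim⟩
  have fib₂ : ∀ e' ∈ G₂'.E, ∀ e ∈ G₁.E ∪ G₂.E,
      (if e ∈ G₁.E then f₁ e else f₂ e) = e' ↔ e ∈ G₂.E ∧ f₂ e = e' := by
    rintro e' he' e (he | he)
    · rw [i₁ e he]
      exact ⟨fun h => (hn' e' (h ▸ h₁.maps e he) he').elim, fun h => (hn e he h.1).elim⟩
    · rw [i₂ e he]
      simp [he]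
  constructor
  · rintro e (he | he)
    · exact .inl ((i₁ e he).symm ▸ h₁.maps e he)
    · exact .inr ((i₂ e he).symm ▸ h₂.maps e he)
  · rintro e' (he' | he') hc
    · obtain ⟨m, q⟩ := h₁.fixed e' he' hc
      refine ⟨.inl m, fun e he => (fib₁ e' he' e he).trans ⟨fun h => (q e h.1).1 h.2, ?_⟩⟩
      rintro rfl
      exact ⟨m, (q e m).2 rfl⟩
    · obtain ⟨m, q⟩ := h₂.fixed e' he' hc
      refine ⟨.inr m, fun e he => (fib₂ e' he' e he).trans ⟨fun h => (q e h.1).1 h.2, ?_⟩⟩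
      rintro rfl
      exact ⟨m, (q e m).2 rfl⟩
  · rintro e' (he' | he') hc
    · obtain ⟨G₀, s, q, r⟩ := h₁.run e' he' hc
      refine ⟨G₀, s, ?_, fun a b h => .inl (r a b h)⟩
      ext e
      rw [q]
      exact ⟨fun h => ⟨.inl h.1, (fib₁ e' he' e (.inl h.1)).2 h⟩,
        fun h => (fib₁ e' he' e h.1).1 h.2⟩
    · obtain ⟨G₀, s, q, r⟩ := h₂.run e' he' hc
      refine ⟨G₀, s, ?_, fun a b h => .inr (.inl (r a b h))⟩
      ext e
      rw [q]
      exact ⟨fun h => ⟨.inr h.1, (fib₂ e' he' e (.inr h.1)).2 h⟩,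
        fun h => (fib₂ e' he' e h.1).1 h.2⟩
  · rintro e' (he' | he') hc
    · obtain ⟨m, q⟩ := h₁.key_mem e' he' hc
      exact ⟨.inl m, (i₁ _ m).trans q⟩
    · obtain ⟨m, q⟩ := h₂.key_mem e' he' hc
      exact ⟨.inr m, (i₂ _ m).trans q⟩
  · rintro a (ha | ha) b (hb | hb)
    · rw [i₁ a ha, i₁ b hb]
      intro hne
      constructor
      · rintro (h | h | ⟨_, h⟩)
        · exact .inl ((h₁.po_iff a ha b hb hne).1 h)
        · exact (hn a ha (o₂.po_sub a b h).1).elim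
        · exact (hn b hb h).elim
      · rintro (h | h | ⟨_, h⟩)
        · exact .inl ((h₁.po_iff a ha b hb hne).2 h)
        · exact (hn' _ (h₁.maps a ha) (o₂'.po_sub _ _ h).1).elim
        · exact (hn' _ (h₁.maps b hb) h).elim
    · rw [i₁ a ha, i₂ b hb]
      exact fun _ => ⟨fun _ => .inr (.inr ⟨h₁.maps a ha, h₂.maps b hb⟩),
        fun _ => .inr (.inr ⟨ha, hb⟩)⟩
    · rw [i₂ a ha, i₁ b hb]
      intro _
      constructor
      · rintro (h | h | ⟨h, _⟩)
        · exact (hn a (o₁.po_sub a b h).1 ha).elim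
        · exact (hn b hb (o₂.po_sub a b h).2.1).elim
        · exact (hn a h ha).elim
      · rintro (h | h | ⟨h, _⟩)
        · exact (hn' _ (o₁'.po_sub _ _ h).1 (h₂.maps a ha)).elim
        · exact (hn' _ (h₁.maps b hb) (o₂'.po_sub _ _ h).2.1).elim
        · exact (hn' _ h (h₂.maps a ha)).elim
    · rw [i₂ a ha, i₂ b hb]
      intro hne
      constructor
      · rintro (h | h | ⟨h, _⟩)
        · exact (hn a (o₁.po_sub a b h).1 ha).elim
        · exact .inr (.inl ((h₂.po_iff a ha b hb hne).1 h))
        · exact (hn a h ha).elim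
      · rintro (h | h | ⟨h, _⟩)
        · exact (hn' _ (o₁'.po_sub _ _ h).1 (h₂.maps a ha)).elim
        · exact .inr (.inl ((h₂.po_iff a ha b hb hne).2 h))
        · exact (hn' _ h (h₂.maps a ha)).elim

/-- Every run of an inlined program arises from a run of the original program. The predicate `P`
records what is known about the events, so that a key event can be found in each run of an
implementation. -/
theorem Sem.abstract {P : Event Val M T → Prop} (hb : ∀ t, ∀ c ∈ C, ∀ v k (G : Plain Val M T),
      ¬ Sem t (I t c) v (k + 1) G)
    (hk : ∀ t, ∀ c ∈ C, ∀ v (G : Plain Val M T), Sem t (I t c) v 0 G → (∀ e ∈ G.E, P e) →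
      ∃ i, (⟨t, i, key t c, u⟩ : Event Val M T) ∈ G.E)
    {t : Fin T} (p : SeqProg Val M) {v : Val} {k : ℕ} {G : Plain Val M T}
    (h : Sem t (inlineSeq C I t p) v k G) (hP : ∀ e ∈ G.E, P e) :
    ∃ G' f, Sem t p v k G' ∧ Abstracts C I key u G G' f := by
  induction p generalizing v k G with
  | val w =>
    cases h
    exact ⟨_, _, .val _, abstracts_empty⟩
  | brk n w =>
    cases h
    exact ⟨_, _, .brk _ _, abstracts_empty⟩
  | call c =>
    by_cases hc : c ∈ C
    · rw [inlineSeq, if_pos hc] at h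
      cases k with
      | succ k => exact (hb t c hc v k G h).elim
      | zero =>
        obtain ⟨i, hi⟩ := hk t c hc v G h hP
        exact ⟨_, _, .call _ _ _, abstracts_run hc h hi⟩
    · rw [inlineSeq, if_neg hc] at h
      cases h
      exact ⟨_, _, .call _ _ _, abstracts_single hc⟩
  | letIn p g ih₁ ih₂ =>
    cases h with
    | letIn s₁ s₂ hd =>
      obtain ⟨G₁', f₁, t₁, a₁⟩ := ih₁ s₁ fun e he => hP e (.inl he)
      obtain ⟨G₂', f₂, t₂, a₂⟩ := ih₂ _ s₂ fun e he => hP e (.inr he)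
      exact ⟨_, _, .letIn t₁ t₂ (a₁.disjoint a₂ hd),
        a₁.seq a₂ hd s₁.ordered.1 s₂.ordered.1 t₁.ordered.1 t₂.ordered.1⟩
    | letBrk s hne =>
      obtain ⟨G', f, t', a⟩ := ih₁ s hP
      exact ⟨_, _, .letBrk t' hne, a⟩
  | loop p ih =>
    generalize hq : inlineSeq C I t (.loop p) = q at h
    rw [inlineSeq] at hq
    induction h with
    | loopBrk s _ =>
      cases hq
      obtain ⟨G', f, t', a⟩ := ih s hP
      exact ⟨_, _, .loopBrk t', a⟩
    | loopNext s₁ s₂ hd _ ih₂ =>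
      cases hq
      obtain ⟨G₁', f₁, t₁, a₁⟩ := ih s₁ fun e he => hP e (.inl he)
      obtain ⟨G₂', f₂, t₂, a₂⟩ := ih₂ (fun e he => hP e (.inr he)) rfl
      exact ⟨_, _, .loopNext t₁ t₂ (a₁.disjoint a₂ hd),
        a₁.seq a₂ hd s₁.ordered.1 s₂.ordered.1 t₁.ordered.1 t₂.ordered.1⟩
    | _ => cases hq

theorem Abstracts.par {Gs Gs' : Fin T → Plain Val M T}
    {fs : Fin T → Event Val M T → Event Val M T}
    (h : ∀ t, Abstracts C I key u (Gs t) (Gs' t) (fs t))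
    (ht : ∀ t, ∀ e ∈ (Gs t).E, e.thread = t) (ht' : ∀ t, ∀ e ∈ (Gs' t).E, e.thread = t)
    (o : ∀ t, (Gs t).Ordered) (o' : ∀ t, (Gs' t).Ordered) :
    Abstracts C I key u (Plain.par Gs) (Plain.par Gs') (fun e => fs e.thread e) := by
  have mem : ∀ {e}, e ∈ (Plain.par Gs).E → e ∈ (Gs e.thread).E := by
    intro e he
    obtain ⟨t, he⟩ := Set.mem_iUnion.1 he
    exact (ht t e he).symm ▸ he
  have mem' : ∀ {e}, e ∈ (Plain.par Gs').E → e ∈ (Gs' e.thread).E := by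
    intro e he
    obtain ⟨t, he⟩ := Set.mem_iUnion.1 he
    exact (ht' t e he).symm ▸ he
  have thr : ∀ {e}, e ∈ (Plain.par Gs).E → (fs e.thread e).thread = e.thread :=
    fun he => ht' _ _ ((h _).maps _ (mem he))
  constructor
  · exact fun e he => Set.mem_iUnion.2 ⟨_, (h e.thread).maps e (mem he)⟩
  · intro e' he' hc
    obtain ⟨m, q⟩ := (h e'.thread).fixed e' (mem' he') hc
    refine ⟨Set.mem_iUnion.2 ⟨_, m⟩, fun e he => ⟨fun hf => ?_, ?_⟩⟩
    · have : e.thread = e'.thread := (thr he).symm.trans (congrArg _ hf)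
      rw [this] at hf
      exact (q e (this ▸ mem he)).1 hf
    · rintro rfl
      exact (q e m).2 rfl
  · intro e' he' hc
    obtain ⟨G₀, s, q, r⟩ := (h e'.thread).run e' (mem' he') hc
    refine ⟨G₀, s, ?_, fun a b hab => ⟨_, r a b hab⟩⟩
    ext e
    rw [q]
    constructor
    · rintro ⟨he, hf⟩
      refine ⟨Set.mem_iUnion.2 ⟨_, he⟩, ?_⟩
      show fs e.thread e = e'
      rw [ht _ e he, hf]
    · rintro ⟨he, hf⟩
      have : e.thread = e'.thread := (thr he).symm.trans (congrArg _ hf)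
      exact ⟨this ▸ mem he, (congrArg (fun t => fs t e) this.symm).trans hf⟩
  · intro e' he' hc
    obtain ⟨m, q⟩ := (h e'.thread).key_mem e' (mem' he') hc
    exact ⟨Set.mem_iUnion.2 ⟨_, m⟩, q⟩
  · intro a ha b hb hne
    constructor
    · rintro ⟨t, hab⟩
      obtain ⟨ma, mb, -⟩ := (o t).po_sub a b hab
      refine ⟨t, ?_⟩
      have ea := ht t a ma
      have eb := ht t b mb
      simp only [ea, eb] at hne ⊢
      exact ((h t).po_iff a ma b mb hne).1 hab
    · rintro ⟨t, hab⟩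
      obtain ⟨ma, mb, -⟩ := (o' t).po_sub _ _ hab
      have ea : a.thread = t := (thr ha).symm.trans (ht' t _ ma)
      have eb : b.thread = t := (thr hb).symm.trans (ht' t _ mb)
      refine ⟨t, ?_⟩
      have ma := mem ha
      have mb := mem hb
      simp only [ea, eb] at hne hab ma mb
      exact ((h t).po_iff a ma b mb hne).2 hab

end Abstracts
end Plain

/-! ### Runs of the ticket-lock implementation -/

section Impl
variable {Val Loc Node Wid : Type*} {T : ℕ}

theorem Sem.call_inv {M : Type*} {t : Fin T} {c : M} {v : Val} {k : ℕ} {G : Plain Val M T}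
    (h : Sem t (.call c) v k G) : k = 0 ∧ ∃ i, G = Plain.single ⟨t, i, c, v⟩ := by
  cases h
  exact ⟨rfl, _, rfl⟩

theorem Sem.letIn_call_inv {M : Type*} {t : Fin T} {c : M} {f : Val → SeqProg Val M} {v : Val}
    {k : ℕ} {G : Plain Val M T} (h : Sem t (.letIn (.call c) f) v k G) :
    ∃ i r G₂, G = (Plain.single ⟨t, i, c, r⟩).seq G₂ ∧ Sem t (f r) v k G₂ := by
  cases h with
  | letIn s₁ s₂ _ =>
    obtain ⟨-, i, rfl⟩ := s₁.call_inv
    exact ⟨i, _, _, rfl, s₂⟩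
  | letBrk s hne => exact absurd s.call_inv.1 hne

variable {σ : Sys Val Loc Node T} (lay : Layout σ)

theorem pollTurns_sem {x : Loc} {v : Val} {ts : List (Fin T)} {t : Fin T} {r : Val} {k : ℕ}
    {G : Plain Val (Call Val Loc Node Wid) T} (h : Sem t (pollTurns lay x v ts) r k G) :
    (∀ e ∈ G.E, ∃ u, e.call = .sv (.read (lay.cell x (.turn u)))) ∧
      (k = 0 ∨ k = 1 ∧ r = σ.unit ∧ ∃ e ∈ G.E, e.out = v) := by
  induction ts generalizing G with
  | nil =>
    cases h
    exact ⟨fun _ h => h.elim, .inl rfl⟩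
  | cons u ts ih =>
    obtain ⟨i, r', G₂, rfl, h'⟩ := Sem.letIn_call_inv h
    split at h'
    · rename_i hr
      cases h'
      refine ⟨?_, .inr ⟨rfl, rfl, _, .inl rfl, hr⟩⟩
      rintro e (rfl | he)
      · exact ⟨u, rfl⟩
      · exact he.elim
    · obtain ⟨h₁, h₂⟩ := ih h'
      refine ⟨?_, h₂.imp_right fun ⟨a, b, e, he, ho⟩ => ⟨a, b, e, .inr he, ho⟩⟩
      rintro e (rfl | he)
      · exact ⟨u, rfl⟩
      · exact h₁ e he

theorem pollLoop_sem {x : Loc} {v : Val} {ts : List (Fin T)} {t : Fin T} {r : Val} {k : ℕ}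
    {G : Plain Val (Call Val Loc Node Wid) T}
    (h : Sem t (.loop (pollTurns lay x v ts)) r k G) :
    (∀ e ∈ G.E, ∃ u, e.call = .sv (.read (lay.cell x (.turn u)))) ∧
      k = 0 ∧ r = σ.unit ∧ ∃ e ∈ G.E, e.out = v := by
  generalize hq : SeqProg.loop (pollTurns lay x v ts) = q at h
  induction h with
  | loopBrk s _ =>
    cases hq
    obtain ⟨h₁, h | ⟨h₂, h₃⟩⟩ := pollTurns_sem lay s
    · exact absurd h (Nat.succ_ne_zero _)
    · exact ⟨h₁, Nat.succ.inj h₂, h₃⟩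
  | loopNext s₁ s₂ _ _ ih =>
    cases hq
    obtain ⟨h₁, h₂, h₃, e, he, ho⟩ := ih rfl
    refine ⟨?_, h₂, h₃, e, .inr he, ho⟩
    rintro e (he | he)
    · exact (pollTurns_sem lay s₁).1 e he
    · exact h₁ e he
  | _ => cases hq

/-- The events of an acquire: `faa` fetches the ticket, `wt` waits for it, `rd` reads it, and
`poll` is a read of a turn variable that returns the ticket. -/
structure AcqTrace [One Val] (d : Wid) (t : Fin T) (x : Loc)
    (G : Plain Val (Call Val Loc Node Wid) T)
    (faa wt rd poll : Event Val (Call Val Loc Node Wid) T) : Prop where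
  faa_mem : faa ∈ G.E
  wt_mem : wt ∈ G.E
  rd_mem : rd ∈ G.E
  poll_mem : poll ∈ G.E
  faa_call : faa.call = .rdma (.rfaa (lay.cell x (.ticket t)) (lay.cell x .dispenser) 1 d)
  wt_call : wt.call = .rdma (.wait d)
  rd_call : rd.call = .rdma (.read (lay.cell x (.ticket t)))
  poll_call : ∃ u, poll.call = .sv (.read (lay.cell x (.turn u)))
  poll_out : poll.out = rd.out
  faa_wt : G.po faa wt
  wt_rd : G.po wt rd
  rd_poll : G.po rd poll
  eq_or : ∀ e ∈ G.E, e = faa ∨ e = wt ∨ e = rd ∨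
    ∃ u, e.call = .sv (.read (lay.cell x (.turn u)))

theorem acqImpl_sem [One Val] {d : Wid} {t : Fin T} {x : Loc} {v : Val} {k : ℕ}
    {G : Plain Val (Call Val Loc Node Wid) T} (h : Sem t (acqImpl lay d t x) v k G) :
    k = 0 ∧ v = σ.unit ∧ ∃ faa wt rd poll, AcqTrace lay d t x G faa wt rd poll := by
  obtain ⟨i₁, r₁, G₁, rfl, h'⟩ := Sem.letIn_call_inv h
  obtain ⟨i₂, r₂, G₂, rfl, h''⟩ := Sem.letIn_call_inv h'
  obtain ⟨i₃, r₃, G₃, rfl, hl⟩ := Sem.letIn_call_inv h''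
  obtain ⟨h₁, rfl, rfl, e, he, rfl⟩ := pollLoop_sem lay hl
  refine ⟨rfl, rfl,
    ⟨t, i₁, .rdma (.rfaa (lay.cell x (.ticket t)) (lay.cell x .dispenser) 1 d), r₁⟩,
    ⟨t, i₂, .rdma (.wait d), r₂⟩, ⟨t, i₃, .rdma (.read (lay.cell x (.ticket t))), e.out⟩, e, ?_⟩
  exact {
    faa_mem := .inl rfl
    wt_mem := .inr (.inl rfl)
    rd_mem := .inr (.inr (.inl rfl))
    poll_mem := .inr (.inr (.inr he))
    faa_call := rfl
    wt_call := rfl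
    rd_call := rfl
    poll_call := h₁ e he
    poll_out := rfl
    faa_wt := .inr (.inr ⟨rfl, .inl rfl⟩)
    wt_rd := .inr (.inl (.inr (.inr ⟨rfl, .inl rfl⟩)))
    rd_poll := .inr (.inl (.inr (.inl (.inr (.inr ⟨rfl, he⟩)))))
    eq_or := fun a ha => ha.imp_right (.imp_right (.imp_right (h₁ a))) }

/-- The events of a release: `rd` reads the ticket, `wr` writes the next turn, and `bc`
broadcasts it. -/
structure RelTrace [One Val] [Add Val] (d : Wid) (t : Fin T) (x : Loc)
    (G : Plain Val (Call Val Loc Node Wid) T)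
    (rd wr bc : Event Val (Call Val Loc Node Wid) T) : Prop where
  rd_mem : rd ∈ G.E
  wr_mem : wr ∈ G.E
  bc_mem : bc ∈ G.E
  rd_call : rd.call = .rdma (.read (lay.cell x (.ticket t)))
  wr_call : wr.call = .sv (.write (lay.cell x (.turn t)) (rd.out + 1))
  bc_call : bc.call = .sv (.bcast (lay.cell x (.turn t)) d {σ.threadNode t}ᶜ)
  rd_wr : G.po rd wr
  eq_or : ∀ e ∈ G.E, e = rd ∨ e = wr ∨ e = bc

theorem relImpl_sem [One Val] [Add Val] {d : Wid} {t : Fin T} {x : Loc} {v : Val} {k : ℕ}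
    {G : Plain Val (Call Val Loc Node Wid) T} (h : Sem t (relImpl lay d t x) v k G) :
    k = 0 ∧ ∃ rd wr bc, bc.out = v ∧ RelTrace lay d t x G rd wr bc := by
  obtain ⟨i₁, r₁, G₁, rfl, h'⟩ := Sem.letIn_call_inv h
  obtain ⟨i₂, r₂, G₂, rfl, h''⟩ := Sem.letIn_call_inv h'
  obtain ⟨rfl, i₃, rfl⟩ := Sem.call_inv h''
  refine ⟨rfl, ⟨t, i₁, .rdma (.read (lay.cell x (.ticket t))), r₁⟩,
    ⟨t, i₂, .sv (.write (lay.cell x (.turn t)) (r₁ + 1)), r₂⟩,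
    ⟨t, i₃, .sv (.bcast (lay.cell x (.turn t)) d {σ.threadNode t}ᶜ), v⟩, rfl, ?_⟩
  exact {
    rd_mem := .inl rfl
    wr_mem := .inr (.inl rfl)
    bc_mem := .inr (.inr rfl)
    rd_call := rfl
    wr_call := rfl
    bc_call := rfl
    rd_wr := .inr (.inr ⟨rfl, .inl rfl⟩)
    eq_or := fun a ha => ha }

theorem pollTurns_callsIn {C : Set (Call Val Loc Node Wid)} (hC : Set.range Call.sv ⊆ C)
    (x : Loc) (v : Val) (ts : List (Fin T)) : CallsIn C (pollTurns lay x v ts) := by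
  induction ts with
  | nil => exact .val _
  | cons u ts ih =>
    refine .letIn (.call (hC ⟨_, rfl⟩)) fun r => ?_
    split
    · exact .brk _ _
    · exact ih

variable [AddMonoidWithOne Val] (dAcq dRel : Fin T → Loc → Wid)

theorem wlockLib_notMem : (wlockLib σ : Library Val (Call Val Loc Node Wid) Loc Node T) ∉
    ({rdmaLib σ, svLib σ} : Set (Library Val (Call Val Loc Node Wid) Loc Node T)) := by
  rintro (h | h)
  · have : Call.rdma .mfence ∈
        (wlockLib σ : Library Val (Call Val Loc Node Wid) Loc Node T).calls := h ▸ ⟨_, rfl⟩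
    obtain ⟨_, h⟩ := this
    cases h
  · have : Call.sv (.gfence ∅) ∈
        (wlockLib σ : Library Val (Call Val Loc Node Wid) Loc Node T).calls := h ▸ ⟨_, rfl⟩
    obtain ⟨_, h⟩ := this
    cases h

theorem wlockImpl_no_break {t : Fin T} {c : Call Val Loc Node Wid} (hc : c ∈ Set.range Call.lock)
    {v : Val} {k : ℕ} {G : Plain Val (Call Val Loc Node Wid) T} :
    ¬ Sem t (wlockImpl lay dAcq dRel t c) v (k + 1) G := by
  obtain ⟨x | x, rfl⟩ := hc
  · exact fun h => Nat.succ_ne_zero _ (acqImpl_sem lay h).1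
  · exact fun h => Nat.succ_ne_zero _ (relImpl_sem lay h).1

theorem wlockImpl_wellDefined : WellDefined {rdmaLib σ, svLib σ} (wlockLib σ)
    (wlockImpl lay dAcq dRel) where
  not_mem := wlockLib_notMem
  calls := by
    have hr : ∀ c, Call.rdma c ∈ ⋃ L' ∈ ({rdmaLib σ, svLib σ} :
        Set (Library Val (Call Val Loc Node Wid) Loc Node T)), L'.calls := fun c =>
      Set.mem_biUnion (x := rdmaLib σ) (.inl rfl) ⟨c, rfl⟩
    have hs : ∀ c, Call.sv c ∈ ⋃ L' ∈ ({rdmaLib σ, svLib σ} :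
        Set (Library Val (Call Val Loc Node Wid) Loc Node T)), L'.calls := fun c =>
      Set.mem_biUnion (x := svLib σ) (.inr rfl) ⟨c, rfl⟩
    rintro t c ⟨x | x, rfl⟩
    · exact .letIn (.call (hr _)) fun _ => .letIn (.call (hr _)) fun _ =>
        .letIn (.call (hr _)) fun v => .loop (pollTurns_callsIn lay
          (Set.range_subset_iff.2 hs) _ _ _)
    · exact .letIn (.call (hr _)) fun _ => .letIn (.call (hs _)) fun _ => .call (hs _)
  no_break t c hc v k G := wlockImpl_no_break lay dAcq dRel hc
  nonempty := by
    rintro t c ⟨x | x, rfl⟩ v G h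
    · obtain ⟨-, -, _, _, _, _, h⟩ := acqImpl_sem lay h
      exact ⟨_, h.faa_mem⟩
    · obtain ⟨-, _, _, _, -, h⟩ := relImpl_sem lay h
      exact ⟨_, h.rd_mem⟩

/-- The call in the implementation of a lock call whose event lends its identifier to the
event of the lock call. -/
def wlockKey : Fin T → Call Val Loc Node Wid → Call Val Loc Node Wid
  | t, .lock (.acq x) =>
      .rdma (.rfaa (lay.cell x (.ticket t)) (lay.cell x .dispenser) 1 (dAcq t x))
  | t, .lock (.rel x) => .sv (.bcast (lay.cell x (.turn t)) (dRel t x) {σ.threadNode t}ᶜ)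
  | _, c => c

/-- Calls of the RDMA and shared-variable libraries without a return value return `()`. -/
def ReturnsUnit (σ : Sys Val Loc Node T) (e : Event Val (Call Val Loc Node Wid) T) : Prop :=
  (∀ c, e.call = .rdma c → ¬ c.ReturnsVal → e.out = σ.unit) ∧
    ∀ c, e.call = .sv c → ¬ c.ReturnsVal → e.out = σ.unit

theorem exists_wlockKey {t : Fin T} {c : Call Val Loc Node Wid} (hc : c ∈ Set.range Call.lock)
    {v : Val} {G : Plain Val (Call Val Loc Node Wid) T}
    (h : Sem t (wlockImpl lay dAcq dRel t c) v 0 G) (hG : ∀ e ∈ G.E, ReturnsUnit σ e) :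
    ∃ i, (⟨t, i, wlockKey lay dAcq dRel t c, σ.unit⟩ :
      Event Val (Call Val Loc Node Wid) T) ∈ G.E := by
  have ht := h.ordered.2
  obtain ⟨x | x, rfl⟩ := hc
  · obtain ⟨-, -, faa, _, _, _, h⟩ := acqImpl_sem lay h
    have h₁ := (hG _ h.faa_mem).1 _ h.faa_call not_false
    have h₂ := ht _ h.faa_mem
    refine ⟨faa.ident, ?_⟩
    convert h.faa_mem using 1
    ext1
    exacts [h₂.symm, rfl, h.faa_call.symm, h₁.symm]
  · obtain ⟨-, _, _, bc, -, h⟩ := relImpl_sem lay h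
    have h₁ := (hG _ h.bc_mem).2 _ h.bc_call not_false
    have h₂ := ht _ h.bc_mem
    refine ⟨bc.ident, ?_⟩
    convert h.bc_mem using 1
    ext1
    exacts [h₂.symm, rfl, h.bc_call.symm, h₁.symm]

end Impl

/-! ### Consistency of sub-executions -/

theorem StrictTotalOn.restrict {α : Type*} {r : α → α → Prop} {A B S : Set α}
    (h : StrictTotalOn r A) (hB : ∀ a, a ∈ B ↔ a ∈ A ∧ a ∈ S) :
    StrictTotalOn (fun a b => r a b ∧ a ∈ S ∧ b ∈ S) B where
  sub a b hab := ⟨(hB a).2 ⟨(h.sub a b hab.1).1, hab.2.1⟩, (hB b).2 ⟨(h.sub a b hab.1).2, hab.2.2⟩⟩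
  irrefl a haa := h.irrefl a haa.1
  trans a b c hab hbc := ⟨h.trans a b c hab.1 hbc.1, hab.2.1, hbc.2.2⟩
  total a ha b hb hne := by
    obtain ⟨ha, ha'⟩ := (hB a).1 ha
    obtain ⟨hb, hb'⟩ := (hB b).1 hb
    exact (h.total a ha b hb hne).imp (fun h => ⟨h, ha', hb'⟩) (fun h => ⟨h, hb', ha'⟩)

section SubExec
variable {Val M Node : Type*} {T : ℕ}

/-- `K` consists of some of the events of `G`, with the same program order and stamps. Nothing is
required of the synchronisation and happens-before orders. -/
structure SubExec (K G : Exec Val M Node T) : Prop where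
  E_sub : ∀ e ∈ K.E, e ∈ G.E
  po_sub : ∀ a b, K.po a b → a ∈ K.E ∧ b ∈ K.E
  po_iff : ∀ a ∈ K.E, ∀ b ∈ K.E, (K.po a b ↔ G.po a b)
  stmp : ∀ e ∈ K.E, K.stmp e = G.stmp e

namespace SubExec
variable {K G : Exec Val M Node T} (h : SubExec K G)
include h

theorem po {a b : Event Val M T} (hab : K.po a b) : G.po a b :=
  (h.po_iff a (h.po_sub a b hab).1 b (h.po_sub a b hab).2).1 hab

theorem mem_SE_iff (s : SubEvent Val M Node T) : s ∈ K.SE ↔ s ∈ G.SE ∧ s.1 ∈ K.E :=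
  ⟨fun hs => ⟨⟨h.E_sub _ hs.1, h.stmp _ hs.1 ▸ hs.2⟩, hs.1⟩,
    fun hs => ⟨hs.2, (h.stmp _ hs.2).symm ▸ hs.1.2⟩⟩

theorem SE_sub {s : SubEvent Val M Node T} (hs : s ∈ K.SE) : s ∈ G.SE :=
  ((h.mem_SE_iff s).1 hs).1

theorem reads_sub {s : SubEvent Val M Node T} (hs : s ∈ K.Reads) : s ∈ G.Reads :=
  ⟨h.SE_sub hs.1, hs.2⟩

theorem writes_sub {s : SubEvent Val M Node T} (hs : s ∈ K.Writes) : s ∈ G.Writes :=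
  ⟨h.SE_sub hs.1, hs.2⟩

theorem ppo {s₁ s₂ : SubEvent Val M Node T} (hs : K.ppo s₁ s₂) : G.ppo s₁ s₂ :=
  ⟨h.SE_sub hs.1, h.SE_sub hs.2.1, h.po hs.2.2.1, hs.2.2.2⟩

end SubExec
end SubExec

section RdmaSub
variable {Val Loc Node Wid : Type*} {T : ℕ}
  {σ : Sys Val Loc Node T} {K G : Exec Val (Call Val Loc Node Wid) Node T}

/-- The restriction of a witness to the subevents of `K`. -/
def RdmaWit.restrict (w : RdmaWit Val Loc Node Wid T)
    (K : Exec Val (Call Val Loc Node Wid) Node T) : RdmaWit Val Loc Node Wid T where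
  vR := w.vR
  vW := w.vW
  rf s₁ s₂ := w.rf s₁ s₂ ∧ s₁ ∈ K.SE ∧ s₂ ∈ K.SE
  moAt x s₁ s₂ := w.moAt x s₁ s₂ ∧ s₁ ∈ K.SE ∧ s₂ ∈ K.SE
  nfo s₁ s₂ := w.nfo s₁ s₂ ∧ s₁ ∈ K.SE ∧ s₂ ∈ K.SE
  raoAt n s₁ s₂ := w.raoAt n s₁ s₂ ∧ s₁ ∈ K.SE ∧ s₂ ∈ K.SE

namespace RdmaWit
variable {w : RdmaWit Val Loc Node Wid T}

theorem exists_rf_restrict_iff [Zero Val] [Add Val] (h : SubExec K G) (wf : w.WellFormed σ G)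
    (hrf : ∀ s₁ s₂, w.rf s₁ s₂ → s₂.1 ∈ K.E → s₁.1 ∈ K.E)
    {r : SubEvent Val (Call Val Loc Node Wid) Node T} (hr : r ∈ K.SE)
    (p : SubEvent Val (Call Val Loc Node Wid) Node T → Prop) :
    (∃ s, (w.restrict K).rf s r ∧ p s) ↔ ∃ s, w.rf s r ∧ p s :=
  ⟨fun ⟨s, hs, hp⟩ => ⟨s, hs.1, hp⟩, fun ⟨s, hs, hp⟩ =>
    ⟨s, ⟨hs, (h.mem_SE_iff s).2 ⟨(wf.rf_sub s r hs).1.1, hrf s r hs hr.1⟩, hr⟩, hp⟩⟩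

theorem WellFormed.restrict [Zero Val] [Add Val] (wf : w.WellFormed σ G) (h : SubExec K G)
    (hrf : ∀ s₁ s₂, w.rf s₁ s₂ → s₂.1 ∈ K.E → s₁.1 ∈ K.E) :
    (w.restrict K).WellFormed σ K where
  read_val e a x hs := wf.read_val e a x (h.reads_sub hs)
  cas_read_val e a x v₁ v₂ hs := wf.cas_read_val e a x v₁ v₂ (h.reads_sub hs)
  write_val e a x v hs := wf.write_val e a x v (h.writes_sub hs)
  cas_write_val e a x v₁ v₂ hs := wf.cas_write_val e a x v₁ v₂ (h.writes_sub hs)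
  put_val e n h₁ h₂ := wf.put_val e n (h.SE_sub h₁) (h.SE_sub h₂)
  get_val e n h₁ h₂ := wf.get_val e n (h.SE_sub h₁) (h.SE_sub h₂)
  rmw_val e n h₁ h₂ := wf.rmw_val e n (h.SE_sub h₁) (h.SE_sub h₂)
  rf_sub s₁ s₂ hs := ⟨⟨hs.2.1, (wf.rf_sub s₁ s₂ hs.1).1.2⟩, ⟨hs.2.2, (wf.rf_sub s₁ s₂ hs.1).2.2⟩⟩
  rf_match s₁ s₂ hs := wf.rf_match s₁ s₂ hs.1
  rf_fun s₁ s₁' s₂ hs hs' := wf.rf_fun s₁ s₁' s₂ hs.1 hs'.1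
  rf_zero s hs hn := wf.rf_zero s (h.reads_sub hs) fun ⟨s₁, hs₁⟩ => by
    obtain ⟨u, hu, -⟩ :=
      (exists_rf_restrict_iff h wf hrf hs.1 (fun _ => True)).2 ⟨s₁, hs₁, trivial⟩
    exact hn ⟨u, hu⟩
  mo_total x := (wf.mo_total x).restrict fun s =>
    ⟨fun hs => ⟨⟨h.writes_sub hs.1, hs.2⟩, hs.1.1⟩, fun hs => ⟨⟨hs.2, hs.1.1.2⟩, hs.1.2⟩⟩
  nfo_sub s₁ s₂ hs := hs.2
  nfo_total s₁ h₁ s₂ h₂ hp := (wf.nfo_total s₁ (h.SE_sub h₁) s₂ (h.SE_sub h₂) hp).imp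
    (fun hn => ⟨hn, h₁, h₂⟩) (fun hn => ⟨hn, h₂, h₁⟩)
  rcas_fail e he x y v₁ v₂ d hc hs :=
    wf.rcas_fail e (h.E_sub e he) x y v₁ v₂ d hc ((h.stmp e he).symm.trans hs)
  rcas_succ e he x y v₁ v₂ d hc hs :=
    wf.rcas_succ e (h.E_sub e he) x y v₁ v₂ d hc ((h.stmp e he).symm.trans hs)
  rfaa_val e he := wf.rfaa_val e (h.E_sub e he)
  rao_total n := (wf.rao_total n).restrict fun s =>
    ⟨fun hs => ⟨⟨h.SE_sub hs.1, hs.2⟩, hs.1⟩, fun hs => ⟨hs.2, hs.1.2⟩⟩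

variable {s₁ s₂ : SubEvent Val (Call Val Loc Node Wid) Node T}

theorem poWid_sub (h : SubExec K G) {a b : Event Val (Call Val Loc Node Wid) T}
    (hab : poWid K a b) : poWid G a b := ⟨h.po hab.1, hab.2⟩

theorem iso_sub (h : SubExec K G) (hs : rdmaIso K s₁ s₂) : rdmaIso G s₁ s₂ :=
  ⟨h.SE_sub hs.1, h.SE_sub hs.2.1, hs.2.2⟩

theorem pfg_sub (h : SubExec K G) (hs : pfg K s₁ s₂) : pfg G s₁ s₂ :=
  ⟨h.SE_sub hs.1, h.SE_sub hs.2.1, hs.2.2.1, hs.2.2.2.1, poWid_sub h hs.2.2.2.2⟩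

theorem pfp_sub (h : SubExec K G) (hs : pfp K s₁ s₂) : pfp G s₁ s₂ :=
  ⟨h.SE_sub hs.1, h.SE_sub hs.2.1, hs.2.2.1, hs.2.2.2.1, poWid_sub h hs.2.2.2.2⟩

theorem ippo_sub (h : SubExec K G) (hs : ippo K s₁ s₂) : ippo G s₁ s₂ :=
  hs.imp h.ppo fun hs => ⟨h.SE_sub hs.1, h.SE_sub hs.2.1, h.po hs.2.2.1, hs.2.2.2⟩

section
variable [Zero Val] [Add Val] (h : SubExec K G) (wf : w.WellFormed σ G)
  (hrf : ∀ s₁ s₂, w.rf s₁ s₂ → s₂.1 ∈ K.E → s₁.1 ∈ K.E)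
include h wf hrf

theorem rb_sub (hs : (w.restrict K).rb K s₁ s₂) : w.rb G s₁ s₂ := by
  obtain ⟨hr, hw, hc, hl⟩ := hs
  refine ⟨h.reads_sub hr, h.writes_sub hw, hc.imp ?_ ?_, hl⟩
  · rintro ⟨u, hu, x, hm⟩
    exact ⟨u, hu.1, x, hm.1⟩
  · rintro hn ⟨u, hu⟩
    obtain ⟨u, hu, -⟩ :=
      (exists_rf_restrict_iff h wf hrf hr.1 (fun _ => True)).2 ⟨u, hu, trivial⟩
    exact hn ⟨u, hu⟩

theorem ib_sub (hs : ib K (w.restrict K) s₁ s₂) : ib G w s₁ s₂ := by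
  refine Relation.TransGen.mono ?_ _ _ hs
  rintro a b (hab | hab | hab | hab | hab | hab | hab)
  · exact .inl (ippo_sub h hab)
  · exact .inr (.inl (iso_sub h hab))
  · exact .inr (.inr (.inl hab.1))
  · exact .inr (.inr (.inr (.inl (pfg_sub h hab))))
  · exact .inr (.inr (.inr (.inr (.inl (pfp_sub h hab)))))
  · exact .inr (.inr (.inr (.inr (.inr (.inl hab.1)))))
  · exact .inr (.inr (.inr (.inr (.inr (.inr ⟨hab.1, hab.2.1, hab.2.2.1.imp h.po h.po,
      rb_sub h wf hrf hab.2.2.2⟩)))))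

theorem so_sub (hs : rdmaSo K (w.restrict K) s₁ s₂) : rdmaSo G w s₁ s₂ := by
  rcases hs with hs | hs | hs | hs | hs | hs | hs | hs | hs
  · exact .inl (iso_sub h hs)
  · exact .inr (.inl ⟨hs.1.1, fun hi => hs.2 ⟨hi.1, hi.2.1,
      (h.po_iff _ hs.1.2.1.1 _ hs.1.2.2.1).2 hi.2.2.1, hs.1⟩⟩)
  · exact .inr (.inr (.inl (pfg_sub h hs)))
  · exact .inr (.inr (.inr (.inl hs.1)))
  · exact .inr (.inr (.inr (.inr (.inl (rb_sub h wf hrf hs)))))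
  · obtain ⟨x, hs⟩ := hs
    exact .inr (.inr (.inr (.inr (.inr (.inl ⟨x, hs.1⟩)))))
  · obtain ⟨x, hs⟩ := hs
    exact .inr (.inr (.inr (.inr (.inr (.inr (.inl ⟨x, hs.1⟩))))))
  · obtain ⟨hn, s, hi, x, hs⟩ := hs
    exact .inr (.inr (.inr (.inr (.inr (.inr (.inr (.inl ⟨hn, s, iso_sub h hi, x, hs.1⟩)))))))
  · exact .inr (.inr (.inr (.inr (.inr (.inr (.inr (.inr
      ⟨h.SE_sub hs.1, hs.2.1, ib_sub h wf hrf hs.2.2⟩)))))))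

end

theorem ib_mem [Zero Val] [Add Val] (wf : w.WellFormed σ G)
    (hs : ib G w s₁ s₂) : s₁ ∈ G.SE ∧ s₂ ∈ G.SE := by
  have step : ∀ a b, (ippo G a b ∨ rdmaIso G a b ∨ w.rf a b ∨ pfg G a b ∨ pfp G a b ∨ w.nfo a b ∨
      w.rbi G a b) → a ∈ G.SE ∧ b ∈ G.SE := by
    rintro a b ((hab | hab) | hab | hab | hab | hab | hab | hab)
    · exact ⟨hab.1, hab.2.1⟩
    · exact ⟨hab.1, hab.2.1⟩
    · exact ⟨hab.1, hab.2.1⟩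
    · exact ⟨(wf.rf_sub _ _ hab).1.1, (wf.rf_sub _ _ hab).2.1⟩
    · exact ⟨hab.1, hab.2.1⟩
    · exact ⟨hab.1, hab.2.1⟩
    · exact wf.nfo_sub _ _ hab
    · exact ⟨hab.2.2.2.1.1, hab.2.2.2.2.1.1⟩
  induction hs with
  | single h => exact step _ _ h
  | tail _ h ih => exact ⟨ih.1, (step _ _ h).2⟩

theorem so_mem [Zero Val] [Add Val] (wf : w.WellFormed σ G)
    (hs : rdmaSo G w s₁ s₂) : s₁ ∈ G.SE ∧ s₂ ∈ G.SE := by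
  rcases hs with hs | hs | hs | hs | hs | hs | hs | hs | hs
  · exact ⟨hs.1, hs.2.1⟩
  · exact ⟨(wf.rf_sub _ _ hs.1).1.1, (wf.rf_sub _ _ hs.1).2.1⟩
  · exact ⟨hs.1, hs.2.1⟩
  · exact wf.nfo_sub _ _ hs
  · exact ⟨hs.1.1, hs.2.1.1⟩
  · obtain ⟨x, hs⟩ := hs
    obtain ⟨h₁, h₂⟩ := (wf.mo_total x).sub _ _ hs
    exact ⟨h₁.1.1, h₂.1.1⟩
  · obtain ⟨n, hs⟩ := hs
    obtain ⟨h₁, h₂⟩ := (wf.rao_total n).sub _ _ hs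
    exact ⟨h₁.1, h₂.1⟩
  · obtain ⟨_, s, hi, n, hs⟩ := hs
    exact ⟨hi.2.1, ((wf.rao_total n).sub _ _ hs).2.1⟩
  · exact ib_mem wf hs.2.2

end RdmaWit

theorem rdmaConsistent_of_sub [Zero Val] [Add Val] {w : RdmaWit Val Loc Node Wid T}
    (h : SubExec K G) (wf : w.WellFormed σ G) (hib : ∀ s, ¬ ib G w s s)
    (hst : ∀ e ∈ G.E, ∀ c, e.call = .rdma c →
      c.Addressed σ e.thread ∧ G.stmp e ∈ c.stamps σ e.out ∧ (¬ c.ReturnsVal → e.out = σ.unit))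
    (hrf : ∀ s₁ s₂, w.rf s₁ s₂ → s₂.1 ∈ K.E → s₁.1 ∈ K.E)
    (hso : ∀ s₁ s₂, K.so s₁ s₂ ↔ rdmaSo K (w.restrict K) s₁ s₂) : RdmaConsistent σ K :=
  ⟨fun e he c hc => (h.stmp e he).symm ▸ hst e (h.E_sub e he) c hc, w.restrict K,
    wf.restrict h hrf, fun s hs => hib s (RdmaWit.ib_sub h wf hrf hs), hso⟩

end RdmaSub

section SvSub
variable {Val Loc Node Wid : Type*} {T : ℕ}
  {σ : Sys Val Loc Node T} {K G : Exec Val (Call Val Loc Node Wid) Node T}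

/-- The restriction of a witness to the subevents of `K`. -/
def SvWit.restrict (w : SvWit Val Loc Node Wid T)
    (K : Exec Val (Call Val Loc Node Wid) Node T) : SvWit Val Loc Node Wid T where
  vR := w.vR
  vW := w.vW
  rfOn n s₁ s₂ := w.rfOn n s₁ s₂ ∧ s₁ ∈ K.SE ∧ s₂ ∈ K.SE
  moOn x n s₁ s₂ := w.moOn x n s₁ s₂ ∧ s₁ ∈ K.SE ∧ s₂ ∈ K.SE

namespace SvWit
variable {w : SvWit Val Loc Node Wid T} {s₁ s₂ : SubEvent Val (Call Val Loc Node Wid) Node T}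

theorem writesOn_sub (h : SubExec K G) {n : Node} (hs : s₁ ∈ svWritesOn σ K n) :
    s₁ ∈ svWritesOn σ G n := ⟨h.SE_sub hs.1, hs.2⟩

theorem readsOn_sub (h : SubExec K G) {n : Node} (hs : s₁ ∈ svReadsOn σ K n) :
    s₁ ∈ svReadsOn σ G n := ⟨h.reads_sub hs.1, hs.2⟩

section
variable [Zero Val] (h : SubExec K G) (wf : w.WellFormed σ G)
  (hrf : ∀ n s₁ s₂, w.rfOn n s₁ s₂ → s₂.1 ∈ K.E → s₁.1 ∈ K.E)
include h wf hrf

theorem rfOn_restrict {n : Node} (hs : w.rfOn n s₁ s₂) (h₂ : s₂ ∈ K.SE) :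
    (w.restrict K).rfOn n s₁ s₂ :=
  ⟨hs, (h.mem_SE_iff s₁).2 ⟨(wf.rf_sub n s₁ s₂ hs).1.1, hrf n s₁ s₂ hs h₂.1⟩, h₂⟩

theorem WellFormed.restrict : (w.restrict K).WellFormed σ K where
  read_val e a x hs := wf.read_val e a x (h.reads_sub hs)
  write_val e a x v hs := wf.write_val e a x v (h.writes_sub hs)
  bcast_val e n h₁ h₂ := wf.bcast_val e n (h.SE_sub h₁) (h.SE_sub h₂)
  rf_sub n s₁ s₂ hs := ⟨⟨hs.2.1, (wf.rf_sub n s₁ s₂ hs.1).1.2⟩,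
    ⟨hs.2.2, (wf.rf_sub n s₁ s₂ hs.1).2.1.2⟩, (wf.rf_sub n s₁ s₂ hs.1).2.2⟩
  rf_match n s₁ s₂ hs := wf.rf_match n s₁ s₂ hs.1
  rf_fun n s₁ s₁' s₂ hs hs' := wf.rf_fun n s₁ s₁' s₂ hs.1 hs'.1
  rf_zero n s hs hn := wf.rf_zero n s (readsOn_sub h hs) fun ⟨s₁, hs₁⟩ =>
    hn ⟨s₁, rfOn_restrict h wf hrf hs₁ hs.1.1⟩
  mo_total x n := (wf.mo_total x n).restrict fun _ =>
    ⟨fun hs => ⟨⟨writesOn_sub h hs.1, hs.2⟩, hs.1.1⟩, fun hs => ⟨⟨hs.2, hs.1.1.2⟩, hs.1.2⟩⟩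

theorem rb_sub (hs : (w.restrict K).rb σ K s₁ s₂) : w.rb σ G s₁ s₂ := by
  obtain ⟨n, hr, hw, hl, hc⟩ := hs
  refine ⟨n, readsOn_sub h hr, writesOn_sub h hw, hl, hc.imp ?_ ?_⟩
  · rintro ⟨u, hu, x, hm⟩
    exact ⟨u, hu.1, x, hm.1⟩
  · rintro hn ⟨u, hu⟩
    exact hn ⟨u, rfOn_restrict h wf hrf hu hr.1.1⟩

end

/-- The synchronisation order exported by the shared-variable library. -/
def svSo (σ : Sys Val Loc Node T) (G : Exec Val (Call Val Loc Node Wid) Node T)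
    (w : SvWit Val Loc Node Wid T) (s₁ s₂ : SubEvent Val (Call Val Loc Node Wid) Node T) : Prop :=
  svIso G s₁ s₂ ∨ w.rfe G s₁ s₂ ∨ svPf G s₁ s₂ ∨ w.rb σ G s₁ s₂ ∨ w.mo s₁ s₂

theorem so_sub [Zero Val] (h : SubExec K G) (wf : w.WellFormed σ G)
    (hrf : ∀ n s₁ s₂, w.rfOn n s₁ s₂ → s₂.1 ∈ K.E → s₁.1 ∈ K.E)
    (hs : svSo σ K (w.restrict K) s₁ s₂) : svSo σ G w s₁ s₂ := by
  rcases hs with hs | hs | hs | hs | hs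
  · exact .inl ⟨h.SE_sub hs.1, h.SE_sub hs.2.1, hs.2.2⟩
  · obtain ⟨⟨n, hn⟩, hi⟩ := hs
    exact .inr (.inl ⟨⟨n, hn.1⟩, fun hi' => hi ⟨hi'.1, hi'.2.1,
      (h.po_iff _ hn.2.1.1 _ hn.2.2.1).2 hi'.2.2.1, n, hn⟩⟩)
  · exact .inr (.inr (.inl ⟨h.SE_sub hs.1, h.SE_sub hs.2.1, hs.2.2.1, hs.2.2.2.1,
      h.po hs.2.2.2.2.1, hs.2.2.2.2.2⟩))
  · exact .inr (.inr (.inr (.inl (rb_sub h wf hrf hs))))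
  · obtain ⟨x, n, hs⟩ := hs
    exact .inr (.inr (.inr (.inr ⟨x, n, hs.1⟩)))

theorem so_mem [Zero Val] (wf : w.WellFormed σ G) (hs : svSo σ G w s₁ s₂) :
    s₁ ∈ G.SE ∧ s₂ ∈ G.SE := by
  rcases hs with hs | hs | hs | hs | hs
  · exact ⟨hs.1, hs.2.1⟩
  · obtain ⟨⟨n, hn⟩, -⟩ := hs
    exact ⟨(wf.rf_sub _ _ _ hn).1.1, (wf.rf_sub _ _ _ hn).2.1.1⟩
  · exact ⟨hs.1, hs.2.1⟩
  · obtain ⟨n, hr, hw, -⟩ := hs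
    exact ⟨hr.1.1, hw.1⟩
  · obtain ⟨x, n, hs⟩ := hs
    obtain ⟨h₁, h₂⟩ := (wf.mo_total x n).sub _ _ hs
    exact ⟨h₁.1.1, h₂.1.1⟩

end SvWit

theorem svConsistent_of_sub [Zero Val] {w : SvWit Val Loc Node Wid T}
    (h : SubExec K G) (wf : w.WellFormed σ G)
    (hno : ∀ r s, ¬ (r.2 = .aCR ∧ G.po s.1 r.1 ∧ w.rb σ G r s ∧ s.2 = .aCW))
    (hst : ∀ e ∈ G.E, ∀ c, e.call = .sv c →
      G.stmp e = c.stamps ∧ (¬ c.ReturnsVal → e.out = σ.unit))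
    (hrf : ∀ n s₁ s₂, w.rfOn n s₁ s₂ → s₂.1 ∈ K.E → s₁.1 ∈ K.E)
    (hso : ∀ s₁ s₂, K.so s₁ s₂ ↔ SvWit.svSo σ K (w.restrict K) s₁ s₂) : SvConsistent σ K :=
  ⟨fun e he c hc => (h.stmp e he).symm ▸ hst e (h.E_sub e he) c hc, w.restrict K,
    wf.restrict h hrf, fun r s hs => hno r s
      ⟨hs.1, h.po hs.2.1, SvWit.rb_sub h wf hrf hs.2.2.1, hs.2.2.2⟩, hso⟩

end SvSub

/-! ### Remote fetch-and-add counters -/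

section Counter
variable {Val Loc Node Wid : Type*} {T : ℕ}
  {σ : Sys Val Loc Node T} {K : Exec Val (Call Val Loc Node Wid) Node T}
  {w : RdmaWit Val Loc Node Wid T}

theorem Exec.Valid.restrict {M : Type*} {G : Exec Val M Node T} (h : G.Valid) (C : Set M) :
    (G.restrict C).Valid where
  po_sub a b hab := ⟨⟨(h.po_sub a b hab.1).1, hab.2.1⟩, ⟨(h.po_sub a b hab.1).2.1, hab.2.2⟩,
    (h.po_sub a b hab.1).2.2⟩
  po_irrefl a haa := h.po_irrefl a haa.1
  po_trans a b c hab hbc := ⟨h.po_trans a b c hab.1 hbc.1, hab.2.1, hbc.2.2⟩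
  po_total a ha b hb ht hne := (h.po_total a ha.1 b hb.1 ht hne).imp
    (fun h => ⟨h, ha.2, hb.2⟩) (fun h => ⟨h, hb.2, ha.2⟩)
  stmp_nonempty e he := h.stmp_nonempty e he.1
  so_sub s₁ s₂ hs := ⟨⟨⟨(h.so_sub s₁ s₂ hs.1).1.1, hs.2.1⟩, (h.so_sub s₁ s₂ hs.1).1.2⟩,
    ⟨⟨(h.so_sub s₁ s₂ hs.1).2.1, hs.2.2⟩, (h.so_sub s₁ s₂ hs.1).2.2⟩⟩
  hb_sub s₁ s₂ hs := ⟨⟨⟨(h.hb_sub s₁ s₂ hs.1).1.1, hs.2.1⟩, (h.hb_sub s₁ s₂ hs.1).1.2⟩,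
    ⟨⟨(h.hb_sub s₁ s₂ hs.1).2.1, hs.2.2⟩, (h.hb_sub s₁ s₂ hs.1).2.2⟩⟩
  hb_trans s₁ s₂ s₃ hs hs' := ⟨h.hb_trans s₁ s₂ s₃ hs.1 hs'.1, hs.2.1, hs'.2.2⟩
  hb_irrefl s hs := h.hb_irrefl s hs.1
  so_hb s₁ s₂ hs := ⟨h.so_hb s₁ s₂ hs.1, hs.2⟩
  ppo_hb s₁ s₂ hs := ⟨h.ppo_hb s₁ s₂ ⟨⟨hs.1.1.1, hs.1.2⟩, ⟨hs.2.1.1.1, hs.2.1.2⟩, hs.2.2.1.1,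
    hs.2.2.2⟩, hs.2.2.1.2⟩

/-- An execution of the RDMA library that is explained by the witness `w`. -/
structure RdmaRun [Zero Val] [Add Val] (σ : Sys Val Loc Node T)
    (K : Exec Val (Call Val Loc Node Wid) Node T) (w : RdmaWit Val Loc Node Wid T) : Prop where
  valid : K.Valid
  stamped : ∀ e ∈ K.E, ∀ c, e.call = .rdma c →
    c.Addressed σ e.thread ∧ K.stmp e ∈ c.stamps σ e.out ∧ (¬ c.ReturnsVal → e.out = σ.unit)
  wf : w.WellFormed σ K
  ib_irrefl : ∀ s, ¬ ib K w s s
  so_hb : ∀ s₁ s₂, rdmaSo K w s₁ s₂ → K.hb s₁ s₂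

namespace RdmaRun

section Read
variable [Zero Val] [Add Val] (h : RdmaRun σ K w)
include h

theorem hb_of_rf {s r : SubEvent Val (Call Val Loc Node Wid) Node T} (hs : w.rf s r)
    (hn : s.2 ≠ .aCW) : K.hb s r :=
  h.so_hb _ _ (.inr (.inl ⟨hs, fun hi => hn hi.1⟩))

/-- A read `r` returns the value of a write `u` that happens before it, if every other write to
the location happens before `u` or after `r`. -/
theorem vW_eq_vR {y : Loc} {u r : SubEvent Val (Call Val Loc Node Wid) Node T}
    (hu : u ∈ K.Writes) (hr : r ∈ K.Reads) (lu : rdmaLoc u = {y}) (lr : rdmaLoc r = {y})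
    (hur : K.hb u r) (hall : ∀ s ∈ K.Writes, rdmaLoc s = {y} →
      s.2 ≠ .aCW ∧ (s = u ∨ K.hb s u ∨ K.hb r s)) : w.vW u = w.vR r := by
  have hne : r ≠ u := fun e => h.valid.hb_irrefl u (e ▸ hur)
  have hnrb : ¬ w.rb K r u := fun hb => h.valid.hb_irrefl u (h.valid.hb_trans _ _ _ hur
    (h.so_hb _ _ (.inr (.inr (.inr (.inr (.inl hb)))))))
  by_cases hrf : ∃ s, w.rf s r
  · obtain ⟨s, hs⟩ := hrf
    obtain ⟨sw, -⟩ := h.wf.rf_sub s r hs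
    have ls : rdmaLoc s = {y} := (h.wf.rf_match s r hs).1.trans lr
    obtain ⟨hn, rfl | hsu | hrs⟩ := hall s sw ls
    · exact (h.wf.rf_match s r hs).2
    · have hne' : s ≠ u := fun e => h.valid.hb_irrefl u (e ▸ hsu)
      refine absurd ⟨hr, hu, .inl ⟨s, hs, y, ?_⟩, lr.trans lu.symm, hne⟩ hnrb
      refine ((h.wf.mo_total y).total s ⟨sw, ls⟩ u ⟨hu, lu⟩ hne').resolve_right fun hus => ?_
      exact h.valid.hb_irrefl u (h.valid.hb_trans _ _ _
        (h.so_hb _ _ (.inr (.inr (.inr (.inr (.inr (.inl ⟨y, hus⟩))))))) hsu)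
    · exact (h.valid.hb_irrefl r (h.valid.hb_trans _ _ _ hrs (h.hb_of_rf hs hn))).elim
  · exact absurd ⟨hr, hu, .inr hrf, lr.trans lu.symm, hne⟩ hnrb

theorem vR_eq_zero {y : Loc} {r : SubEvent Val (Call Val Loc Node Wid) Node T}
    (hr : r ∈ K.Reads) (lr : rdmaLoc r = {y})
    (hall : ∀ s ∈ K.Writes, rdmaLoc s = {y} → s.2 ≠ .aCW ∧ K.hb r s) : w.vR r = 0 := by
  refine h.wf.rf_zero r hr fun ⟨s, hs⟩ => ?_
  obtain ⟨hn, hrs⟩ := hall s (h.wf.rf_sub s r hs).1 ((h.wf.rf_match s r hs).1.trans lr)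
  exact h.valid.hb_irrefl r (h.valid.hb_trans _ _ _ hrs (h.hb_of_rf hs hn))

/-- The subevents of a remote fetch-and-add, and the order between them. -/
theorem rfaa {e : Event Val (Call Val Loc Node Wid) T} (he : e ∈ K.E) {x y : Loc} {v : Val}
    {d : Wid} (hc : e.call = .rdma (.rfaa x y v d)) :
    K.stmp e = {.narr (σ.locNode y), .nrw (σ.locNode y), .nlw (σ.locNode y)} ∧
      K.hb (e, .narr (σ.locNode y)) (e, .nrw (σ.locNode y)) ∧
      K.hb (e, .narr (σ.locNode y)) (e, .nlw (σ.locNode y)) := by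
  have hst : K.stmp e = {.narr (σ.locNode y), .nrw (σ.locNode y), .nlw (σ.locNode y)} :=
    (h.stamped e he _ hc).2.1
  have hr : e.call.IsRmw := by rw [hc]; trivial
  have m₁ : (e, Stamp.narr (σ.locNode y)) ∈ K.SE := ⟨he, by rw [hst]; exact .inl rfl⟩
  have m₂ : (e, Stamp.nrw (σ.locNode y)) ∈ K.SE := ⟨he, by rw [hst]; exact .inr (.inl rfl)⟩
  have m₃ : (e, Stamp.nlw (σ.locNode y)) ∈ K.SE := ⟨he, by rw [hst]; exact .inr (.inr rfl)⟩
  exact ⟨hst,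
    h.so_hb _ _ (.inl ⟨m₁, m₂, rfl, .inr (.inr (.inr (.inr ⟨hr, _, rfl, rfl⟩)))⟩),
    h.so_hb _ _ (.inl ⟨m₁, m₃, rfl, .inr (.inr (.inr (.inl ⟨hr, _, rfl, rfl⟩)))⟩)⟩

end Read

/-- The events that fetch and increment `y`. -/
def incrs [One Val] (K : Exec Val (Call Val Loc Node Wid) Node T) (y : Loc) :
    Set (Event Val (Call Val Loc Node Wid) T) :=
  {e ∈ K.E | ∃ x d, e.call = .rdma (.rfaa x y 1 d)}

/-- The remote-atomic order between the events that fetch and increment `y`. -/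
def incrLt [One Val] (σ : Sys Val Loc Node T) (K : Exec Val (Call Val Loc Node Wid) Node T)
    (w : RdmaWit Val Loc Node Wid T) (y : Loc) (a b : Event Val (Call Val Loc Node Wid) T) :
    Prop :=
  w.raoAt (σ.locNode y) (a, .narr (σ.locNode y)) (b, .narr (σ.locNode y)) ∧
    a ∈ incrs K y ∧ b ∈ incrs K y

/-- The number of increments of `y` before `a`. -/
noncomputable def ticketNo [One Val] (σ : Sys Val Loc Node T)
    (K : Exec Val (Call Val Loc Node Wid) Node T) (w : RdmaWit Val Loc Node Wid T) (y : Loc)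
    (a : Event Val (Call Val Loc Node Wid) T) : ℕ :=
  {b | incrLt σ K w y b a}.ncard

section Incr
variable [AddMonoidWithOne Val] (h : RdmaRun σ K w) {y : Loc}
  {a b : Event Val (Call Val Loc Node Wid) T}
include h

theorem incrLt_total : StrictTotalOn (incrLt σ K w y) (incrs K y) where
  sub _ _ hab := hab.2
  irrefl a haa := (h.wf.rao_total _).irrefl _ haa.1
  trans a b c hab hbc := ⟨(h.wf.rao_total _).trans _ _ _ hab.1 hbc.1, hab.2.1, hbc.2.2⟩
  total := by
    intro a ha b hb hne
    have mem : ∀ e ∈ incrs K y, (e, Stamp.narr (σ.locNode y)) ∈ {s | s ∈ K.SE ∧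
        s.2 = .narr (σ.locNode y) ∧
        ((∃ x y' v₁ v₂ d, s.1.call = .rdma (.rcas x y' v₁ v₂ d) ∧
          σ.locNode y' = σ.locNode y) ∨
         (∃ x y' v d, s.1.call = .rdma (.rfaa x y' v d) ∧ σ.locNode y' = σ.locNode y))} := by
      rintro e ⟨he, x, d, hc⟩
      exact ⟨⟨he, by rw [(h.rfaa he hc).1]; exact .inl rfl⟩, rfl, .inr ⟨x, y, 1, d, hc, rfl⟩⟩
    exact ((h.wf.rao_total (σ.locNode y)).total _ (mem a ha) _ (mem b hb)
      (fun e => hne (congrArg Prod.fst e))).imp (fun h => ⟨h, ha, hb⟩) (fun h => ⟨h, hb, ha⟩)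

/-- The write of an increment happens before the read of each later one. -/
theorem hb_of_incrLt (hab : incrLt σ K w y a b) :
    K.hb (a, .nrw (σ.locNode y)) (b, .narr (σ.locNode y)) := by
  obtain ⟨ha, x, d, hc⟩ := hab.2.1
  have hst := (h.rfaa ha hc).1
  have hr : a.call.IsRmw := by rw [hc]; trivial
  refine h.so_hb _ _ (.inr (.inr (.inr (.inr (.inr (.inr (.inr (.inl
    ⟨⟨_, rfl⟩, (a, .narr (σ.locNode y)), ⟨⟨ha, ?_⟩, ⟨ha, ?_⟩, rfl,
      .inr (.inr (.inr (.inr ⟨hr, _, rfl, rfl⟩)))⟩, _, hab.1⟩))))))))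
  · show _ ∈ K.stmp a
    rw [hst]
    exact .inl rfl
  · show _ ∈ K.stmp a
    rw [hst]
    exact .inr (.inl rfl)

variable (hfin : K.E.Finite)
include hfin

theorem ticketNo_lt (hab : incrLt σ K w y a b) : ticketNo σ K w y a < ticketNo σ K w y b := by
  refine Set.ncard_lt_ncard ⟨fun c hc => h.incrLt_total.trans _ _ _ hc hab, fun hs => ?_⟩
    (hfin.subset fun c hc => hc.2.1.1)
  exact h.incrLt_total.irrefl a (hs hab)

/-- If `y` is written by increments only, an increment fetches the number of earlier increments:
by induction, it reads from the last earlier one. -/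
theorem vR_eq_ticketNo (hy : ∀ s ∈ K.Writes, rdmaLoc s = {y} →
      s.1 ∈ incrs K y ∧ s.2 = .nrw (σ.locNode y)) (ha : a ∈ incrs K y) :
    w.vR (a, .narr (σ.locNode y)) = ticketNo σ K w y a := by
  induction hk : ticketNo σ K w y a using Nat.strong_induction_on generalizing a with
  | _ k ih =>
    obtain ⟨haE, x, d, hc⟩ := ha
    obtain ⟨hst, h₁, -⟩ := h.rfaa haE hc
    have hr : (a, Stamp.narr (σ.locNode y)) ∈ K.Reads :=
      ⟨⟨haE, by rw [hst]; exact .inl rfl⟩, trivial⟩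
    have lr : rdmaLoc ((a, Stamp.narr (σ.locNode y)) :
        SubEvent Val (Call Val Loc Node Wid) Node T) = {y} := by
      simp [rdmaLoc, hc, RdmaCall.subLoc]
    have ha : a ∈ incrs K y := ⟨haE, x, d, hc⟩
    rcases Set.eq_empty_or_nonempty {b | incrLt σ K w y b a} with hP | hP
    · have hk0 : k = 0 := by rw [← hk, ticketNo, hP, Set.ncard_empty]
      rw [hk0, Nat.cast_zero]
      refine h.vR_eq_zero hr lr fun s hs ls => ?_
      obtain ⟨hi, h2⟩ := hy s hs ls
      obtain ⟨b, q⟩ := s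
      obtain rfl : q = _ := h2
      refine ⟨(nomatch ·), ?_⟩
      by_cases hab : a = b
      · exact hab ▸ h₁
      · have hab := (h.incrLt_total.total a ha b hi hab).resolve_right
          fun hba => Set.eq_empty_iff_forall_notMem.1 hP b hba
        obtain ⟨hbE, _, _, hbc⟩ := hi
        exact h.valid.hb_trans _ _ _ h₁ (h.valid.hb_trans _ _ _ (h.hb_of_incrLt hab)
          (h.rfaa hbE hbc).2.1)
    · have hPf : {b | incrLt σ K w y b a}.Finite := hfin.subset fun c hc => hc.2.1.1
      obtain ⟨b, hba, hmax⟩ := Set.exists_max_image _ (ticketNo σ K w y) hPf hP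
      -- By maximality of its ticket, `b` is the last increment before `a`.
      have hlast : ∀ c, incrLt σ K w y c a → c = b ∨ incrLt σ K w y c b := fun c hca => by
        by_cases hcb : c = b
        · exact .inl hcb
        · exact .inr ((h.incrLt_total.total c hca.2.1 b hba.2.1 hcb).resolve_right
            fun hbc => (h.ticketNo_lt hfin hbc).not_ge (hmax c hca))
      have hcard : ticketNo σ K w y a = ticketNo σ K w y b + 1 := by
        have : {c | incrLt σ K w y c a} = insert b {c | incrLt σ K w y c b} := by
          ext c
          refine ⟨fun hca => hlast c hca, ?_⟩
          rintro (rfl | hcb)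
          · exact hba
          · exact h.incrLt_total.trans _ _ _ hcb hba
        have hn : b ∉ {c | incrLt σ K w y c b} := h.incrLt_total.irrefl b
        have hbf : {c | incrLt σ K w y c b}.Finite := hfin.subset fun c hc => hc.2.1.1
        rw [ticketNo, this, Set.ncard_insert_of_notMem hn hbf, ticketNo]
      obtain ⟨hbE, x', d', hbc⟩ := hba.2.1
      obtain ⟨hbst, hb₁, -⟩ := h.rfaa hbE hbc
      have hbv := h.wf.rfaa_val b hbE x' y 1 d' hbc
      have key : w.vW (b, .nrw (σ.locNode y)) = w.vR (a, .narr (σ.locNode y)) := by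
        refine h.vW_eq_vR (y := y) ⟨⟨hbE, by rw [hbst]; exact .inr (.inl rfl)⟩, trivial⟩ hr
          (by simp [rdmaLoc, hbc, RdmaCall.subLoc]) lr (h.hb_of_incrLt hba) fun s hs ls => ?_
        obtain ⟨hi, h2⟩ := hy s hs ls
        obtain ⟨c, q⟩ := s
        obtain rfl : q = _ := h2
        refine ⟨(nomatch ·), ?_⟩
        have hcw : ∀ {c}, c ∈ incrs K y →
            K.hb (c, .narr (σ.locNode y)) (c, .nrw (σ.locNode y)) := by
          rintro c ⟨hcE, _, _, hcc⟩
          exact (h.rfaa hcE hcc).2.1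
        by_cases hca : c = a
        · exact .inr (.inr (hca ▸ h₁))
        rcases h.incrLt_total.total c hi a ha hca with hca | hac
        · rcases hlast c hca with rfl | hcb
          · exact .inl rfl
          · exact .inr (.inl (h.valid.hb_trans _ _ _ (h.hb_of_incrLt hcb) hb₁))
        · exact .inr (.inr (h.valid.hb_trans _ _ _ h₁
            (h.valid.hb_trans _ _ _ (h.hb_of_incrLt hac) (hcw hi))))
      rw [← key, hbv, ih _ (by omega) hba.2.1 rfl, ← hk, hcard, Nat.cast_succ]

end Incr
end RdmaRun
end Counter

/-! ### Correctness of the ticket lock -/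

section Lock
variable {Val Loc Node Wid : Type*} {T : ℕ}

/-- The locations of a call of the RDMA or the shared-variable library. -/
def Call.locs : Call Val Loc Node Wid → Set Loc
  | .rdma c => c.loc
  | .sv c => c.loc
  | .lock _ => ∅

theorem RdmaCall.subLoc_subset (c : RdmaCall Val Loc Node Wid) (a : Stamp Node) :
    c.subLoc a ⊆ c.loc := by
  cases c <;> cases a <;> simp [RdmaCall.subLoc, RdmaCall.loc]

theorem rdmaLoc_subset (s : SubEvent Val (Call Val Loc Node Wid) Node T) :
    rdmaLoc s ⊆ s.1.call.locs := by
  obtain ⟨⟨t, i, c, v⟩, a⟩ := s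
  cases c with
  | rdma c => exact RdmaCall.subLoc_subset c a
  | _ => exact Set.empty_subset _

theorem svLoc_subset (s : SubEvent Val (Call Val Loc Node Wid) Node T) :
    svLoc s ⊆ s.1.call.locs := by
  obtain ⟨⟨t, i, c, v⟩, a⟩ := s
  cases c with
  | sv c => exact subset_rfl
  | _ => exact Set.empty_subset _

/-- An execution of the shared-variable library that is explained by the witness `w`. -/
structure SvRun [Zero Val] (σ : Sys Val Loc Node T)
    (K : Exec Val (Call Val Loc Node Wid) Node T) (w : SvWit Val Loc Node Wid T) : Prop where
  valid : K.Valid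
  stamped : ∀ e ∈ K.E, ∀ c, e.call = .sv c →
    K.stmp e = c.stamps ∧ (¬ c.ReturnsVal → e.out = σ.unit)
  wf : w.WellFormed σ K
  rb_not_po : ∀ r s, ¬ (r.2 = .aCR ∧ K.po s.1 r.1 ∧ w.rb σ K r s ∧ s.2 = .aCW)
  so_hb : ∀ s₁ s₂, SvWit.svSo σ K w s₁ s₂ → K.hb s₁ s₂

/-- The events of `G` that `f` maps to `l`. -/
def runOf {M : Type*} (G : Exec Val M Node T) (f : Event Val M T → Event Val M T)
    (l : Event Val M T) : Plain Val M T :=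
  ⟨{e ∈ G.E | f e = l}, G.po⟩

variable [AddMonoidWithOne Val] {σ : Sys Val Loc Node T}

/-- A consistent execution `G` of a program with an inlined ticket lock, collapsed by `f` onto a
run `G'` of the original program. Events inside and outside the lock implementation share no
location. -/
structure LockRun (lay : Layout σ) (dAcq dRel : Fin T → Loc → Wid)
    (G : Exec Val (Call Val Loc Node Wid) Node T) (G' : Plain Val (Call Val Loc Node Wid) T)
    (f : Event Val (Call Val Loc Node Wid) T → Event Val (Call Val Loc Node Wid) T)
    (w : RdmaWit Val Loc Node Wid T) (u : SvWit Val Loc Node Wid T) : Prop where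
  valid : G.Valid
  finite : G.E.Finite
  ordered : G'.Ordered
  abs : Abstracts (Set.range Call.lock) (wlockImpl lay dAcq dRel) (wlockKey lay dAcq dRel) σ.unit
    G.toPlain G' f
  rdma : RdmaRun σ (G.restrict (Set.range Call.rdma)) w
  sv : SvRun σ (G.restrict (Set.range Call.sv)) u
  separate : ∀ a ∈ G.E, ∀ b ∈ G.E, (f a).call ∈ Set.range Call.lock →
    (f b).call ∉ Set.range Call.lock → Disjoint a.call.locs b.call.locs

namespace LockRun
variable {lay : Layout σ} {dAcq dRel : Fin T → Loc → Wid}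
  {G : Exec Val (Call Val Loc Node Wid) Node T} {G' : Plain Val (Call Val Loc Node Wid) T}
  {f : Event Val (Call Val Loc Node Wid) T → Event Val (Call Val Loc Node Wid) T}
  {w : RdmaWit Val Loc Node Wid T} {u : SvWit Val Loc Node Wid T}
  (h : LockRun lay dAcq dRel G G' f w u)
include h

theorem po_of_po {a b : Event Val (Call Val Loc Node Wid) T} (ha : a ∈ G.E) (hb : b ∈ G.E)
    (hab : G'.po (f a) (f b)) : G.po a b :=
  (h.abs.po_iff a ha b hb fun e => h.ordered.irrefl _ (e ▸ hab)).2 hab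

theorem thread_eq {e : Event Val (Call Val Loc Node Wid) T} (he : e ∈ G.E) :
    (f e).thread = e.thread := by
  by_cases hc : (f e).call ∈ Set.range Call.lock
  · obtain ⟨G₀, s, hE, -⟩ := h.abs.run _ (h.abs.maps e he) hc
    have : e ∈ G₀.E := hE ▸ ⟨he, rfl⟩
    exact (s.ordered.2 e this).symm
  · rw [((h.abs.fixed _ (h.abs.maps e he) hc).2 e he).1 rfl |>.symm]

theorem impl_of_loc {a b : Event Val (Call Val Loc Node Wid) T} (ha : a ∈ G.E) (hb : b ∈ G.E)
    (hc : (f a).call ∈ Set.range Call.lock) {y : Loc} (hya : y ∈ a.call.locs)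
    (hyb : y ∈ b.call.locs) : (f b).call ∈ Set.range Call.lock :=
  by_contra fun hn => Set.disjoint_left.1 (h.separate a ha b hb hc hn) hya hyb

theorem hb_of_po {a b : Event Val (Call Val Loc Node Wid) T} {p q : Stamp Node}
    (ha : p ∈ G.stmp a) (hb : q ∈ G.stmp b) (hab : G.po a b) (hpq : p.sto q) :
    G.hb (a, p) (b, q) :=
  h.valid.ppo_hb _ _ ⟨⟨(h.valid.po_sub a b hab).1, ha⟩, ⟨(h.valid.po_sub a b hab).2.1, hb⟩,
    hab, hpq⟩

theorem rdma_stamp {e : Event Val (Call Val Loc Node Wid) T} (he : e ∈ G.E)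
    {c : RdmaCall Val Loc Node Wid} (hc : e.call = .rdma c) : G.stmp e ∈ c.stamps σ e.out :=
  (h.rdma.stamped e ⟨he, hc ▸ ⟨c, rfl⟩⟩ c hc).2.1

theorem sv_stamp {e : Event Val (Call Val Loc Node Wid) T} (he : e ∈ G.E)
    {c : SvCall Val Loc Node Wid} (hc : e.call = .sv c) : G.stmp e = c.stamps :=
  (h.sv.stamped e ⟨he, hc ▸ ⟨c, rfl⟩⟩ c hc).1

theorem read_stamp {r : Event Val (Call Val Loc Node Wid) T} (hr : r ∈ G.E) {y : Loc}
    (hc : r.call = .rdma (.read y)) : Stamp.aCR ∈ G.stmp r := by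
  have := h.rdma_stamp hr hc
  simp only [RdmaCall.stamps, Set.mem_singleton_iff] at this
  simp [this]

theorem acq_trace {l : Event Val (Call Val Loc Node Wid) T} (hl : l ∈ G'.E) {x : Loc}
    (hc : l.call = .lock (.acq x)) : l.out = σ.unit ∧ ∃ faa wt rd poll,
      AcqTrace lay (dAcq l.thread x) l.thread x (runOf G f l) faa wt rd poll := by
  obtain ⟨G₀, s, hE, hpo⟩ := h.abs.run l hl (hc ▸ ⟨_, rfl⟩)
  rw [hc] at s
  obtain ⟨-, ho, faa, wt, rd, poll, t⟩ := acqImpl_sem lay s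
  have hE : ∀ e, e ∈ G₀.E ↔ e ∈ (runOf G f l).E := fun e => by rw [hE]; rfl
  exact ⟨ho, faa, wt, rd, poll, (hE _).1 t.faa_mem, (hE _).1 t.wt_mem, (hE _).1 t.rd_mem,
    (hE _).1 t.poll_mem, t.faa_call, t.wt_call, t.rd_call, t.poll_call, t.poll_out,
    hpo _ _ t.faa_wt, hpo _ _ t.wt_rd, hpo _ _ t.rd_poll, fun e he => t.eq_or e ((hE _).2 he)⟩

theorem rel_trace {l : Event Val (Call Val Loc Node Wid) T} (hl : l ∈ G'.E) {x : Loc}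
    (hc : l.call = .lock (.rel x)) : l.out = σ.unit ∧ ∃ rd wr bc,
      RelTrace lay (dRel l.thread x) l.thread x (runOf G f l) rd wr bc := by
  obtain ⟨G₀, s, hE, hpo⟩ := h.abs.run l hl (hc ▸ ⟨_, rfl⟩)
  rw [hc] at s
  -- A release returns the output of its broadcast.
  obtain ⟨-, rd, wr, bc, ho, t⟩ := relImpl_sem lay s
  have hE : ∀ e, e ∈ G₀.E ↔ e ∈ (runOf G f l).E := fun e => by rw [hE]; rfl
  have hb : bc ∈ G.E := ((hE _).1 t.bc_mem).1
  refine ⟨ho.symm.trans ((h.sv.stamped bc ⟨hb, t.bc_call ▸ ⟨_, rfl⟩⟩ _ t.bc_call).2 not_false),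
    rd, wr, bc, (hE _).1 t.rd_mem, (hE _).1 t.wr_mem, (hE _).1 t.bc_mem, t.rd_call, t.wr_call,
    t.bc_call, hpo _ _ t.rd_wr, fun e he => t.eq_or e ((hE _).2 he)⟩

/-- The lock implementation performs RDMA writes only when it fetches a ticket: to the dispenser and
to the private ticket of the thread. -/
theorem rdma_write {e : Event Val (Call Val Loc Node Wid) T} {p : Stamp Node} (he : e ∈ G.E)
    (hp : p ∈ G.stmp e) (hw : p.IsWrite) (hr : e.call ∈ Set.range Call.rdma)
    (hc : (f e).call ∈ Set.range Call.lock) :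
    ∃ x, (f e).call = .lock (.acq x) ∧
      e.call = .rdma (.rfaa (lay.cell x (.ticket (f e).thread)) (lay.cell x .dispenser) 1
        (dAcq (f e).thread x)) ∧
      ((p = .nrw (σ.locNode (lay.cell x .dispenser)) ∧
          rdmaLoc (e, p) = {lay.cell x .dispenser}) ∨
        (p = .nlw (σ.locNode (lay.cell x .dispenser)) ∧
          rdmaLoc (e, p) = {lay.cell x (.ticket (f e).thread)})) := by
  have no_read : ∀ y, e.call ≠ .rdma (.read y) := fun y hy => by
    obtain rfl : p = .aCR := by
      have := h.rdma_stamp he hy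
      simp only [RdmaCall.stamps, Set.mem_singleton_iff] at this
      simpa [this] using hp
    exact hw
  have no_wait : ∀ d, e.call ≠ .rdma (.wait d) := fun d hd => by
    obtain rfl : p = .aWT := by
      have := h.rdma_stamp he hd
      simp only [RdmaCall.stamps, Set.mem_singleton_iff] at this
      simpa [this] using hp
    exact hw
  have no_sv : ∀ c, e.call ≠ .sv c := fun c hc => by
    obtain ⟨_, hr⟩ := hr
    exact absurd (hr.trans hc) (by simp)
  obtain ⟨x | x, hx⟩ := hc
  · obtain ⟨-, faa, wt, rd, poll, t⟩ := h.acq_trace (h.abs.maps e he) hx.symm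
    rcases t.eq_or e ⟨he, rfl⟩ with h' | h' | h' | ⟨_, h'⟩
    · subst h'
      refine ⟨x, hx.symm, t.faa_call, ?_⟩
      have := h.rdma_stamp he t.faa_call
      simp only [RdmaCall.stamps, Set.mem_singleton_iff] at this
      rw [this] at hp
      simp only [rdmaLoc, t.faa_call]
      rcases hp with rfl | rfl | rfl
      · exact hw.elim
      · exact .inl ⟨rfl, rfl⟩
      · exact .inr ⟨rfl, rfl⟩
    · exact (no_wait _ ((congrArg Event.call h').trans t.wt_call)).elim
    · exact (no_read _ ((congrArg Event.call h').trans t.rd_call)).elim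
    · exact (no_sv _ h').elim
  · obtain ⟨-, rd, wr, bc, t⟩ := h.rel_trace (h.abs.maps e he) hx.symm
    rcases t.eq_or e ⟨he, rfl⟩ with h' | h' | h'
    · exact (no_read _ ((congrArg Event.call h').trans t.rd_call)).elim
    · exact (no_sv _ ((congrArg Event.call h').trans t.wr_call)).elim
    · exact (no_sv _ ((congrArg Event.call h').trans t.bc_call)).elim

/-- The lock implementation writes shared variables only when it releases a lock, with a write
and a broadcast of the turn variable of the thread. -/
theorem sv_write {e : Event Val (Call Val Loc Node Wid) T} {p : Stamp Node} (he : e ∈ G.E)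
    (hp : p ∈ G.stmp e) (hw : p.IsWrite) (hr : e.call ∈ Set.range Call.sv)
    (hc : (f e).call ∈ Set.range Call.lock) :
    ∃ x rd wr bc, (f e).call = .lock (.rel x) ∧
      RelTrace lay (dRel (f e).thread x) (f e).thread x (runOf G f (f e)) rd wr bc ∧
      e.call.locs = {lay.cell x (.turn (f e).thread)} ∧ ((e = wr ∧ p = .aCW) ∨
        (e = bc ∧ ∃ n, n ≠ σ.threadNode (f e).thread ∧ p = .nrw n ∧ .nlr n ∈ G.stmp e)) := by
  have no_rdma : ∀ c, e.call ≠ .rdma c := fun c hc => by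
    obtain ⟨_, hr⟩ := hr
    exact absurd (hr.trans hc) (by simp)
  obtain ⟨x | x, hx⟩ := hc
  · obtain ⟨-, faa, wt, rd, poll, t⟩ := h.acq_trace (h.abs.maps e he) hx.symm
    rcases t.eq_or e ⟨he, rfl⟩ with h' | h' | h' | ⟨_, h'⟩
    · exact (no_rdma _ ((congrArg Event.call h').trans t.faa_call)).elim
    · exact (no_rdma _ ((congrArg Event.call h').trans t.wt_call)).elim
    · exact (no_rdma _ ((congrArg Event.call h').trans t.rd_call)).elim
    · rw [h.sv_stamp he h'] at hp
      obtain rfl : p = .aCR := hp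
      exact hw.elim
  · obtain ⟨-, rd, wr, bc, t⟩ := h.rel_trace (h.abs.maps e he) hx.symm
    refine ⟨x, rd, wr, bc, hx.symm, t, ?_⟩
    rcases t.eq_or e ⟨he, rfl⟩ with h' | h' | h'
    · exact (no_rdma _ ((congrArg Event.call h').trans t.rd_call)).elim
    · have hc : e.call = _ := (congrArg Event.call h').trans t.wr_call
      rw [h.sv_stamp he hc] at hp
      rw [hc]
      exact ⟨rfl, .inl ⟨h', hp⟩⟩
    · have hc : e.call = _ := (congrArg Event.call h').trans t.bc_call
      have hs := h.sv_stamp he hc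
      rw [hs] at hp
      obtain ⟨n, hn, rfl | rfl⟩ := hp
      · exact hw.elim
      · rw [hc, hs]
        exact ⟨rfl, .inr ⟨h', n, hn, rfl, n, hn, .inl rfl⟩⟩

section Acquire
variable {x : Loc} {a : Event Val (Call Val Loc Node Wid) T}
  {faa wt rd poll : Event Val (Call Val Loc Node Wid) T}
  (hc : a.call = .lock (.acq x))
  (t : AcqTrace lay (dAcq a.thread x) a.thread x (runOf G f a) faa wt rd poll)
include t

theorem poll_stamp : Stamp.aCR ∈ G.stmp poll := by
  obtain ⟨_, hc⟩ := t.poll_call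
  rw [h.sv_stamp t.poll_mem.1 hc]
  rfl

theorem faa_stamp : G.stmp faa = {.narr (σ.locNode (lay.cell x .dispenser)),
    .nrw (σ.locNode (lay.cell x .dispenser)), .nlw (σ.locNode (lay.cell x .dispenser))} := by
  have := h.rdma_stamp t.faa_mem.1 t.faa_call
  simpa only [RdmaCall.stamps, Set.mem_singleton_iff] using this

omit h in
theorem faa_mem_incrs :
    faa ∈ RdmaRun.incrs (G.restrict (Set.range Call.rdma)) (lay.cell x .dispenser) :=
  ⟨⟨t.faa_mem.1, t.faa_call ▸ ⟨_, rfl⟩⟩, _, _, t.faa_call⟩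

theorem faa_hb_rd :
    G.hb (faa, .nlw (σ.locNode (lay.cell x .dispenser))) (rd, .aCR) := by
  have hw : Stamp.aWT ∈ G.stmp wt := by
    have := h.rdma_stamp t.wt_mem.1 t.wt_call
    simp only [RdmaCall.stamps, Set.mem_singleton_iff] at this
    simp [this]
  have hpo : G.po faa wt := t.faa_wt
  have m₁ : faa ∈ (G.restrict (Set.range Call.rdma)).E := (faa_mem_incrs t).1
  have m₂ : wt ∈ (G.restrict (Set.range Call.rdma)).E :=
    ⟨t.wt_mem.1, t.wt_call ▸ ⟨_, rfl⟩⟩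
  have hn : Stamp.nlw (σ.locNode (lay.cell x .dispenser)) ∈ G.stmp faa := by
    rw [h.faa_stamp t]
    exact .inr (.inr rfl)
  have hpf : pfg (G.restrict (Set.range Call.rdma))
      (faa, .nlw (σ.locNode (lay.cell x .dispenser))) (wt, .aWT) := by
    refine ⟨⟨m₁, hn⟩, ⟨m₂, hw⟩, ⟨_, rfl⟩, rfl, ⟨hpo, m₁.2, m₂.2⟩, dAcq a.thread x, ?_, ?_⟩
    · rw [t.faa_call]; rfl
    · rw [t.wt_call]; rfl
  exact h.valid.hb_trans _ (wt, .aWT) _ (h.rdma.so_hb _ _ (.inr (.inr (.inl hpf)))).1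
    (h.hb_of_po hw (h.read_stamp t.rd_mem.1 t.rd_call) t.wt_rd trivial)

/-- The ticket fetch completes before the poll: its local write is awaited before the ticket is
read. -/
theorem faa_hb_poll :
    G.hb (faa, .narr (σ.locNode (lay.cell x .dispenser))) (poll, .aCR) := by
  refine h.valid.hb_trans _ _ _ (h.rdma.rfaa (faa_mem_incrs t).1 t.faa_call).2.2.1 ?_
  exact h.valid.hb_trans _ _ _ (h.faa_hb_rd t)
    (h.hb_of_po (h.read_stamp t.rd_mem.1 t.rd_call) (h.poll_stamp t) t.rd_poll trivial)

include hc

/-- The dispenser is written only by the ticket fetches. -/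
theorem dispenser_write (s : SubEvent Val (Call Val Loc Node Wid) Node T)
    (hs : s ∈ (G.restrict (Set.range Call.rdma)).Writes)
    (ls : rdmaLoc s = {lay.cell x .dispenser}) :
    s.1 ∈ RdmaRun.incrs (G.restrict (Set.range Call.rdma)) (lay.cell x .dispenser) ∧
      s.2 = .nrw (σ.locNode (lay.cell x .dispenser)) := by
  obtain ⟨e, p⟩ := s
  obtain ⟨⟨⟨he, hr⟩, hp⟩, hw⟩ := hs
  have hl : (f e).call ∈ Set.range Call.lock := by
    refine h.impl_of_loc t.faa_mem.1 he (t.faa_mem.2.symm ▸ hc ▸ ⟨_, rfl⟩)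
      (y := lay.cell x .dispenser) ?_ (rdmaLoc_subset (e, p) (ls ▸ rfl))
    rw [t.faa_call]
    exact .inr rfl
  obtain ⟨x', -, hc', ⟨hp', hl⟩ | ⟨-, hl⟩⟩ := h.rdma_write he hp hw hr hl
  · obtain ⟨rfl, -⟩ := lay.distinct _ _ _ _ (Set.singleton_injective (hl.symm.trans ls))
    exact ⟨⟨⟨he, hr⟩, _, _, hc'⟩, hp'⟩
  · exact nomatch (lay.distinct _ _ _ _ (Set.singleton_injective (hl.symm.trans ls))).2

/-- A private ticket is written only by the ticket fetches of its thread. -/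
theorem ticket_write {e : Event Val (Call Val Loc Node Wid) T} {p : Stamp Node}
    (hs : (e, p) ∈ (G.restrict (Set.range Call.rdma)).Writes)
    (ls : rdmaLoc (e, p) = {lay.cell x (.ticket a.thread)}) :
    (f e).call = .lock (.acq x) ∧ (f e).thread = a.thread ∧ (f e = a → e = faa) ∧
      p = .nlw (σ.locNode (lay.cell x .dispenser)) := by
  obtain ⟨⟨⟨he, hr⟩, hp⟩, hw⟩ := hs
  have hl : (f e).call ∈ Set.range Call.lock := by
    refine h.impl_of_loc t.faa_mem.1 he (t.faa_mem.2.symm ▸ hc ▸ ⟨_, rfl⟩)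
      (y := lay.cell x (.ticket a.thread)) ?_ (rdmaLoc_subset (e, p) (ls ▸ rfl))
    rw [t.faa_call]
    exact .inl rfl
  obtain ⟨x', hx', hc', ⟨-, hl⟩ | ⟨hp', hl⟩⟩ := h.rdma_write he hp hw hr hl
  · exact nomatch (lay.distinct _ _ _ _ (Set.singleton_injective (hl.symm.trans ls))).2
  · obtain ⟨rfl, ht⟩ := lay.distinct _ _ _ _ (Set.singleton_injective (hl.symm.trans ls))
    refine ⟨hx', Slot.ticket.inj ht, fun hfe => ?_, hp'⟩
    rcases t.eq_or e ⟨he, hfe⟩ with h' | h' | h' | ⟨_, h'⟩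
    · exact h'
    · exact absurd (hc'.symm.trans ((congrArg Event.call h').trans t.wt_call)) (by simp)
    · exact absurd (hc'.symm.trans ((congrArg Event.call h').trans t.rd_call)) (by simp)
    · exact absurd (hc'.symm.trans h') (by simp)

theorem faa_value : w.vR (faa, .narr (σ.locNode (lay.cell x .dispenser))) =
    RdmaRun.ticketNo σ (G.restrict (Set.range Call.rdma)) w (lay.cell x .dispenser) faa :=
  h.rdma.vR_eq_ticketNo (h.finite.subset fun _ he => he.1) (h.dispenser_write hc t)
    (faa_mem_incrs t)

/-- A read of the private ticket between an acquire and the next one of the same thread returns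
the ticket of that acquire. -/
theorem read_ticket {r : Event Val (Call Val Loc Node Wid) T} (hr : r ∈ G.E)
    (hrc : r.call = .rdma (.read (lay.cell x (.ticket a.thread))))
    (hb : G.hb (faa, .nlw (σ.locNode (lay.cell x .dispenser))) (r, .aCR))
    (hall : ∀ a' ∈ G'.E, a'.call = .lock (.acq x) → a'.thread = a.thread → a' ≠ a →
      G'.po a' a ∨ G'.po (f r) a') :
    r.out = RdmaRun.ticketNo σ (G.restrict (Set.range Call.rdma)) w
      (lay.cell x .dispenser) faa := by
  have hn : Stamp.narr (σ.locNode (lay.cell x .dispenser)) ∈ G.stmp faa := by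
    rw [h.faa_stamp t]; exact .inl rfl
  have hl : Stamp.nlw (σ.locNode (lay.cell x .dispenser)) ∈ G.stmp faa := by
    rw [h.faa_stamp t]; exact .inr (.inr rfl)
  have m₁ : faa ∈ (G.restrict (Set.range Call.rdma)).E := (faa_mem_incrs t).1
  have m₂ : r ∈ (G.restrict (Set.range Call.rdma)).E := ⟨hr, hrc ▸ ⟨_, rfl⟩⟩
  have hrs := h.read_stamp hr hrc
  have hrr : (r, Stamp.aCR) ∈ (G.restrict (Set.range Call.rdma)).Reads := ⟨⟨m₂, hrs⟩, trivial⟩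
  have hfw : (faa, Stamp.nlw (σ.locNode (lay.cell x .dispenser))) ∈
      (G.restrict (Set.range Call.rdma)).Writes := ⟨⟨m₁, hl⟩, trivial⟩
  rw [← h.faa_value hc t, h.rdma.wf.rmw_val faa _ ⟨m₁, hn⟩ hfw.1,
    ← h.rdma.wf.read_val r .aCR _ hrr hrc]
  refine (h.rdma.vW_eq_vR (y := lay.cell x (.ticket a.thread)) hfw hrr
    ?_ ?_ ⟨hb, m₁.2, m₂.2⟩ ?_).symm
  · simp [rdmaLoc, t.faa_call, RdmaCall.subLoc]
  · simp [rdmaLoc, hrc, RdmaCall.subLoc, RdmaCall.loc]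
  · rintro ⟨e, p⟩ hs ls
    obtain ⟨hec, het, hef, rfl⟩ := h.ticket_write hc t hs ls
    obtain ⟨⟨⟨he, her⟩, hep⟩, -⟩ := hs
    refine ⟨(nomatch ·), ?_⟩
    by_cases hfe : f e = a
    · exact .inl (by rw [hef hfe])
    -- Ticket writes of one thread to one node follow program order, and none overtakes the read.
    rcases hall _ (h.abs.maps e he) hec het hfe with hpo | hpo
    · rw [← t.faa_mem.2] at hpo
      exact .inr (.inl ⟨h.hb_of_po hep hl (h.po_of_po he t.faa_mem.1 hpo) rfl, her, m₁.2⟩)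
    · exact .inr (.inr ⟨h.hb_of_po hrs hep (h.po_of_po hr he hpo) trivial, m₂.2, her⟩)

theorem acq_rd_out (ha : a ∈ G'.E) : rd.out = RdmaRun.ticketNo σ
    (G.restrict (Set.range Call.rdma)) w (lay.cell x .dispenser) faa := by
  refine h.read_ticket hc t t.rd_mem.1 t.rd_call (h.faa_hb_rd t) fun a' ha' _ ht hne => ?_
  rw [t.rd_mem.2]
  exact h.ordered.total a' ha' a ha ht hne

end Acquire

omit h in
/-- The release `l` of `x` ends the critical section that the acquire `a` starts. -/
structure Matched (G' : Plain Val (Call Val Loc Node Wid) T) (x : Loc)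
    (a l : Event Val (Call Val Loc Node Wid) T) : Prop where
  acq_mem : a ∈ G'.E
  rel_mem : l ∈ G'.E
  acq : a.call = .lock (.acq x)
  rel : l.call = .lock (.rel x)
  po : G'.po a l
  between : ∀ c ∈ G'.E, c.call = .lock (.acq x) ∨ c.call = .lock (.rel x) →
    ¬ (G'.po a c ∧ G'.po c l)

theorem matched_unique {x : Loc} {a l l' : Event Val (Call Val Loc Node Wid) T}
    (m : Matched G' x a l) (m' : Matched G' x a l') : l = l' := by
  by_contra hne
  have ht : l.thread = l'.thread :=
    ((h.ordered.po_sub _ _ m.po).2.2).symm.trans (h.ordered.po_sub _ _ m'.po).2.2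
  rcases h.ordered.total l m.rel_mem l' m'.rel_mem ht hne with hp | hp
  · exact m'.between l m.rel_mem (.inr m.rel) ⟨m.po, hp⟩
  · exact m.between l' m'.rel_mem (.inr m'.rel) ⟨m'.po, hp⟩

/-- A release reads the ticket of the matching acquire, since the next acquire of the thread, which
overwrites it, comes later. -/
theorem rel_rd_out {x : Loc} {a l : Event Val (Call Val Loc Node Wid) T}
    (m : Matched G' x a l) {faa wt rd poll rd' wr bc : Event Val (Call Val Loc Node Wid) T}
    (t : AcqTrace lay (dAcq a.thread x) a.thread x (runOf G f a) faa wt rd poll)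
    (t' : RelTrace lay (dRel l.thread x) l.thread x (runOf G f l) rd' wr bc) :
    rd'.out = RdmaRun.ticketNo σ (G.restrict (Set.range Call.rdma)) w
      (lay.cell x .dispenser) faa := by
  have ht : a.thread = l.thread := (h.ordered.po_sub _ _ m.po).2.2
  have hpo : G.po rd rd' := h.po_of_po t.rd_mem.1 t'.rd_mem.1 (by
    rw [t.rd_mem.2, t'.rd_mem.2]
    exact m.po)
  refine h.read_ticket m.acq t t'.rd_mem.1 (ht ▸ t'.rd_call) (h.valid.hb_trans _ _ _
    (h.faa_hb_rd t) (h.hb_of_po (h.read_stamp t.rd_mem.1 t.rd_call)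
      (h.read_stamp t'.rd_mem.1 t'.rd_call) hpo trivial)) fun a' ha' hca' hta' hne => ?_
  rw [t'.rd_mem.2]
  refine (h.ordered.total a' ha' a m.acq_mem hta' hne).imp_right fun hp => ?_
  refine (h.ordered.total a' ha' l m.rel_mem (hta'.trans ht) ?_).resolve_left
    fun hp' => m.between a' ha' (.inl hca') ⟨hp, hp'⟩
  rintro rfl
  exact absurd (hca'.symm.trans m.rel) (by simp)

/-- A read of a turn variable by the lock implementation that does not return `0` reads from a
release, either from its write or, on another node, from its broadcast. -/
theorem exists_turn_rf {r : Event Val (Call Val Loc Node Wid) T} {q : Stamp Node}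
    (hr : (r, q) ∈ (G.restrict (Set.range Call.sv)).Reads)
    (hri : (f r).call ∈ Set.range Call.lock) {x : Loc} {z : Fin T}
    (hrl : svLoc (r, q) = {lay.cell x (.turn z)}) (h0 : u.vR (r, q) ≠ 0) :
    ∃ e p rd wr bc, e ∈ G.E ∧ u.rfOn (σ.threadNode r.thread) (e, p) (r, q) ∧
      u.vW (e, p) = u.vR (r, q) ∧ (f e).call = .lock (.rel x) ∧ (f e).thread = z ∧
      RelTrace lay (dRel (f e).thread x) (f e).thread x (runOf G f (f e)) rd wr bc ∧
      ((e = wr ∧ p = .aCW ∧ u.vW (e, p) = rd.out + 1) ∨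
        (e = bc ∧ p = .nrw (σ.threadNode r.thread) ∧
          σ.threadNode r.thread ≠ σ.threadNode z ∧
          .nlr (σ.threadNode r.thread) ∈ G.stmp e)) := by
  have hrn : (r, q) ∈ svReadsOn σ (G.restrict (Set.range Call.sv)) (σ.threadNode r.thread) :=
    ⟨hr, rfl⟩
  obtain ⟨⟨e, p⟩, hrf⟩ : ∃ s, u.rfOn (σ.threadNode r.thread) s (r, q) := by
    by_contra hn
    exact h0 (h.sv.wf.rf_zero _ _ hrn hn)
  obtain ⟨⟨⟨⟨he, hes⟩, hep⟩, hpn⟩, -⟩ := h.sv.wf.rf_sub _ _ _ hrf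
  obtain ⟨hloc, hval⟩ := h.sv.wf.rf_match _ _ _ hrf
  have hep : p ∈ G.stmp e := hep
  have hpn : (p = .aCW ∧ _) ∨ p = .nrw (σ.threadNode r.thread) := hpn
  have hw : p.IsWrite := by rcases hpn with ⟨rfl, -⟩ | rfl <;> trivial
  have hel : lay.cell x (.turn z) ∈ e.call.locs :=
    svLoc_subset (e, p) (hloc.trans hrl ▸ Set.mem_singleton _)
  have hei : (f e).call ∈ Set.range Call.lock :=
    h.impl_of_loc hr.1.1.1 he hri (svLoc_subset (r, q) (hrl ▸ Set.mem_singleton _)) hel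
  obtain ⟨x', rd, wr, bc, hfe, t, hlocs, hcase⟩ := h.sv_write he hep hw hes hei
  rw [hlocs] at hel
  obtain ⟨rfl, hzt⟩ := lay.distinct _ _ _ _ (Set.mem_singleton_iff.1 hel)
  have hz : z = (f e).thread := Slot.turn.inj hzt
  refine ⟨e, p, rd, wr, bc, he, hrf, hval, hfe, hz.symm, t, hcase.imp ?_ ?_⟩
  · rintro ⟨rfl, rfl⟩
    exact ⟨rfl, rfl, h.sv.wf.write_val e .aCW _ _ ⟨⟨⟨he, hes⟩, hep⟩, trivial⟩ t.wr_call⟩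
  · rintro ⟨rfl, n, hn, rfl, hnl⟩
    obtain ⟨h', -⟩ | h' := hpn
    · exact absurd h' (by simp)
    · obtain rfl : n = _ := Stamp.nrw.inj h'
      exact ⟨rfl, rfl, hz ▸ hn, hnl⟩

/-- The poll that ends an acquire with a nonzero ticket happens after the write of a release that
passes the turn to this ticket. The broadcast of that write may have picked up the write of a
later release, in which case the latter is the one to consider. -/
theorem exists_release_hb_poll {x : Loc} {a faa wt rd poll : Event Val (Call Val Loc Node Wid) T}
    (hc : a.call = .lock (.acq x))
    (t : AcqTrace lay (dAcq a.thread x) a.thread x (runOf G f a) faa wt rd poll)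
    (h0 : poll.out ≠ 0) :
    ∃ l ∈ G'.E, l.call = .lock (.rel x) ∧ ∃ rd' wr bc,
      RelTrace lay (dRel l.thread x) l.thread x (runOf G f l) rd' wr bc ∧
      rd'.out + 1 = poll.out ∧ G.hb (wr, .aCW) (poll, .aCR) := by
  obtain ⟨z, hz⟩ := t.poll_call
  have hpE : poll ∈ G.E := t.poll_mem.1
  have hpr : (poll, Stamp.aCR) ∈ (G.restrict (Set.range Call.sv)).Reads :=
    ⟨⟨⟨hpE, hz ▸ ⟨_, rfl⟩⟩, h.poll_stamp t⟩, trivial⟩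
  have hpv := h.sv.wf.read_val poll .aCR _ hpr hz
  have hpi : (f poll).call ∈ Set.range Call.lock := by
    rw [t.poll_mem.2, hc]
    exact ⟨_, rfl⟩
  have hpl : svLoc (poll, (.aCR : Stamp Node)) = {lay.cell x (.turn z)} := by
    simp [svLoc, hz, SvCall.loc]
  have rfe : ∀ {s r : SubEvent Val (Call Val Loc Node Wid) Node T} {n : Node},
      u.rfOn n s r → ¬ u.rfi (G.restrict (Set.range Call.sv)) s r → G.hb s r :=
    fun hs hn => (h.sv.so_hb _ _ (.inr (.inl ⟨⟨_, hs⟩, hn⟩))).1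
  obtain ⟨e, p, rd', wr, bc, he, hrf, hval, hfe, hth, t', h' | h'⟩ :=
    h.exists_turn_rf hpr hpi hpl (hpv ▸ h0)
  · obtain ⟨rfl, rfl, hv⟩ := h'
    refine ⟨f e, h.abs.maps e he, hfe, rd', e, bc, t', hv.symm.trans (hval.trans hpv), ?_⟩
    by_cases hi : u.rfi (G.restrict (Set.range Call.sv)) (e, .aCW) (poll, .aCR)
    -- A thread may read its own write early, but here the write precedes the fetch of the ticket.
    · have hpo : G.po e poll := hi.2.2.1.1
      have hne : f e ≠ f poll := fun h' => by
        rw [t.poll_mem.2] at h'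
        exact absurd (hfe.symm.trans ((congrArg Event.call h').trans hc)) (by simp)
      have hpo' : G.po e faa := by
        refine h.po_of_po he t.faa_mem.1 ?_
        rw [t.faa_mem.2, ← t.poll_mem.2]
        exact (h.abs.po_iff e he poll hpE hne).1 hpo
      refine h.valid.hb_trans _ _ _ (h.hb_of_po (q := .narr _) ?_ ?_ hpo' trivial)
        (h.faa_hb_poll t)
      · rw [h.sv_stamp he t'.wr_call]
        rfl
      · rw [h.faa_stamp t]
        exact .inl rfl
    · exact rfe hrf hi
  · obtain ⟨rfl, rfl, hn, hnl⟩ := h'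
    -- The broadcast does not target the node of its thread, so its local read is from a CPU write.
    have heS : e ∈ (G.restrict (Set.range Call.sv)).E := ⟨he, t'.bc_call ▸ ⟨_, rfl⟩⟩
    have hrS : (e, Stamp.nlr (σ.threadNode poll.thread)) ∈
        (G.restrict (Set.range Call.sv)).Reads := ⟨⟨heS, hnl⟩, trivial⟩
    have hwS := (h.sv.wf.rf_sub _ _ _ hrf).1.1
    have hbv := h.sv.wf.bcast_val e _ hrS.1 hwS
    have hel : svLoc (e, Stamp.nlr (σ.threadNode poll.thread)) = {lay.cell x (.turn z)} := by
      simp [svLoc, t'.bc_call, SvCall.loc, hth]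
    obtain ⟨e₂, p₂, rd₂, wr₂, bc₂, he₂, hrf₂, hval₂, hfe₂, hth₂, t₂, h' | h'⟩ :=
      h.exists_turn_rf hrS (hfe ▸ ⟨_, rfl⟩) hel (by rw [hbv, hval, hpv]; exact h0)
    · obtain ⟨rfl, rfl, hv⟩ := h'
      refine ⟨f e₂, h.abs.maps e₂ he₂, hfe₂, rd₂, e₂, bc₂, t₂,
        hv.symm.trans (hval₂.trans (hbv.trans (hval.trans hpv))), ?_⟩
      refine h.valid.hb_trans _ _ _ (rfe hrf₂ fun hi => absurd hi.2.1 (by simp)) ?_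
      refine h.valid.hb_trans _ _ _ (h.sv.so_hb _ _ (.inl ⟨hrS.1, hwS, rfl, _, _, _,
        t'.bc_call, _, ?_, rfl, rfl⟩)).1 (rfe hrf fun hi => absurd hi.1 (by simp))
      exact hth ▸ hn
    · rw [← hth, h.thread_eq he] at h'
      exact absurd rfl h'.2.2.1

/-- Mutual exclusion: if `a₀` fetches its ticket before `a`, then the release matching `a₀` happens
before the poll that ends `a`. The turn of `a` comes from the acquire with the preceding ticket,
to which the claim applies inductively. -/
theorem release_hb_poll [CharZero Val] {x : Loc}
    (hm : ∀ l ∈ G'.E, l.call = .lock (.rel x) → ∃ a, Matched G' x a l)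
    {a faa wt rd poll : Event Val (Call Val Loc Node Wid) T} (ha : a ∈ G'.E)
    (hc : a.call = .lock (.acq x))
    (t : AcqTrace lay (dAcq a.thread x) a.thread x (runOf G f a) faa wt rd poll)
    {a₀ l faa₀ wt₀ rd₀ poll₀ rd' wr bc : Event Val (Call Val Loc Node Wid) T}
    (m : Matched G' x a₀ l)
    (t₀ : AcqTrace lay (dAcq a₀.thread x) a₀.thread x (runOf G f a₀) faa₀ wt₀ rd₀ poll₀)
    (t' : RelTrace lay (dRel l.thread x) l.thread x (runOf G f l) rd' wr bc)
    (hlt : RdmaRun.incrLt σ (G.restrict (Set.range Call.rdma)) w (lay.cell x .dispenser)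
      faa₀ faa) : G.hb (wr, .aCW) (poll, .aCR) := by
  have hfin : (G.restrict (Set.range Call.rdma)).E.Finite := h.finite.subset fun _ he => he.1
  induction hk : RdmaRun.ticketNo σ (G.restrict (Set.range Call.rdma)) w
      (lay.cell x .dispenser) faa using Nat.strong_induction_on
      generalizing a faa wt rd poll with
  | _ k ih =>
    have hlt' := h.rdma.ticketNo_lt hfin hlt
    have hout : poll.out = (k : Val) := by
      rw [t.poll_out, h.acq_rd_out hc t ha, hk]
    obtain ⟨l₁, hl₁, hc₁, rd₁, wr₁, bc₁, t₁, hv, hb⟩ :=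
      h.exists_release_hb_poll hc t (by rw [hout]; exact Nat.cast_ne_zero.2 (by omega))
    obtain ⟨a₁, m₁⟩ := hm l₁ hl₁ hc₁
    obtain ⟨-, faa₁, wt₁, rda₁, poll₁, s₁⟩ := h.acq_trace m₁.acq_mem m₁.acq
    rw [h.rel_rd_out m₁ s₁ t₁, hout, ← Nat.cast_succ, Nat.cast_inj] at hv
    -- The acquire `a₁` has the ticket preceding that of `a`, hence is `a₀` or comes later.
    by_cases heq : faa₀ = faa₁
    · obtain rfl : a₀ = a₁ := by rw [← t₀.faa_mem.2, heq, s₁.faa_mem.2]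
      obtain rfl := h.matched_unique m m₁
      rcases t₁.eq_or wr t'.wr_mem with h' | h' | h'
      · exact absurd (t'.wr_call.symm.trans ((congrArg Event.call h').trans t₁.rd_call)) (by simp)
      · exact h' ▸ hb
      · exact absurd (t'.wr_call.symm.trans ((congrArg Event.call h').trans t₁.bc_call)) (by simp)
    · have hlt₁ : RdmaRun.incrLt σ (G.restrict (Set.range Call.rdma)) w (lay.cell x .dispenser)
          faa₀ faa₁ := by
        refine (h.rdma.incrLt_total.total _ (faa_mem_incrs t₀) _ (faa_mem_incrs s₁)
          heq).resolve_right fun h' => ?_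
        have := h.rdma.ticketNo_lt hfin h'
        omega
      have hpo : G.po poll₁ wr₁ := h.po_of_po s₁.poll_mem.1 t₁.wr_mem.1 (by
        rw [s₁.poll_mem.2, t₁.wr_mem.2]
        exact m₁.po)
      refine h.valid.hb_trans _ _ _ (ih _ (by omega) m₁.acq_mem m₁.acq s₁ hlt₁ rfl) ?_
      refine h.valid.hb_trans _ _ _ (h.hb_of_po (h.poll_stamp s₁) ?_ hpo trivial) hb
      rw [h.sv_stamp t₁.wr_mem.1 t₁.wr_call]
      rfl

end LockRun
end Lock

/-! ### The abstract execution -/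

section Abstract
variable {Val Loc Node Wid : Type*} {T : ℕ}

/-- The plain execution `G'` with the stamps of `G` on the events outside the lock library, and
without synchronisation. -/
def lockBase (G : Exec Val (Call Val Loc Node Wid) Node T)
    (G' : Plain Val (Call Val Loc Node Wid) T) : Exec Val (Call Val Loc Node Wid) Node T where
  toPlain := G'
  stmp e := match e.call with
    | .lock c => c.stamps
    | _ => G.stmp e
  so _ _ := False
  hb _ _ := False

/-- The subevent of the implementation that represents a subevent of the original program: an
acquire takes effect at its last poll, and a release at its write of the turn variable. -/
def lockPoint (poll wr : Event Val (Call Val Loc Node Wid) T → Event Val (Call Val Loc Node Wid) T)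
    (s : SubEvent Val (Call Val Loc Node Wid) Node T) :
    SubEvent Val (Call Val Loc Node Wid) Node T :=
  match s.1.call with
  | .lock (.acq _) => (poll s.1, .aCR)
  | .lock (.rel _) => (wr s.1, .aCW)
  | _ => s

/-- The synchronisation that the lock library exports for the orders `lo` of acquires. -/
def lockSo (G : Exec Val (Call Val Loc Node Wid) Node T)
    (lo : Loc → Event Val (Call Val Loc Node Wid) T → Event Val (Call Val Loc Node Wid) T → Prop)
    (s₁ s₂ : SubEvent Val (Call Val Loc Node Wid) Node T) : Prop :=
  ∃ x, s₁.2 = .aCW ∧ s₂.2 = .aMF ∧ ∃ a, imm (lockPo G x) a s₁.1 ∧ lo x a s₂.1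

/-- The acquires of `x`, ordered by the remote-atomic order of their ticket fetches. -/
def ticketLo [One Val] (σ : Sys Val Loc Node T) (lay : Layout σ)
    (G : Exec Val (Call Val Loc Node Wid) Node T) (w : RdmaWit Val Loc Node Wid T)
    (A : Loc → Set (Event Val (Call Val Loc Node Wid) T))
    (faa : Event Val (Call Val Loc Node Wid) T → Event Val (Call Val Loc Node Wid) T) (x : Loc)
    (a b : Event Val (Call Val Loc Node Wid) T) : Prop :=
  RdmaRun.incrLt σ (G.restrict (Set.range Call.rdma)) w (lay.cell x .dispenser) (faa a) (faa b) ∧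
    a ∈ A x ∧ b ∈ A x

/-- The execution of the original program. Each library contributes its own synchronisation, and
happens-before is that of the implementation at the representing subevents. -/
def lockExec [AddMonoidWithOne Val] (σ : Sys Val Loc Node T) (lay : Layout σ)
    (G : Exec Val (Call Val Loc Node Wid) Node T) (G' : Plain Val (Call Val Loc Node Wid) T)
    (w : RdmaWit Val Loc Node Wid T) (u : SvWit Val Loc Node Wid T)
    (faa poll wr : Event Val (Call Val Loc Node Wid) T → Event Val (Call Val Loc Node Wid) T) :
    Exec Val (Call Val Loc Node Wid) Node T where
  toPlain := G'
  stmp := (lockBase G G').stmp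
  so s₁ s₂ :=
    rdmaSo ((lockBase G G').restrict (Set.range Call.rdma))
      (w.restrict ((lockBase G G').restrict (Set.range Call.rdma))) s₁ s₂ ∨
    SvWit.svSo σ ((lockBase G G').restrict (Set.range Call.sv))
      (u.restrict ((lockBase G G').restrict (Set.range Call.sv))) s₁ s₂ ∨
    (LockWellFormed ((lockBase G G').restrict (Set.range Call.lock)) ∧
      lockSo ((lockBase G G').restrict (Set.range Call.lock))
        (ticketLo σ lay G w (acquires ((lockBase G G').restrict (Set.range Call.lock))) faa)
        s₁ s₂)
  hb s₁ s₂ := s₁ ∈ (lockBase G G').SE ∧ s₂ ∈ (lockBase G G').SE ∧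
    G.hb (lockPoint poll wr s₁) (lockPoint poll wr s₂)

theorem rdma_notMem_lock : ∀ c ∈ Set.range (Call.rdma : _ → Call Val Loc Node Wid),
    c ∉ Set.range Call.lock := by
  rintro _ ⟨c, rfl⟩ ⟨_, h⟩
  cases h

theorem sv_notMem_lock : ∀ c ∈ Set.range (Call.sv : _ → Call Val Loc Node Wid),
    c ∉ Set.range Call.lock := by
  rintro _ ⟨c, rfl⟩ ⟨_, h⟩
  cases h

theorem Stamp.sto_narr_of_sto_aMF {p : Stamp Node} (hp : p.sto .aMF) (n : Node) :
    p.sto (.narr n) := by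
  cases p <;> trivial

theorem svLoc_eq_locs {s : SubEvent Val (Call Val Loc Node Wid) Node T}
    (hs : s.1.call ∈ Set.range Call.sv) : svLoc s = s.1.call.locs := by
  obtain ⟨⟨t, i, c, v⟩, a⟩ := s
  obtain ⟨c, rfl⟩ := hs
  rfl

theorem lockPoint_of_notMem
    {poll wr : Event Val (Call Val Loc Node Wid) T → Event Val (Call Val Loc Node Wid) T}
    {s : SubEvent Val (Call Val Loc Node Wid) Node T} (hs : s.1.call ∉ Set.range Call.lock) :
    lockPoint poll wr s = s := by
  obtain ⟨⟨t, i, c, v⟩, a⟩ := s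
  cases c with
  | lock c => exact absurd ⟨c, rfl⟩ hs
  | _ => rfl

theorem lockPoint_acq
    {poll wr : Event Val (Call Val Loc Node Wid) T → Event Val (Call Val Loc Node Wid) T}
    {e : Event Val (Call Val Loc Node Wid) T} {p : Stamp Node} {x : Loc}
    (he : e.call = .lock (.acq x)) : lockPoint poll wr (e, p) = (poll e, .aCR) := by
  simp only [lockPoint, he]

theorem lockPoint_rel
    {poll wr : Event Val (Call Val Loc Node Wid) T → Event Val (Call Val Loc Node Wid) T}
    {e : Event Val (Call Val Loc Node Wid) T} {p : Stamp Node} {x : Loc}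
    (he : e.call = .lock (.rel x)) : lockPoint poll wr (e, p) = (wr e, .aCW) := by
  simp only [lockPoint, he]

theorem lockBase_stmp_of_notMem {G : Exec Val (Call Val Loc Node Wid) Node T}
    {G' : Plain Val (Call Val Loc Node Wid) T} {e : Event Val (Call Val Loc Node Wid) T}
    (he : e.call ∉ Set.range Call.lock) : (lockBase G G').stmp e = G.stmp e := by
  obtain ⟨t, i, c, v⟩ := e
  cases c with
  | lock c => exact absurd ⟨c, rfl⟩ he
  | _ => rfl

theorem lockBase_stmp_lock {G : Exec Val (Call Val Loc Node Wid) Node T}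
    {G' : Plain Val (Call Val Loc Node Wid) T} {e : Event Val (Call Val Loc Node Wid) T}
    {c : LockCall Loc} (he : e.call = .lock c) : (lockBase G G').stmp e = c.stamps := by
  obtain ⟨t, i, c', v⟩ := e
  obtain rfl : c' = _ := he
  rfl

theorem matched_of_imm {G : Exec Val (Call Val Loc Node Wid) Node T}
    {G' : Plain Val (Call Val Loc Node Wid) T} {x : Loc} {a l : Event Val (Call Val Loc Node Wid) T}
    (hi : imm (lockPo ((lockBase G G').restrict (Set.range Call.lock)) x) a l)
    (ha : a ∈ acquires ((lockBase G G').restrict (Set.range Call.lock)) x)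
    (hl : l ∈ releases ((lockBase G G').restrict (Set.range Call.lock)) x) :
    LockRun.Matched G' x a l where
  acq_mem := ha.1.1
  rel_mem := hl.1.1
  acq := ha.2
  rel := hl.2
  po := hi.1.1.1
  between c hc hx hb := by
    have hcL : c.call ∈ Set.range Call.lock := by
      rcases hx with hx | hx <;> exact hx ▸ ⟨_, rfl⟩
    have hcm : c ∈ acquires ((lockBase G G').restrict (Set.range Call.lock)) x ∪
        releases ((lockBase G G').restrict (Set.range Call.lock)) x :=
      hx.imp (fun hx => ⟨⟨hc, hcL⟩, hx⟩) (fun hx => ⟨⟨hc, hcL⟩, hx⟩)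
    exact hi.2 ⟨c, ⟨⟨hb.1, ha.1.2, hcL⟩, .inl ha, hcm⟩, ⟨⟨hb.2, hcL, hl.1.2⟩, hcm, .inr hl⟩⟩

variable [AddMonoidWithOne Val] {σ : Sys Val Loc Node T}

namespace LockRun
variable {lay : Layout σ} {dAcq dRel : Fin T → Loc → Wid}
  {G : Exec Val (Call Val Loc Node Wid) Node T} {G' : Plain Val (Call Val Loc Node Wid) T}
  {f : Event Val (Call Val Loc Node Wid) T → Event Val (Call Val Loc Node Wid) T}
  {w : RdmaWit Val Loc Node Wid T} {u : SvWit Val Loc Node Wid T}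
  (h : LockRun lay dAcq dRel G G' f w u)
include h

theorem f_eq_of_mem {e : Event Val (Call Val Loc Node Wid) T} (he : e ∈ G'.E)
    (hc : e.call ∉ Set.range Call.lock) : e ∈ G.E ∧ f e = e :=
  ⟨(h.abs.fixed e he hc).1, ((h.abs.fixed e he hc).2 e (h.abs.fixed e he hc).1).2 rfl⟩

theorem f_eq_of_notMem {e : Event Val (Call Val Loc Node Wid) T} (he : e ∈ G.E)
    (hc : (f e).call ∉ Set.range Call.lock) : f e = e :=
  (((h.abs.fixed _ (h.abs.maps e he) hc).2 e he).1 rfl).symm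

/-- Outside the lock library, the original program runs a part of the inlined one. -/
theorem subExec {C : Set (Call Val Loc Node Wid)} (hC : ∀ c ∈ C, c ∉ Set.range Call.lock) :
    SubExec ((lockBase G G').restrict C) (G.restrict C) where
  E_sub e he := ⟨(h.f_eq_of_mem he.1 (hC _ he.2)).1, he.2⟩
  po_sub a b hab := ⟨⟨(h.ordered.po_sub a b hab.1).1, hab.2.1⟩,
    ⟨(h.ordered.po_sub a b hab.1).2.1, hab.2.2⟩⟩
  po_iff a ha b hb := by
    obtain ⟨ha', hfa⟩ := h.f_eq_of_mem ha.1 (hC _ ha.2)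
    obtain ⟨hb', hfb⟩ := h.f_eq_of_mem hb.1 (hC _ hb.2)
    refine and_congr_left fun _ => ?_
    by_cases hab : a = b
    · subst hab
      exact iff_of_false (h.ordered.irrefl a) (h.valid.po_irrefl a)
    · have := h.abs.po_iff a ha' b hb' (by rwa [hfa, hfb])
      rw [hfa, hfb] at this
      exact this.symm
  stmp e he := lockBase_stmp_of_notMem (G' := G') (hC _ he.2)

/-- No event outside the lock implementation reads from one inside. -/
theorem rf_closed (s₁ s₂ : SubEvent Val (Call Val Loc Node Wid) Node T) (hrf : w.rf s₁ s₂)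
    (h₂ : s₂.1 ∈ ((lockBase G G').restrict (Set.range Call.rdma)).E) :
    s₁.1 ∈ ((lockBase G G').restrict (Set.range Call.rdma)).E := by
  obtain ⟨⟨⟨⟨he, hr⟩, hp⟩, hw⟩, -⟩ := h.rdma.wf.rf_sub _ _ hrf
  have hn : (f s₁.1).call ∉ Set.range Call.lock := fun hl => by
    have hs₂ := rdma_notMem_lock _ h₂.2
    obtain ⟨y, hy⟩ : (rdmaLoc s₁).Nonempty := by
      obtain ⟨x, -, -, ⟨-, hl⟩ | ⟨-, hl⟩⟩ := h.rdma_write he hp hw hr hl <;>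
        exact Set.nonempty_of_mem (Set.ext_iff.1 hl _ |>.2 rfl)
    obtain ⟨hm, hf⟩ := h.f_eq_of_mem h₂.1 hs₂
    refine hs₂ (hf ▸ h.impl_of_loc he hm hl (rdmaLoc_subset _ hy) (rdmaLoc_subset s₂ ?_))
    rwa [← (h.rdma.wf.rf_match _ _ hrf).1]
  exact ⟨h.f_eq_of_notMem he hn ▸ h.abs.maps _ he, hr⟩

/-- No event outside the lock implementation reads a shared variable from one inside. -/
theorem rfOn_closed (n : Node) (s₁ s₂ : SubEvent Val (Call Val Loc Node Wid) Node T)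
    (hrf : u.rfOn n s₁ s₂)
    (h₂ : s₂.1 ∈ ((lockBase G G').restrict (Set.range Call.sv)).E) :
    s₁.1 ∈ ((lockBase G G').restrict (Set.range Call.sv)).E := by
  obtain ⟨⟨⟨⟨he, hr⟩, hp⟩, hw⟩, -⟩ := h.sv.wf.rf_sub _ _ _ hrf
  have hw : s₁.2.IsWrite := by
    rcases hw with ⟨hw, -⟩ | hw <;> rw [hw] <;> trivial
  have hn : (f s₁.1).call ∉ Set.range Call.lock := fun hl => by
    have hs₂ := sv_notMem_lock _ h₂.2
    obtain ⟨x, -, -, -, -, -, hlocs, -⟩ := h.sv_write he hp hw hr hl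
    obtain ⟨hm, hf⟩ := h.f_eq_of_mem h₂.1 hs₂
    refine hs₂ (hf ▸ h.impl_of_loc he hm hl (hlocs ▸ Set.mem_singleton _) (svLoc_subset s₂ ?_))
    rw [← (h.sv.wf.rf_match _ _ _ hrf).1, svLoc_eq_locs hr, hlocs]
    rfl
  exact ⟨h.f_eq_of_notMem he hn ▸ h.abs.maps _ he, hr⟩

/-- In a lock-well-formed execution, the only immediate successor of an acquire is a release. -/
theorem mem_releases_of_imm {x : Loc} {a l : Event Val (Call Val Loc Node Wid) T}
    (hwf : LockWellFormed ((lockBase G G').restrict (Set.range Call.lock)))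
    (hi : imm (lockPo ((lockBase G G').restrict (Set.range Call.lock)) x) a l)
    (ha : a ∈ acquires ((lockBase G G').restrict (Set.range Call.lock)) x) :
    l ∈ releases ((lockBase G G').restrict (Set.range Call.lock)) x := by
  obtain ⟨r, hr, hi'⟩ := (hwf x).1 a ha
  by_cases hne : l = r
  · exact hne ▸ hr
  have hl := hi.1.2.2
  have hal := h.ordered.po_sub _ _ hi.1.1.1
  have har := h.ordered.po_sub _ _ hi'.1.1.1
  rcases h.ordered.total l hal.2.1 r har.2.1 (hal.2.2.symm.trans har.2.2) hne with hp | hp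
  · exact absurd ⟨l, hi.1, ⟨⟨hp, hi.1.1.2.2, hr.1.2⟩, hl, .inr hr⟩⟩ hi'.2
  · exact absurd ⟨r, hi'.1, ⟨⟨hp, hr.1.2, hi.1.1.2.2⟩, .inr hr, hl⟩⟩ hi.2

section Exec
variable {faa poll wr : Event Val (Call Val Loc Node Wid) T → Event Val (Call Val Loc Node Wid) T}
  (hacq : ∀ a ∈ G'.E, ∀ x, a.call = .lock (.acq x) → ∃ wt rd,
    AcqTrace lay (dAcq a.thread x) a.thread x (runOf G f a) (faa a) wt rd (poll a))
  (hrel : ∀ l ∈ G'.E, ∀ x, l.call = .lock (.rel x) → ∃ rd bc,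
    RelTrace lay (dRel l.thread x) l.thread x (runOf G f l) rd (wr l) bc)
include hacq

theorem ticketLo_total (x : Loc) : StrictTotalOn (ticketLo σ lay G w
    (acquires ((lockBase G G').restrict (Set.range Call.lock))) faa x)
    (acquires ((lockBase G G').restrict (Set.range Call.lock)) x) where
  sub _ _ hab := hab.2
  irrefl _ haa := h.rdma.incrLt_total.irrefl _ haa.1
  trans _ _ _ hab hbc := ⟨h.rdma.incrLt_total.trans _ _ _ hab.1 hbc.1, hab.2.1, hbc.2.2⟩
  total a ha b hb hne := by
    obtain ⟨_, _, ta⟩ := hacq a ha.1.1 x ha.2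
    obtain ⟨_, _, tb⟩ := hacq b hb.1.1 x hb.2
    exact (h.rdma.incrLt_total.total _ (faa_mem_incrs ta) _ (faa_mem_incrs tb)
      (fun e => hne (by rw [← ta.faa_mem.2, e, tb.faa_mem.2]))).imp
      (fun h => ⟨h, ha, hb⟩) (fun h => ⟨h, hb, ha⟩)

include hrel

/-- The subevent representing `s` belongs to `G`, and the stamps ordered after that of `s` are
ordered after its own stamp. -/
theorem lockPoint_spec {s : SubEvent Val (Call Val Loc Node Wid) Node T}
    (hs : s ∈ (lockBase G G').SE) :
    lockPoint poll wr s ∈ G.SE ∧ f (lockPoint poll wr s).1 = s.1 ∧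
      ∀ p, s.2.sto p → (lockPoint poll wr s).2.sto p := by
  obtain ⟨e, p⟩ := s
  obtain ⟨he, hp⟩ := hs
  by_cases hc : e.call ∈ Set.range Call.lock
  · obtain ⟨x | x, hx⟩ := hc
    · obtain ⟨_, _, t⟩ := hacq e he x hx.symm
      rw [lockPoint_acq hx.symm]
      exact ⟨⟨t.poll_mem.1, h.poll_stamp t⟩, t.poll_mem.2, fun _ _ => trivial⟩
    · obtain ⟨_, _, t⟩ := hrel e he x hx.symm
      rw [lockPoint_rel hx.symm]
      rw [lockBase_stmp_lock hx.symm] at hp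
      obtain rfl : p = .aCW := hp
      refine ⟨⟨t.wr_mem.1, ?_⟩, t.wr_mem.2, fun _ h => h⟩
      rw [h.sv_stamp t.wr_mem.1 t.wr_call]
      rfl
  · rw [lockPoint_of_notMem hc]
    rw [lockBase_stmp_of_notMem hc] at hp
    obtain ⟨hm, hf⟩ := h.f_eq_of_mem he hc
    exact ⟨⟨hm, hp⟩, hf, fun _ h => h⟩

/-- Preserved program order is reflected by the implementation. A write before an acquire is not
ordered with the poll directly, but with the fetch of the ticket. -/
theorem hb_lockPoint_of_ppo {s₁ s₂ : SubEvent Val (Call Val Loc Node Wid) Node T}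
    (hs : (lockBase G G').ppo s₁ s₂) :
    G.hb (lockPoint poll wr s₁) (lockPoint poll wr s₂) := by
  obtain ⟨h₁, h₂, hpo, hst⟩ := hs
  obtain ⟨m₁, f₁, o₁⟩ := h.lockPoint_spec hacq hrel h₁
  obtain ⟨m₂, f₂, -⟩ := h.lockPoint_spec hacq hrel h₂
  have hpo' : G.po (lockPoint poll wr s₁).1 (lockPoint poll wr s₂).1 :=
    h.po_of_po m₁.1 m₂.1 (by rw [f₁, f₂]; exact hpo)
  obtain ⟨e, p⟩ := s₂
  obtain ⟨he, hp⟩ := h₂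
  by_cases hc : e.call ∈ Set.range Call.lock
  · obtain ⟨x | x, hx⟩ := hc
    · obtain ⟨_, _, t⟩ := hacq e he x hx.symm
      rw [lockPoint_acq hx.symm]
      rw [lockBase_stmp_lock hx.symm] at hp
      obtain rfl : p = .aMF := hp
      have hpo₁ : G.po (lockPoint poll wr s₁).1 (faa e) := by
        refine h.po_of_po m₁.1 t.faa_mem.1 ?_
        rw [f₁, t.faa_mem.2]
        exact hpo
      refine h.valid.hb_trans _ _ _ (h.hb_of_po m₁.2 (q := .narr _) ?_ hpo₁
        (Stamp.sto_narr_of_sto_aMF (o₁ _ hst) _)) (h.faa_hb_poll t)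
      rw [h.faa_stamp t]
      exact .inl rfl
    · rw [lockPoint_rel hx.symm] at hpo' m₂ ⊢
      rw [lockBase_stmp_lock hx.symm] at hp
      obtain rfl : p = .aCW := hp
      exact h.hb_of_po m₁.2 m₂.2 hpo' (o₁ _ hst)
  · rw [lockPoint_of_notMem (s := (e, p)) hc] at hpo' m₂ ⊢
    exact h.hb_of_po m₁.2 m₂.2 hpo' (o₁ _ hst)

variable [CharZero Val]

/-- The synchronisation exported by the lock library is enforced by the implementation. -/
theorem hb_lockPoint_of_lockSo {s₁ s₂ : SubEvent Val (Call Val Loc Node Wid) Node T}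
    (hwf : LockWellFormed ((lockBase G G').restrict (Set.range Call.lock)))
    (hs : lockSo ((lockBase G G').restrict (Set.range Call.lock))
      (ticketLo σ lay G w (acquires ((lockBase G G').restrict (Set.range Call.lock))) faa)
      s₁ s₂) :
    s₁ ∈ (lockBase G G').SE ∧ s₂ ∈ (lockBase G G').SE ∧ s₁.1.call ∈ Set.range Call.lock ∧
      s₂.1.call ∈ Set.range Call.lock ∧
      G.hb (lockPoint poll wr s₁) (lockPoint poll wr s₂) := by
  obtain ⟨l, p⟩ := s₁
  obtain ⟨b, q⟩ := s₂
  obtain ⟨x, rfl, rfl, a, hi, hlt, ha, hb⟩ := hs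
  have hl := h.mem_releases_of_imm hwf hi ha
  have m := matched_of_imm hi ha hl
  refine ⟨⟨hl.1.1, ?_⟩, ⟨hb.1.1, ?_⟩, hl.1.2, hb.1.2, ?_⟩
  · rw [lockBase_stmp_lock hl.2]
    rfl
  · rw [lockBase_stmp_lock hb.2]
    rfl
  · obtain ⟨_, _, ta⟩ := hacq a m.acq_mem x m.acq
    obtain ⟨_, _, tb⟩ := hacq b hb.1.1 x hb.2
    obtain ⟨_, _, tl⟩ := hrel l m.rel_mem x m.rel
    rw [lockPoint_rel m.rel, lockPoint_acq hb.2]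
    refine h.release_hb_poll (fun l hl hc => ?_) hb.1.1 hb.2 tb m ta tl hlt
    have hl' : l ∈ releases ((lockBase G G').restrict (Set.range Call.lock)) x :=
      ⟨⟨hl, hc ▸ ⟨_, rfl⟩⟩, hc⟩
    obtain ⟨a, ha, hi⟩ := (hwf x).2 l hl'
    exact ⟨a, matched_of_imm hi ha hl'⟩

/-- The synchronisation of the abstract execution is contained in its happens-before. -/
theorem lockExec_so {s₁ s₂ : SubEvent Val (Call Val Loc Node Wid) Node T}
    (hs : (lockExec σ lay G G' w u faa poll wr).so s₁ s₂) :
    (lockExec σ lay G G' w u faa poll wr).hb s₁ s₂ := by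
  rcases hs with hs | hs | ⟨hwf, hs⟩
  · obtain ⟨h₁, h₂⟩ := RdmaWit.so_mem (h.rdma.wf.restrict (h.subExec rdma_notMem_lock)
      h.rf_closed) hs
    refine ⟨⟨h₁.1.1, h₁.2⟩, ⟨h₂.1.1, h₂.2⟩, ?_⟩
    rw [lockPoint_of_notMem (rdma_notMem_lock _ h₁.1.2),
      lockPoint_of_notMem (rdma_notMem_lock _ h₂.1.2)]
    exact (h.rdma.so_hb _ _ (RdmaWit.so_sub (h.subExec rdma_notMem_lock) h.rdma.wf
      h.rf_closed hs)).1
  · obtain ⟨h₁, h₂⟩ := SvWit.so_mem (SvWit.WellFormed.restrict (h.subExec sv_notMem_lock) h.sv.wf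
      h.rfOn_closed) hs
    refine ⟨⟨h₁.1.1, h₁.2⟩, ⟨h₂.1.1, h₂.2⟩, ?_⟩
    rw [lockPoint_of_notMem (sv_notMem_lock _ h₁.1.2),
      lockPoint_of_notMem (sv_notMem_lock _ h₂.1.2)]
    exact (h.sv.so_hb _ _ (SvWit.so_sub (h.subExec sv_notMem_lock) h.sv.wf h.rfOn_closed hs)).1
  · obtain ⟨h₁, h₂, -, -, hb⟩ := h.hb_lockPoint_of_lockSo hacq hrel hwf hs
    exact ⟨h₁, h₂, hb⟩

theorem lockExec_valid : (lockExec σ lay G G' w u faa poll wr).Valid where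
  po_sub := h.ordered.po_sub
  po_irrefl := h.ordered.irrefl
  po_trans := h.ordered.trans
  po_total := h.ordered.total
  stmp_nonempty e he := by
    by_cases hc : e.call ∈ Set.range Call.lock
    · obtain ⟨x | x, hx⟩ := hc
      · exact ⟨.aMF, by rw [lockExec, lockBase_stmp_lock hx.symm]; rfl⟩
      · exact ⟨.aCW, by rw [lockExec, lockBase_stmp_lock hx.symm]; rfl⟩
    · rw [lockExec, lockBase_stmp_of_notMem hc]
      exact h.valid.stmp_nonempty e (h.f_eq_of_mem he hc).1
  so_sub _ _ hs := ⟨(h.lockExec_so hacq hrel hs).1, (h.lockExec_so hacq hrel hs).2.1⟩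
  hb_sub _ _ hs := ⟨hs.1, hs.2.1⟩
  hb_trans _ _ _ hs hs' := ⟨hs.1, hs'.2.1, h.valid.hb_trans _ _ _ hs.2.2 hs'.2.2⟩
  hb_irrefl _ hs := h.valid.hb_irrefl _ hs.2.2
  so_hb _ _ hs := h.lockExec_so hacq hrel hs
  ppo_hb _ _ hs := ⟨hs.1, hs.2.1, h.hb_lockPoint_of_ppo hacq hrel hs⟩

/-- Each synchronisation edge comes from one library. -/
theorem lockExec_so_cases {s₁ s₂ : SubEvent Val (Call Val Loc Node Wid) Node T}
    (hs : (lockExec σ lay G G' w u faa poll wr).so s₁ s₂) :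
    (rdmaSo ((lockBase G G').restrict (Set.range Call.rdma))
      (w.restrict ((lockBase G G').restrict (Set.range Call.rdma))) s₁ s₂ ∧
      s₁.1.call ∈ Set.range Call.rdma ∧ s₂.1.call ∈ Set.range Call.rdma) ∨
    (SvWit.svSo σ ((lockBase G G').restrict (Set.range Call.sv))
      (u.restrict ((lockBase G G').restrict (Set.range Call.sv))) s₁ s₂ ∧
      s₁.1.call ∈ Set.range Call.sv ∧ s₂.1.call ∈ Set.range Call.sv) ∨
    ((LockWellFormed ((lockBase G G').restrict (Set.range Call.lock)) ∧
      lockSo ((lockBase G G').restrict (Set.range Call.lock))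
        (ticketLo σ lay G w (acquires ((lockBase G G').restrict (Set.range Call.lock))) faa)
        s₁ s₂) ∧
      s₁.1.call ∈ Set.range Call.lock ∧ s₂.1.call ∈ Set.range Call.lock) := by
  rcases hs with hs | hs | ⟨hwf, hs⟩
  · obtain ⟨h₁, h₂⟩ := RdmaWit.so_mem (h.rdma.wf.restrict (h.subExec rdma_notMem_lock)
      h.rf_closed) hs
    exact .inl ⟨hs, h₁.1.2, h₂.1.2⟩
  · obtain ⟨h₁, h₂⟩ := SvWit.so_mem (SvWit.WellFormed.restrict (h.subExec sv_notMem_lock) h.sv.wf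
      h.rfOn_closed) hs
    exact .inr (.inl ⟨hs, h₁.1.2, h₂.1.2⟩)
  · obtain ⟨-, -, h₁, h₂, -⟩ := h.hb_lockPoint_of_lockSo hacq hrel hwf hs
    exact .inr (.inr ⟨⟨hwf, hs⟩, h₁, h₂⟩)

theorem lockExec_rdma : RdmaConsistent σ
    ((lockExec σ lay G G' w u faa poll wr).restrict (Set.range Call.rdma)) := by
  have hsub := h.subExec rdma_notMem_lock
  refine rdmaConsistent_of_sub (G := G.restrict (Set.range Call.rdma)) (w := w)
    ⟨hsub.E_sub, hsub.po_sub, hsub.po_iff, hsub.stmp⟩ h.rdma.wf h.rdma.ib_irrefl h.rdma.stamped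
    h.rf_closed fun s₁ s₂ => ⟨fun hs => ?_, fun hs => ?_⟩
  · rcases h.lockExec_so_cases hacq hrel hs.1 with hs' | ⟨-, ⟨_, hs'⟩, -⟩ | ⟨-, hs', -⟩
    · exact hs'.1
    · obtain ⟨_, hs⟩ := hs.2.1
      cases hs.trans hs'.symm
    · exact absurd hs' (rdma_notMem_lock _ hs.2.1)
  · obtain ⟨h₁, h₂⟩ := RdmaWit.so_mem (h.rdma.wf.restrict hsub h.rf_closed) hs
    exact ⟨.inl hs, h₁.1.2, h₂.1.2⟩

theorem lockExec_sv : SvConsistent σ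
    ((lockExec σ lay G G' w u faa poll wr).restrict (Set.range Call.sv)) := by
  have hsub := h.subExec sv_notMem_lock
  refine svConsistent_of_sub (G := G.restrict (Set.range Call.sv)) (w := u)
    ⟨hsub.E_sub, hsub.po_sub, hsub.po_iff, hsub.stmp⟩ h.sv.wf h.sv.rb_not_po h.sv.stamped
    h.rfOn_closed fun s₁ s₂ => ⟨fun hs => ?_, fun hs => ?_⟩
  · rcases h.lockExec_so_cases hacq hrel hs.1 with ⟨-, ⟨_, hs'⟩, -⟩ | hs' | ⟨-, hs', -⟩
    · obtain ⟨_, hs⟩ := hs.2.1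
      cases hs.trans hs'.symm
    · exact hs'.1
    · exact absurd hs' (sv_notMem_lock _ hs.2.1)
  · obtain ⟨h₁, h₂⟩ := SvWit.so_mem (SvWit.WellFormed.restrict hsub h.sv.wf h.rfOn_closed) hs
    exact ⟨.inr (.inl hs), h₁.1.2, h₂.1.2⟩

theorem lockExec_wlock : WLockConsistent σ
    ((lockExec σ lay G G' w u faa poll wr).restrict (Set.range Call.lock)) := by
  intro hwf
  refine ⟨fun e he c hc => ⟨lockBase_stmp_lock (G' := G') hc, ?_⟩, _, h.ticketLo_total hacq,
    fun s₁ s₂ => ⟨fun hs => ?_, fun hs => ?_⟩⟩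
  · obtain x | x := c
    · exact (h.acq_trace he.1 hc).1
    · exact (h.rel_trace he.1 hc).1
  · rcases h.lockExec_so_cases hacq hrel hs.1 with ⟨-, ⟨_, hs'⟩, -⟩ | ⟨-, ⟨_, hs'⟩, -⟩ | hs'
    · obtain ⟨_, hs⟩ := hs.2.1
      cases hs.trans hs'.symm
    · obtain ⟨_, hs⟩ := hs.2.1
      cases hs.trans hs'.symm
    · exact hs'.1.2
  · obtain ⟨-, -, h₁, h₂, -⟩ := h.hb_lockPoint_of_lockSo hacq hrel hwf hs
    exact ⟨.inr (.inr ⟨hwf, hs⟩), h₁, h₂⟩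

theorem lockExec_consistent
    (hev : ∀ e ∈ G.E, e.call ∈ Set.range Call.rdma ∨ e.call ∈ Set.range Call.sv) :
    Consistent (insert (wlockLib σ) {rdmaLib σ, svLib σ})
      (lockExec σ lay G G' w u faa poll wr) where
  valid := h.lockExec_valid hacq hrel
  lib := by
    rintro L (rfl | rfl | rfl)
    · exact h.lockExec_wlock hacq hrel
    · exact h.lockExec_rdma hacq hrel
    · exact h.lockExec_sv hacq hrel
  events e he := by
    by_cases hc : e.call ∈ Set.range Call.lock
    · exact ⟨_, .inl rfl, hc⟩
    · rcases hev e (h.f_eq_of_mem he hc).1 with hc | hc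
      · exact ⟨_, .inr (.inl rfl), hc⟩
      · exact ⟨_, .inr (.inr rfl), hc⟩
  sync s₁ s₂ hs := by
    rcases h.lockExec_so_cases hacq hrel hs with hs | hs | hs
    · exact ⟨_, .inr (.inl rfl), hs.2⟩
    · exact ⟨_, .inr (.inr rfl), hs.2⟩
    · exact ⟨_, .inl rfl, hs.2⟩

end Exec

theorem exists_consistent [CharZero Val]
    (hev : ∀ e ∈ G.E, e.call ∈ Set.range Call.rdma ∨ e.call ∈ Set.range Call.sv) :
    ∃ H : Exec Val (Call Val Loc Node Wid) Node T,
      Consistent (insert (wlockLib σ) {rdmaLib σ, svLib σ}) H ∧ H.toPlain = G' := by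
  have hacq : ∀ a, ∃ faa poll, a ∈ G'.E → ∀ x, a.call = .lock (.acq x) → ∃ wt rd,
      AcqTrace lay (dAcq a.thread x) a.thread x (runOf G f a) faa wt rd poll := by
    intro a
    by_cases ha : a ∈ G'.E ∧ ∃ x, a.call = .lock (.acq x)
    · obtain ⟨ha, x, hx⟩ := ha
      obtain ⟨-, faa, wt, rd, poll, t⟩ := h.acq_trace ha hx
      refine ⟨faa, poll, fun _ x' hx' => ?_⟩
      obtain rfl : x = x' := by simpa using hx.symm.trans hx'
      exact ⟨wt, rd, t⟩
    · exact ⟨a, a, fun ha' x hx => absurd ⟨ha', x, hx⟩ ha⟩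
  have hrel : ∀ l, ∃ wr, l ∈ G'.E → ∀ x, l.call = .lock (.rel x) → ∃ rd bc,
      RelTrace lay (dRel l.thread x) l.thread x (runOf G f l) rd wr bc := by
    intro l
    by_cases hl : l ∈ G'.E ∧ ∃ x, l.call = .lock (.rel x)
    · obtain ⟨hl, x, hx⟩ := hl
      obtain ⟨-, rd, wr, bc, t⟩ := h.rel_trace hl hx
      refine ⟨wr, fun _ x' hx' => ?_⟩
      obtain rfl : x = x' := by simpa using hx.symm.trans hx'
      exact ⟨rd, bc, t⟩
    · exact ⟨l, fun hl' x hx => absurd ⟨hl', x, hx⟩ hl⟩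
  choose faa poll hacq using hacq
  choose wr hrel using hrel
  exact ⟨_, h.lockExec_consistent hacq hrel hev, rfl⟩

end LockRun

theorem mem_callLoc_of_mem_locs {c : Call Val Loc Node Wid} {y : Loc} (hy : y ∈ c.locs) :
    y ∈ callLoc ({rdmaLib σ, svLib σ} : Set (Library Val (Call Val Loc Node Wid) Loc Node T))
      c := by
  cases c with
  | rdma c => exact ⟨_, .inl rfl, ⟨c, rfl⟩, hy⟩
  | sv c => exact ⟨_, .inr rfl, ⟨c, rfl⟩, hy⟩
  | lock c => exact hy.elim

theorem wlockImpl_sound [CharZero Val] (lay : Layout σ) (dAcq dRel : Fin T → Loc → Wid) :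
    Sound {rdmaLib σ, svLib σ} (wlockLib σ) (wlockImpl lay dAcq dRel) := by
  rintro p hdisj v ⟨G, hG, Gs, hsem, hpar⟩
  obtain ⟨hst, w, hw, hib, hso⟩ := hG.lib (rdmaLib σ) (.inl rfl)
  obtain ⟨hst', u, hu, hrb, hso'⟩ := hG.lib (svLib σ) (.inr rfl)
  have hP : ∀ t, ∀ e ∈ (Gs t).E, ReturnsUnit σ e := fun t e he => by
    have he : e ∈ G.E := by
      rw [hpar]
      exact Set.mem_iUnion.2 ⟨t, he⟩
    exact ⟨fun c hc => (hst e ⟨he, c, hc.symm⟩ c hc).2.2,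
      fun c hc => (hst' e ⟨he, c, hc.symm⟩ c hc).2⟩
  have habs := fun t => Sem.abstract (C := Set.range Call.lock) (key := wlockKey lay dAcq dRel)
    (u := σ.unit) (fun _ _ hc _ _ _ => wlockImpl_no_break lay dAcq dRel hc)
    (fun _ _ hc _ _ => exists_wlockKey lay dAcq dRel hc) (p t) (hsem t) (hP t)
  choose Gs' fs hsem' habs using habs
  have hpar' := Abstracts.par habs (fun t => (hsem t).ordered.2) (fun t => (hsem' t).ordered.2)
    (fun t => (hsem t).ordered.1) (fun t => (hsem' t).ordered.1)
  have hp' : ProgSem p v (Plain.par Gs') := ⟨Gs', hsem', rfl⟩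
  have hsub : ∀ {c : Call Val Loc Node Wid} {y : Loc}, y ∈ callLoc {rdmaLib σ, svLib σ} c →
      y ∈ callLoc (insert (wlockLib σ) {rdmaLib σ, svLib σ}) c :=
    fun ⟨L, hL, h⟩ => ⟨L, .inr hL, h⟩
  rw [← hpar] at hpar'
  have run : LockRun lay dAcq dRel G (Plain.par Gs') (fun e => fs e.thread e) w u := {
    valid := hG.valid
    finite := by
      rw [hpar]
      exact (Plain.ordered_par (fun t => (hsem t).ordered.1) fun t => (hsem t).ordered.2).finite
    ordered := Plain.ordered_par (fun t => (hsem' t).ordered.1) fun t => (hsem' t).ordered.2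
    abs := hpar'
    rdma := ⟨hG.valid.restrict _, hst, hw, hib,
      fun s₁ s₂ hs => (hG.valid.restrict _).so_hb _ _ ((hso s₁ s₂).2 hs)⟩
    sv := ⟨hG.valid.restrict _, hst', hu, hrb,
      fun s₁ s₂ hs => (hG.valid.restrict _).so_hb _ _ ((hso' s₁ s₂).2 hs)⟩
    separate := by
      intro a ha b hb hac hbc
      refine Set.disjoint_left.2 fun y hya hyb => ?_
      refine Set.disjoint_left.1 hdisj (show y ∈ _ from ?_) ?_
      · obtain ⟨G₀, s, hE, -⟩ := hpar'.run _ (hpar'.maps a ha) hac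
        exact ⟨_, _, _, _, G₀, hac, s, a, hE ▸ ⟨ha, rfl⟩, mem_callLoc_of_mem_locs hya⟩
      · have hm := hpar'.maps b hb
        have hfb := ((hpar'.fixed _ hm hbc).2 b hb).1 rfl
        exact ⟨v, _, hp', b, hfb ▸ hm, hsub (mem_callLoc_of_mem_locs hyb)⟩ }
  obtain ⟨H, hH, hHG⟩ := run.exists_consistent fun e he => by
    obtain ⟨L, rfl | rfl, hc⟩ := hG.events e he
    · exact .inl hc
    · exact .inr hc
  exact ⟨H, hH, hHG ▸ hp'⟩

end Abstract

end Mowgli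

theorem mainTheorem3 {Val Loc Node Wid : Type*} [AddMonoidWithOne Val] [CharZero Val] {T : ℕ}
    (σ : Mowgli.Sys Val Loc Node T) (lay : Mowgli.Layout σ) (dAcq dRel : Fin T → Loc → Wid) :
    Mowgli.WellDefined {Mowgli.rdmaLib σ, Mowgli.svLib σ} (Mowgli.wlockLib σ)
        (Mowgli.wlockImpl lay dAcq dRel) ∧
      Mowgli.Sound {Mowgli.rdmaLib σ, Mowgli.svLib σ} (Mowgli.wlockLib σ)
        (Mowgli.wlockImpl lay dAcq dRel) := by
  exact ⟨Mowgli.wlockImpl_wellDefined lay dAcq dRel, Mowgli.wlockImpl_sound lay dAcq dRel⟩
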